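/- Let $M$ be a closed $3$-manifold with a genus $g\ge 0$ Heegaard splitting $M=H^+\cup H^-$, where $H^+\cap H^-=\partial H^+=\partial H^-=\Sigma$ is an oriented smooth surface (so $M$ is connected and orientable). Let $m_1^\pm,\dots,m_g^\pm\subset\Sigma$ be oriented smooth simple closed curves that bound the discs of a minimal meridional disc system of $H^\pm$ (disjoint properly embedded discs cutting $H^\pm$ into a single ball), and assume that every $m_i^+$ is transverse to every $m_j^-$. The associated Gauss diagram has one oriented circle $\mu_i^\pm$ for each curve $m_i^\pm$, and for each intersection point of $m_i^+$ with $m_j^-$ a chord joining its preimages on $\mu_i^+$ and $\mu_j^-$. The sign of the chord is $+1$ if the frame (tangent to $m_i^+$, tangent to $m_j^-$) agrees with the orientation of $\Sigma$, and $-1$ otherwise. Let $a_{ij}$ be the sum of the signs of the chords joining $\mu_j^-$ to $\mu_i^+$, and let $A=(a_{ij})_{1\le i,j\le g}$. Then $H_1(M;\mathbb Z)$ is the abelian group generated by $g_1,\dots,g_g$ with the relations $\sum_{i=1}^g a_{ij}\,g_i=0$ for $j=1,\dots,g$, where $g_i$ corresponds to $\mu_i^+$ in the following sense: every smooth closed curve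 $\gamma$ on $\Sigma$ transverse to all the $m_i^+$ represents $\sum_i (m_i^+\cdot\gamma)\,g_i$, where $m_i^+\cdot\gamma$ is the algebraic intersection number on $\Sigma$ (with the same sign convention). Moreover, $M$ is an integral homology sphere, i.e. $H_k(M;\mathbb Z)\cong H_k(S^3;\mathbb Z)$ for all $k\ge 0$, if and only if $\det A=\pm1$. -/

import Mathlib

open scoped Manifold ContDiff Topology

noncomputable section

namespace HeegaardGauss

/-- The Euclidean plane, on which the splitting surfaces are modelled. -/
abbrev Plane : Type := EuclideanSpace ℝ (Fin 2)

/-! ### Singular homology with integer coefficients -/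

/-- The integral singular homology group `H_k(X; ℤ)`. -/
abbrev Homology (k : ℕ) (X : Type) [TopologicalSpace X] : ModuleCat.{0} ℤ :=
  ((AlgebraicTopology.singularHomologyFunctor (ModuleCat.{0} ℤ) k).obj
    (ModuleCat.of ℤ ℤ)).obj (TopCat.of X)

/-- The integral singular chain complex of `X`. -/
abbrev chains (X : Type) [TopologicalSpace X] : ChainComplex (ModuleCat.{0} ℤ) ℕ :=
  ((AlgebraicTopology.singularChainComplexFunctor (ModuleCat.{0} ℤ)).obj
    (ModuleCat.of ℤ ℤ)).obj (TopCat.of X)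

/-- The singular `1`-simplex obtained by running once around a loop `γ : ℝ/ℤ → X`, with the edge
`Δ¹ = {(s₀, s₁) : s₀ + s₁ = 1}` parametrised by `s₁ ∈ [0, 1]`. -/
def loopSimplex {X : Type} [TopologicalSpace X] (γ : C(UnitAddCircle, X)) :
    (TopCat.toSSet.obj (TopCat.of X)).obj (.op (SimplexCategory.mk 1)) :=
  ((TopCat.of X).toSSetObjEquiv (.op (SimplexCategory.mk 1))).symm
    ⟨fun s => γ ((s.1 1 : ℝ) : UnitAddCircle), by
      refine γ.continuous.comp ((AddCircle.continuous_mk' (1 : ℝ)).comp ?_)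
      exact (continuous_apply _).comp continuous_subtype_val⟩

/-- `c ∈ H₁(X; ℤ)` is the homology class of the loop `γ`: it is the class of the singular
`1`-cycle consisting of the simplex of `γ` with coefficient `1`. -/
def IsLoopClass {X : Type} [TopologicalSpace X] (γ : C(UnitAddCircle, X))
    (c : Homology 1 X) : Prop :=
  ∃ z : (chains X).cycles 1,
    (chains X).iCycles 1 z =
      (TopCat.toSSet.obj (TopCat.of X)).ιChainComplex (R := ModuleCat.of ℤ ℤ)
        (loopSimplex γ) (1 : ℤ) ∧
    (chains X).homologyπ 1 z = c

/-- `X` has the integral homology of the `3`-sphere, in every degree. For a closed `3`-manifold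
this is the property of being a homology sphere. -/
def IsHomologySphere (X : Type) [TopologicalSpace X] : Prop :=
  ∀ k : ℕ, Nonempty
    (Homology k X ≃ₗ[ℤ] Homology k (Metric.sphere (0 : EuclideanSpace ℝ (Fin 4)) 1))

/-! ### Curves on an oriented surface -/

section Curves

variable (S : Type) [TopologicalSpace S] [ChartedSpace Plane S]

/-- The given atlas of the surface `S` is an oriented atlas: all its coordinate changes have
positive Jacobian determinant. -/
def IsOrientedAtlas : Prop :=
  ∀ e ∈ atlas Plane S, ∀ e' ∈ atlas Plane S, ∀ x ∈ (e.symm.trans e').source,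
    0 < (fderiv ℝ (e.symm.trans e') x).det

/-- A smooth oriented closed curve on `S`, parametrised by the circle `ℝ/ℤ` (possibly with
self-intersections). -/
structure ClosedCurve where
  toFun : UnitAddCircle → S
  smooth : ContMDiff 𝓘(ℝ) (𝓡 2) ∞ (fun t : ℝ => toFun (t : UnitAddCircle))

variable {S}

/-- The velocity vector of a closed curve at the parameter `θ`, in the preferred chart at the
point `α θ`. -/
def ClosedCurve.velocity (α : ClosedCurve S) (θ : UnitAddCircle) : Plane :=
  deriv (fun u : ℝ => chartAt Plane (α.toFun θ) (α.toFun (θ + (u : UnitAddCircle)))) 0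

variable (S) in
/-- A smoothly embedded oriented circle on `S`. -/
structure SimpleClosedCurve extends ClosedCurve S where
  injective : Function.Injective toFun
  immersed : ∀ θ, toClosedCurve.velocity θ ≠ 0

/-- The determinant of the frame `(v, w)` of the plane. -/
def frameDet (v w : Plane) : ℝ := v 0 * w 1 - v 1 * w 0

/-- The curves `α` and `β` are transverse: at each common point their tangents form a frame. -/
def Transverse (α β : ClosedCurve S) : Prop :=
  ∀ θ η, α.toFun θ = β.toFun η → frameDet (α.velocity θ) (β.velocity η) ≠ 0

/-- The sign of an intersection point `α θ = β η` of transverse curves: `1` if the frame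
(tangent to `α`, tangent to `β`) is positive and `-1` otherwise. (The frame is read in a chart of
the atlas; when the atlas is oriented the choice of the chart does not matter.) -/
def crossingSign (α β : ClosedCurve S) (θ η : UnitAddCircle) : ℤˣ :=
  if 0 < frameDet (α.velocity θ) (β.velocity η) then 1 else -1

/-- The algebraic number of intersections of two transverse closed curves. (The sum is finite by
`finite_crossings`.) -/
def algebraicIntersection (α β : ClosedCurve S) : ℤ :=
  ∑ᶠ x : {x : UnitAddCircle × UnitAddCircle // α.toFun x.1 = β.toFun x.2},
    (crossingSign α β x.1.1 x.1.2 : ℤ)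

end Curves

/-! ### Helper facts: closed curves are continuous, transverse ones meet finitely often -/

section Helpers

variable {S : Type} [TopologicalSpace S] [ChartedSpace Plane S]

theorem ClosedCurve.continuous (α : ClosedCurve S) : Continuous α.toFun := by
  have h := α.smooth.continuous
  exact (QuotientAddGroup.isQuotientMap_mk (N := AddSubgroup.zmultiples (1 : ℝ))).continuous_iff.2 h

theorem ClosedCurve.hasDerivAt [IsManifold (𝓡 2) ∞ S] (α : ClosedCurve S) (θ : UnitAddCircle) :
    HasDerivAt (fun u : ℝ => chartAt Plane (α.toFun θ) (α.toFun (θ + (u : UnitAddCircle))))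
      (α.velocity θ) 0 := by
  obtain ⟨t, rfl⟩ := QuotientAddGroup.mk_surjective θ
  have h1 : ContMDiff 𝓘(ℝ) (𝓡 2) ∞
      (fun u : ℝ => α.toFun (((t : ℝ) : UnitAddCircle) + (u : UnitAddCircle))) := by
    have h2 : ContMDiff 𝓘(ℝ) 𝓘(ℝ) ∞ (fun u : ℝ => t + u) :=
      (contDiff_const.add contDiff_id).contMDiff
    exact α.smooth.comp h2
  have h3 := (contMDiffAt_iff.1 (h1 0)).2
  simp only [mfld_simps, contDiffWithinAt_univ] at h3
  have h4 := h3.differentiableAt (by simp)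
  have e : (((t : ℝ) : UnitAddCircle) + ((0 : ℝ) : UnitAddCircle)) = (t : UnitAddCircle) := by
    simp
  rw [e] at h4
  exact h4.hasDerivAt

theorem frameDet_injective {v w : Plane} (h : frameDet v w ≠ 0) {a b : ℝ}
    (hab : a • v - b • w = 0) : a = 0 ∧ b = 0 := by
  have h0 : a * v 0 - b * w 0 = 0 := by simpa using congrArg (fun z : Plane => z 0) hab
  have h1 : a * v 1 - b * w 1 = 0 := by simpa using congrArg (fun z : Plane => z 1) hab
  have ha : a * frameDet v w = 0 := by unfold frameDet; linear_combination w 1 * h0 - w 0 * h1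
  have hb : b * frameDet v w = 0 := by unfold frameDet; linear_combination v 1 * h0 - v 0 * h1
  exact ⟨(mul_eq_zero.1 ha).resolve_right h, (mul_eq_zero.1 hb).resolve_right h⟩

theorem finite_crossings [IsManifold (𝓡 2) ∞ S] [T2Space S] (α β : ClosedCurve S)
    (h : Transverse α β) :
    {x : UnitAddCircle × UnitAddCircle | α.toFun x.1 = β.toFun x.2}.Finite := by
  set T := {x : UnitAddCircle × UnitAddCircle | α.toFun x.1 = β.toFun x.2} with hT
  have hclosed : IsClosed T :=
    isClosed_eq (α.continuous.comp continuous_fst) (β.continuous.comp continuous_snd)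
  by_contra hinf
  obtain ⟨⟨θ, η⟩, hx, hacc⟩ :=
    Set.Infinite.exists_accPt_of_subset_isCompact hinf hclosed.isCompact le_rfl
  have hp : α.toFun θ = β.toFun η := hx
  have hα := α.hasDerivAt θ
  have hβ := β.hasDerivAt η
  rw [← hp] at hβ
  set φ := chartAt Plane (α.toFun θ)
  have hF := (HasFDerivAt.comp ((0, 0) : ℝ × ℝ) (f := Prod.fst) (f' := .fst ℝ ℝ ℝ)
      hα.hasFDerivAt hasFDerivAt_fst).sub
    (HasFDerivAt.comp ((0, 0) : ℝ × ℝ) (f := Prod.snd) (f' := .snd ℝ ℝ ℝ)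
      hβ.hasFDerivAt hasFDerivAt_snd)
  have hne := hF.eventually_ne (c := 0) (by
    have hinj := LinearMap.exists_antilipschitzWith
      (((ContinuousLinearMap.toSpanSingleton ℝ (α.velocity θ)).comp
          (ContinuousLinearMap.fst ℝ ℝ ℝ) -
        (ContinuousLinearMap.toSpanSingleton ℝ (β.velocity η)).comp
          (ContinuousLinearMap.snd ℝ ℝ ℝ) : ℝ × ℝ →L[ℝ] Plane) : ℝ × ℝ →ₗ[ℝ] Plane) (by
      rw [LinearMap.ker_eq_bot']
      rintro ⟨a, b⟩ hab
      have := frameDet_injective (h θ η hp) (a := a) (b := b) (by simpa using hab)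
      simp [this])
    obtain ⟨K, -, hK⟩ := hinj
    exact ⟨K, hK⟩)
  rw [eventually_nhdsWithin_iff] at hne
  have hmap : Filter.map (fun u : ℝ × ℝ => ((θ + (u.1 : UnitAddCircle), η + (u.2 : UnitAddCircle)) :
      UnitAddCircle × UnitAddCircle)) (𝓝 (0, 0)) = 𝓝 (θ, η) := by
    have ho : ∀ ζ : UnitAddCircle, IsOpenMap (fun u : ℝ => ζ + (u : UnitAddCircle)) := fun ζ =>
      (isOpenMap_add_left ζ).comp QuotientAddGroup.isOpenMap_coe
    have hc : ∀ ζ : UnitAddCircle, Continuous (fun u : ℝ => ζ + (u : UnitAddCircle)) := fun ζ =>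
      continuous_const.add (AddCircle.continuous_mk' (1 : ℝ))
    have := ((ho θ).prodMap (ho η)).map_nhds_eq (x := ((0, 0) : ℝ × ℝ))
      ((hc θ).prodMap (hc η)).continuousAt
    simp only [AddCircle.coe_zero, add_zero, Prod.map_apply] at this
    exact this
  have hev : ∀ᶠ y in 𝓝 ((θ, η) : UnitAddCircle × UnitAddCircle), y ≠ (θ, η) → y ∉ T := by
    rw [← hmap, Filter.eventually_map]
    filter_upwards [hne] with u hu hy hyT
    refine hu ?_ ?_
    · rintro rfl
      exact hy (by simp)
    · have : α.toFun (θ + (u.1 : UnitAddCircle)) = β.toFun (η + (u.2 : UnitAddCircle)) := hyT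
      simp [this]
  rw [accPt_iff_frequently] at hacc
  exact hacc (hev.mono fun y hy hy' => hy hy'.1 hy'.2)

end Helpers

/-! ### Gauss diagrams -/

/-- A Gauss diagram with two families `μ₁⁺, …, μ_g⁺` and `μ₁⁻, …, μ_g⁻` of disjoint oriented
circles (copies of `ℝ/ℤ`, indexed by `Fin g`): finitely many signed chords, each joining a point of
a circle of the top family to a point of a circle of the bottom family, with distinct chords
having distinct ends. -/
structure GaussDiagram (g : ℕ) where
  Chord : Type
  finite : Finite Chord
  topEnd : Chord → Fin g × UnitAddCircle
  botEnd : Chord → Fin g × UnitAddCircle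
  topEnd_injective : Function.Injective topEnd
  botEnd_injective : Function.Injective botEnd
  sign : Chord → ℤˣ

open Classical in
/-- The intersection matrix `A = (a_ij)`: `a_ij` is the algebraic number of chords (the sum of their
signs) joining the circle `μ_j⁻` to the circle `μ_i⁺`. -/
def GaussDiagram.intersectionMatrix {g : ℕ} (G : GaussDiagram g) : Matrix (Fin g) (Fin g) ℤ :=
  letI := G.finite
  letI := Fintype.ofFinite G.Chord
  fun i j => ∑ h : G.Chord,
    if (G.topEnd h).1 = i ∧ (G.botEnd h).1 = j then (G.sign h : ℤ) else 0

/-! ### Heegaard diagrams -/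

/-- The standard handlebody of genus `g` in `ℝ³`: a planar disc with `g` holes, thickened. The disc
is the rectangle `[0, 2g+1] × [0, 3]`, the `i`-th hole is the square `(2i+1, 2i+2) × (1, 2)`. -/
def stdHandlebody (g : ℕ) : Set (ℝ × ℝ × ℝ) :=
  {p | p.1 ∈ Set.Icc 0 (2 * g + 1 : ℝ) ∧ p.2.1 ∈ Set.Icc 0 3 ∧ p.2.2 ∈ Set.Icc 0 1 ∧
    ∀ i : Fin g, ¬(p.1 ∈ Set.Ioo (2 * (i : ℝ) + 1) (2 * (i : ℝ) + 2) ∧ p.2.1 ∈ Set.Ioo 1 2)}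

/-- The `i`-th disc of the standard minimal meridional disc system: the thickened arc from the
`i`-th hole to the outer boundary. Cutting the standard handlebody along these `g` discs leaves a
single ball. -/
def stdMeridianDisc {g : ℕ} (i : Fin g) : Set (ℝ × ℝ × ℝ) :=
  {p | p.1 = 2 * (i : ℝ) + 3 / 2 ∧ p.2.1 ∈ Set.Icc 0 1 ∧ p.2.2 ∈ Set.Icc 0 1}

/-- A handlebody of genus `g` in `M` together with a minimal meridional disc system: the
homeomorphic image of the standard pair. (Any minimal meridional disc system of a handlebody `H`,
i.e. any system of `g` disjoint properly embedded discs that cuts `H` into one ball, is carried to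
the standard one by a homeomorphism of `H` onto the standard handlebody.) Only the values of the
map on the standard handlebody matter. -/
structure MarkedHandlebody (g : ℕ) (M : Type) [TopologicalSpace M] where
  map : ℝ × ℝ × ℝ → M
  continuousOn : ContinuousOn map (stdHandlebody g)
  injOn : Set.InjOn map (stdHandlebody g)

namespace MarkedHandlebody

variable {g : ℕ} {M : Type} [TopologicalSpace M] (H : MarkedHandlebody g M)

/-- The handlebody as a subset of `M`. -/
def carrier : Set M := H.map '' stdHandlebody g

/-- The boundary surface of the handlebody. -/
def boundary : Set M := H.map '' frontier (stdHandlebody g)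

/-- The boundary circle of the `i`-th meridional disc. -/
def meridian (i : Fin g) : Set M :=
  H.map '' (stdMeridianDisc i ∩ frontier (stdHandlebody g))

end MarkedHandlebody

/-- A Heegaard diagram `(Σ, M^±)` of genus `g` of `M`: the space `M` is the union of two handlebodies
`H^±` of genus `g` which meet exactly in their common boundary, the splitting surface `Σ`
(parametrised by the smooth surface `S`), and the two families of curves on `Σ` are the boundaries
of minimal meridional disc systems of `H^±`, as oriented smooth curves, where curves of different
families are transverse. (A space with such a splitting along an orientable surface is connected
and orientable.) -/
structure HeegaardDiagram (g : ℕ) (S M : Type) [TopologicalSpace S] [ChartedSpace Plane S]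
    [TopologicalSpace M] where
  pos : MarkedHandlebody g M
  neg : MarkedHandlebody g M
  surface : S → M
  surface_isEmbedding : Topology.IsEmbedding surface
  union_eq : pos.carrier ∪ neg.carrier = Set.univ
  inter_eq : pos.carrier ∩ neg.carrier = Set.range surface
  pos_boundary : pos.boundary = Set.range surface
  neg_boundary : neg.boundary = Set.range surface
  posCurve : Fin g → SimpleClosedCurve S
  negCurve : Fin g → SimpleClosedCurve S
  posCurve_eq : ∀ i, surface '' Set.range (posCurve i).toFun = pos.meridian i
  negCurve_eq : ∀ j, surface '' Set.range (negCurve j).toFun = neg.meridian j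
  transverse : ∀ i j, Transverse (posCurve i).toClosedCurve (negCurve j).toClosedCurve

theorem isClosed_stdHandlebody (g : ℕ) : IsClosed (stdHandlebody g) := by
  have hc : IsClosed (⋂ i : Fin g, (Prod.fst ⁻¹' Set.Ioo (2 * (i : ℝ) + 1) (2 * (i : ℝ) + 2) ∩
      (fun p : ℝ × ℝ × ℝ => p.2.1) ⁻¹' Set.Ioo 1 2)ᶜ) :=
    isClosed_iInter fun i => ((isOpen_Ioo.preimage continuous_fst).inter
      (isOpen_Ioo.preimage (continuous_fst.comp continuous_snd))).isClosed_compl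
  have h := (isClosed_Icc (a := (0 : ℝ)) (b := 2 * g + 1)).preimage
    (continuous_fst (X := ℝ) (Y := ℝ × ℝ)) |>.inter
    (((isClosed_Icc (a := (0 : ℝ)) (b := 3)).preimage (continuous_fst.comp continuous_snd)).inter
      (((isClosed_Icc (a := (0 : ℝ)) (b := 1)).preimage
        (continuous_snd.comp continuous_snd)).inter hc))
  convert h using 1
  ext p
  simp only [stdHandlebody, Set.mem_inter_iff, Set.mem_iInter, Set.mem_compl_iff]
  rfl

theorem MarkedHandlebody.meridian_disjoint {g : ℕ} {M : Type} [TopologicalSpace M]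
    (H : MarkedHandlebody g M) {i j : Fin g} {x : M} (hi : x ∈ H.meridian i)
    (hj : x ∈ H.meridian j) : i = j := by
  have hfr : frontier (stdHandlebody g) ⊆ stdHandlebody g :=
    (isClosed_stdHandlebody g).frontier_subset
  obtain ⟨p, ⟨hp, hp'⟩, rfl⟩ := hi
  obtain ⟨q, ⟨hq, hq'⟩, hqp⟩ := hj
  obtain rfl := H.injOn (hfr hq') (hfr hp') hqp
  have h1 := hp.1
  have h2 := hq.1
  rw [h1] at h2
  apply Fin.ext
  have : (i : ℝ) = j := by linarith
  exact_mod_cast this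

namespace HeegaardDiagram

variable {g : ℕ} {S M : Type} [TopologicalSpace S] [ChartedSpace Plane S] [TopologicalSpace M]
  (D : HeegaardDiagram g S M)

/-- The closed curve in `M` underlying a closed curve on the splitting surface. -/
def loop (γ : ClosedCurve S) : C(UnitAddCircle, M) :=
  ⟨fun θ => D.surface (γ.toFun θ), D.surface_isEmbedding.continuous.comp γ.continuous⟩

theorem pos_end_eq {i i' : Fin g} {θ θ' : UnitAddCircle}
    (h : (D.posCurve i).toFun θ = (D.posCurve i').toFun θ') : (i, θ) = (i', θ') := by
  obtain rfl : i = i' := D.pos.meridian_disjoint (x := D.surface ((D.posCurve i).toFun θ))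
    (D.posCurve_eq i ▸ ⟨_, ⟨θ, rfl⟩, rfl⟩) (D.posCurve_eq i' ▸ ⟨_, ⟨θ', rfl⟩, by rw [h]⟩)
  rw [(D.posCurve i).injective h]

theorem neg_end_eq {j j' : Fin g} {η η' : UnitAddCircle}
    (h : (D.negCurve j).toFun η = (D.negCurve j').toFun η') : (j, η) = (j', η') := by
  obtain rfl : j = j' := D.neg.meridian_disjoint (x := D.surface ((D.negCurve j).toFun η))
    (D.negCurve_eq j ▸ ⟨_, ⟨η, rfl⟩, rfl⟩) (D.negCurve_eq j' ▸ ⟨_, ⟨η', rfl⟩, by rw [h]⟩)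
  rw [(D.negCurve j).injective h]

/-- The Gauss diagram of a Heegaard diagram: its circles are the domains of the curves, and there is
one chord for every intersection point of a curve of the first family with a curve of the second
one, joining the two preimages of that point and carrying the sign of the intersection. -/
def gauss [IsManifold (𝓡 2) ∞ S] [T2Space M] : GaussDiagram g where
  Chord := {x : (Fin g × UnitAddCircle) × (Fin g × UnitAddCircle) //
    (D.posCurve x.1.1).toFun x.1.2 = (D.negCurve x.2.1).toFun x.2.2}
  finite := by
    have : T2Space S := D.surface_isEmbedding.t2Space
    have h : ∀ i j, {x : UnitAddCircle × UnitAddCircle |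
        (D.posCurve i).toFun x.1 = (D.negCurve j).toFun x.2}.Finite :=
      fun i j => finite_crossings _ _ (D.transverse i j)
    refine Set.Finite.subset (Set.finite_iUnion fun i => Set.finite_iUnion fun j =>
      (h i j).image fun x => ((i, x.1), (j, x.2))) ?_
    rintro ⟨⟨i, θ⟩, ⟨j, η⟩⟩ hx
    exact Set.mem_iUnion.2 ⟨i, Set.mem_iUnion.2 ⟨j, (θ, η), hx, rfl⟩⟩
  topEnd h := h.1.1
  botEnd h := h.1.2
  topEnd_injective := by
    rintro ⟨⟨a, b⟩, hx⟩ ⟨⟨a', b'⟩, hy⟩ h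
    obtain rfl : a = a' := h
    obtain rfl : b = b' := D.neg_end_eq (hx.symm.trans hy)
    rfl
  botEnd_injective := by
    rintro ⟨⟨a, b⟩, hx⟩ ⟨⟨a', b'⟩, hy⟩ h
    obtain rfl : b = b' := h
    obtain rfl : a = a' := D.pos_end_eq (hx.trans hy.symm)
    rfl
  sign h := crossingSign (D.posCurve h.1.1.1).toClosedCurve (D.negCurve h.1.2.1).toClosedCurve
    h.1.1.2 h.1.2.2

end HeegaardDiagram

end HeegaardGauss

end

open scoped Manifold ContDiff Topology
noncomputable section
namespace HeegaardGauss

/-! ### Singular chains as finitely supported functions -/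

/-! Think of `M` as the handlebody `H⁺` to which `H⁻` is added in the form of `g` two-handles,
attached along the curves `m_j⁻`, and one ball. Then `H_1(M)` is `H_1(H⁺)` modulo the classes of the
`m_j⁻`. Intersection with the `m_i⁺` identifies `H_1(H⁺)` with `ℤ^g`, and the class of `m_j⁻`
becomes the `j`-th column of `A`. So `H_1(M)` is the cokernel of `A`.

Gluing. The handles are never constructed as such. Inside `H⁻` lies a graph, the core `{depth ≥
1/2}`, and the complement of this graph in `M` retracts onto `H⁺` along an explicit collar
(`bijective_core`). The graph is then erased bit by bit: erasing the part of it in an open box glues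
in the box along the box minus the graph. Erasing `g` arcs, one through each disc, glues along
spaces that look like circles and are homotopic to the `m_j⁻`. What is left is a tree, which is
shrunk to a point without any change of homology. Filling in that point glues a ball along a
homology two-sphere. Each step is an application of the Mayer-Vietoris sequence, and
`homology_glued` collects the result. The same steps show that if the classes of the `m_j⁻` are
independent then `H_2(M) = 0`, `H_3(M) = ℤ` and all higher groups vanish, so Poincaré duality is not
used.

Coordinates. Each disc of `H⁺` is the preimage of a point under a map to the circle (`discMap`). The
degrees of these maps send `H_1(H⁺)` onto `ℤ^g`, because of the loops around the holes, and
`H_1(H⁺)` has `g` generators, so the degrees form an isomorphism (`degrees_bijective`). Along a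
curve on the surface the degree counts the passages through the level `m_i⁺` with signs. On an
oriented surface these signs differ from the crossing signs by a factor that is constant along
`m_i⁺` (`exists_forall_isSide`, `wind_eq_algebraicIntersection`); the factor is absorbed in the
coordinates.

Homology spheres. If `H_1(M) = 0` then `A` is onto, hence invertible over `ℤ`. If `A` is invertible
then `H_1(M) = 0` and the classes of the `m_j⁻` are independent, so every homology group is that of
the three-sphere, which is computed by repeated suspension of punctured vector spaces. -/

/-- The standard topological `n`-simplex. -/
abbrev Simplex (n : ℕ) : Type := stdSimplex ℝ (Fin (n + 1))

/-- Integral singular chains, as finitely supported functions on continuous maps. -/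
abbrev Chain (n : ℕ) (X : Type) [TopologicalSpace X] : Type := C(Simplex n, X) →₀ ℤ

/-- The `i`-th face of the standard simplex. -/
def face {n : ℕ} (i : Fin (n + 2)) : C(Simplex n, Simplex (n + 1)) :=
  ⟨stdSimplex.map i.succAbove, stdSimplex.continuous_map _⟩

theorem face_vertex {n : ℕ} (i : Fin (n + 2)) (j : Fin (n + 1)) :
    face i (stdSimplex.vertex j) = stdSimplex.vertex (i.succAbove j) :=
  stdSimplex.map_vertex _ _

section

variable {X Y Z : Type} [TopologicalSpace X] [TopologicalSpace Y] [TopologicalSpace Z]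

/-- The boundary operator on singular chains. -/
def bd (n : ℕ) : Chain (n + 1) X →ₗ[ℤ] Chain n X :=
  Finsupp.linearCombination ℤ fun σ : C(Simplex (n + 1), X) =>
    ∑ i : Fin (n + 2), (-1 : ℤ) ^ (i : ℕ) • Finsupp.single (σ.comp (face i)) (1 : ℤ)

/-- The map on chains induced by a continuous map. -/
def push (n : ℕ) (f : C(X, Y)) : Chain n X →ₗ[ℤ] Chain n Y :=
  Finsupp.lmapDomain ℤ ℤ fun σ => f.comp σ

@[simp]
theorem bd_single (n : ℕ) (σ : C(Simplex (n + 1), X)) :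
    bd n (Finsupp.single σ 1) =
      ∑ i : Fin (n + 2), (-1 : ℤ) ^ (i : ℕ) • Finsupp.single (σ.comp (face i)) (1 : ℤ) := by
  simp [bd]

@[simp]
theorem push_single (n : ℕ) (f : C(X, Y)) (σ : C(Simplex n, X)) (a : ℤ) :
    push n f (Finsupp.single σ a) = Finsupp.single (f.comp σ) a := by
  simp [push]

theorem chain_hom_ext {n : ℕ} {A : Type*} [AddCommGroup A] {f g : Chain n X →ₗ[ℤ] A}
    (h : ∀ σ, f (Finsupp.single σ 1) = g (Finsupp.single σ 1)) : f = g := by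
  ext σ
  simpa using h σ

theorem push_comp (n : ℕ) (g : C(Y, Z)) (f : C(X, Y)) (c : Chain n X) :
    push n (g.comp f) c = push n g (push n f c) := by
  have : push n (g.comp f) = (push n g).comp (push n f) := chain_hom_ext fun σ => by
    simp [ContinuousMap.comp_assoc]
  rw [this]; rfl

theorem push_bd (n : ℕ) (f : C(X, Y)) (c : Chain (n + 1) X) :
    push n f (bd n c) = bd n (push (n + 1) f c) := by
  have : (push n f).comp (bd n) = (bd n).comp (push (n + 1) f) := chain_hom_ext fun σ => by
    simp [ContinuousMap.comp_assoc]
  exact LinearMap.congr_fun this c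

theorem push_injective (n : ℕ) {f : C(X, Y)} (hf : Function.Injective f) :
    Function.Injective (push n f) := by
  refine Finsupp.mapDomain_injective fun σ τ h => ?_
  ext x
  exact hf (DFunLike.congr_fun h x)

/-! ### Comparison with Mathlib's singular chain complex -/

open CategoryTheory AlgebraicTopology

/-- The singular simplex of the simplicial set `Sing X` given by a continuous map. -/
def mkSimplex {n : ℕ} (σ : C(Simplex n, X)) :
    (TopCat.toSSet.obj (TopCat.of X)).obj (.op (SimplexCategory.mk n)) :=
  ((TopCat.of X).toSSetObjEquiv (.op (SimplexCategory.mk n))).symm σ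

theorem mkSimplex_surjective {n : ℕ}
    (x : (TopCat.toSSet.obj (TopCat.of X)).obj (.op (SimplexCategory.mk n))) :
    ∃ σ : C(Simplex n, X), mkSimplex σ = x :=
  ⟨_, Equiv.symm_apply_apply _ x⟩

/-- True by unfolding: the faces of the singular set are precompositions with the affine maps that
define `face`. -/
theorem δ_mkSimplex {n : ℕ} (σ : C(Simplex (n + 1), X)) (i : Fin (n + 2)) :
    (TopCat.toSSet.obj (TopCat.of X)).δ i (mkSimplex σ) = mkSimplex (σ.comp (face i)) := rfl

/-- The generator of Mathlib's singular chains given by a simplex. -/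
def gen {n : ℕ} (σ : C(Simplex n, X)) : ModuleCat.of ℤ ℤ ⟶ (chains X).X n :=
  (TopCat.toSSet.obj (TopCat.of X)).ιChainComplex (mkSimplex σ)

/-- An additive map between `ℤ`-modules as a morphism. -/
def intHom {A B : ModuleCat.{0} ℤ} (f : A →+ B) : A ⟶ B :=
  ModuleCat.ofHom
    { toFun := f
      map_add' := map_add f
      map_smul' := fun n x => by simpa using map_intCast_smul f ℤ ℤ n x }

/-- Finitely supported chains as elements of Mathlib's singular chain complex. -/
def ofChain (n : ℕ) : Chain n X →+ (chains X).X n :=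
  Finsupp.liftAddHom fun σ : C(Simplex n, X) => (gen σ).hom.toAddMonoidHom

/-- Elements of Mathlib's singular chain complex as finitely supported chains. -/
def toChain (n : ℕ) : (chains X).X n →+ Chain n X :=
  (((TopCat.toSSet.obj (TopCat.of X)).isColimitChainComplexXCofan (ModuleCat.of ℤ ℤ) n).desc
    (Limits.Cofan.mk (ModuleCat.of ℤ (Chain n X)) fun x => ModuleCat.ofHom
      (Finsupp.lsingle ((TopCat.of X).toSSetObjEquiv (.op (SimplexCategory.mk n)) x)))).hom
    |>.toAddMonoidHom

theorem toChain_gen {n : ℕ} (σ : C(Simplex n, X)) (a : ℤ) :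
    toChain n ((gen σ).hom a) = Finsupp.single σ a := by
  have h := ((TopCat.toSSet.obj (TopCat.of X)).isColimitChainComplexXCofan
    (ModuleCat.of ℤ ℤ) n).fac
    (Limits.Cofan.mk (ModuleCat.of ℤ (Chain n X)) fun x => ModuleCat.ofHom
      (Finsupp.lsingle ((TopCat.of X).toSSetObjEquiv (.op (SimplexCategory.mk n)) x)))
    ⟨mkSimplex σ⟩
  have h2 := congrArg (fun f => f.hom a) h
  refine h2.trans ?_
  change Finsupp.single (((TopCat.of X).toSSetObjEquiv (.op (SimplexCategory.mk n)))
    (mkSimplex σ)) a = _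
  rw [mkSimplex, Equiv.apply_symm_apply]

@[simp]
theorem ofChain_single {n : ℕ} (σ : C(Simplex n, X)) (a : ℤ) :
    ofChain n (Finsupp.single σ a) = (gen σ).hom a := by
  simp [ofChain]

theorem chain_addHom_ext {n : ℕ} {A : Type*} [AddCommGroup A] {f g : Chain n X →+ A}
    (h : ∀ σ, f (Finsupp.single σ 1) = g (Finsupp.single σ 1)) : f = g := by
  ext σ
  simpa using h σ

theorem toChain_ofChain (n : ℕ) (c : Chain n X) : toChain n (ofChain n c) = c := by
  have : (toChain n).comp (ofChain n) = AddMonoidHom.id (Chain n X) :=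
    chain_addHom_ext fun σ => by
      rw [AddMonoidHom.comp_apply, ofChain_single, toChain_gen, AddMonoidHom.id_apply]
  exact DFunLike.congr_fun this c

/-- The uniqueness half of the universal property of a coproduct: an endomorphism that fixes all
generators is the identity. To apply it, the composite has to be packaged as a morphism by `intHom`.
-/
theorem ofChain_toChain (n : ℕ) (c : (chains X).X n) : ofChain n (toChain n c) = c := by
  have : intHom ((ofChain n).comp (toChain n)) = 𝟙 ((chains X).X n) := by
    refine SSet.chainComplex_hom_ext fun x => ?_
    obtain ⟨σ, rfl⟩ := mkSimplex_surjective x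
    ext
    change ofChain n (toChain n ((gen σ).hom (1 : ℤ))) = (gen σ).hom (1 : ℤ)
    rw [toChain_gen, ofChain_single]
  exact congrArg (fun f => f.hom c) this

theorem ofChain_bd (n : ℕ) (c : Chain (n + 1) X) :
    ofChain n (bd n c) = ((chains X).d (n + 1) n).hom (ofChain (n + 1) c) := by
  have : (ofChain n).comp (bd n).toAddMonoidHom =
      (((chains X).d (n + 1) n).hom.toAddMonoidHom.comp (ofChain (n + 1)) :
        Chain (n + 1) X →+ _) :=
    chain_addHom_ext fun σ => by
      have h := congrArg (fun f => f.hom (1 : ℤ))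
        ((TopCat.toSSet.obj (TopCat.of X)).ιChainComplex_d (ModuleCat.of ℤ ℤ) (n := n)
          (mkSimplex σ))
      simp only [AddMonoidHom.comp_apply, LinearMap.toAddMonoidHom_coe, bd_single, map_sum,
        map_zsmul, ofChain_single]
      refine Eq.trans ?_ h.symm
      simp only [ModuleCat.hom_sum, LinearMap.sum_apply]
      refine Finset.sum_congr rfl fun i _ => ?_
      rw [δ_mkSimplex]
      rcases neg_one_pow_eq_or ℤ (i : ℕ) with h | h <;> rw [h] <;> simp [gen] <;> rfl
  exact DFunLike.congr_fun this c

theorem ofChain_push (n : ℕ) (f : C(X, Y)) (c : Chain n X) :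
    ofChain n (push n f c) =
      ((((singularChainComplexFunctor (ModuleCat.{0} ℤ)).obj (ModuleCat.of ℤ ℤ)).map
        (TopCat.ofHom f)).f n).hom (ofChain n c) := by
  have : (ofChain n).comp (push n f).toAddMonoidHom =
      (((((singularChainComplexFunctor (ModuleCat.{0} ℤ)).obj (ModuleCat.of ℤ ℤ)).map
        (TopCat.ofHom f)).f n).hom.toAddMonoidHom.comp (ofChain n) : Chain n X →+ _) :=
    chain_addHom_ext fun σ => by
      have h := congrArg (fun f => f.hom (1 : ℤ))
        (SSet.ι_chainComplexMap_f (TopCat.toSSet.obj (TopCat.of X))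
          (TopCat.toSSet.obj (TopCat.of Y)) (TopCat.toSSet.map (TopCat.ofHom f))
          (ModuleCat.of ℤ ℤ) (mkSimplex σ))
      simp only [AddMonoidHom.comp_apply, LinearMap.toAddMonoidHom_coe, push_single,
        ofChain_single]
      exact h.symm
  exact DFunLike.congr_fun this c

theorem bd_bd (n : ℕ) (c : Chain (n + 2) X) : bd n (bd (n + 1) c) = 0 := by
  have h := congrArg (fun f => f.hom (ofChain (n + 2) c)) ((chains X).d_comp_d (n + 2) (n + 1) n)
  have h2 : ofChain n (bd n (bd (n + 1) c)) = 0 := by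
    rw [ofChain_bd, ofChain_bd]; exact h
  rw [← toChain_ofChain n (bd n (bd (n + 1) c)), h2, map_zero]

/-! ### Cycles and homology classes in terms of finitely supported chains -/

/-- The subgroup of cycles. -/
def cyc : (n : ℕ) → (X : Type) → [TopologicalSpace X] → AddSubgroup (Chain n X)
  | 0, _, _ => ⊤
  | n + 1, _, _ => (bd n).toAddMonoidHom.ker

theorem mem_cyc_succ {n : ℕ} {c : Chain (n + 1) X} : c ∈ cyc (n + 1) X ↔ bd n c = 0 := Iff.rfl

theorem bd_mem_cyc {n : ℕ} (c : Chain (n + 1) X) : bd n c ∈ cyc n X := by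
  cases n with
  | zero => trivial
  | succ n => exact bd_bd n c

theorem push_mem_cyc {n : ℕ} (f : C(X, Y)) {c : Chain n X} (h : c ∈ cyc n X) :
    push n f c ∈ cyc n Y := by
  cases n with
  | zero => trivial
  | succ n => rw [mem_cyc_succ] at h ⊢; rw [← push_bd, h, map_zero]

theorem mem_cyc_iff_d {n : ℕ} (c : Chain n X) :
    c ∈ cyc n X ↔ ((chains X).d n ((ComplexShape.down ℕ).next n)).hom (ofChain n c) = 0 := by
  cases n with
  | zero =>
    -- In degree `0` no arrow leaves the complex shape, so the differential to the default value of
    -- `next` is zero and every chain is a cycle.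
    rw [(chains X).shape]
    · exact ⟨fun _ => rfl, fun _ => trivial⟩
    · simp
  | succ n =>
    rw [mem_cyc_succ, ChainComplex.next_nat_succ, ← ofChain_bd]
    refine ⟨fun h => by rw [h, map_zero], fun h => ?_⟩
    rw [← toChain_ofChain n (bd n c), h, map_zero]

/-- The object of cycles is known by its universal property only, so the element `c` is turned into
the morphism from `ℤ` with value `c` at `1` and that morphism is lifted. -/
theorem exists_cycle {n : ℕ} (c : cyc n X) :
    ∃ z : (chains X).cycles n, (chains X).iCycles n z = ofChain n c.1 := by
  have h := (mem_cyc_iff_d c.1).1 c.2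
  let k : ModuleCat.of ℤ ℤ ⟶ (chains X).X n :=
    intHom (zmultiplesHom _ (ofChain n c.1))
  have hk1 : k.hom (1 : ℤ) = ofChain n c.1 := one_zsmul _
  have hk : k ≫ (chains X).d n ((ComplexShape.down ℕ).next n) = 0 := by
    refine ModuleCat.hom_ext (LinearMap.ext_ring ?_)
    change ((chains X).d n ((ComplexShape.down ℕ).next n)).hom (k.hom (1 : ℤ)) = 0
    rw [hk1, h]
  exact ⟨((chains X).liftCycles k _ rfl hk).hom (1 : ℤ),
    (congrArg (fun f => f.hom (1 : ℤ)) ((chains X).liftCycles_i k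
      ((ComplexShape.down ℕ).next n) rfl hk)).trans hk1⟩

theorem iCycles_injective (n : ℕ) : Function.Injective ((chains X).iCycles n) :=
  (ModuleCat.mono_iff_injective _).1 inferInstance

theorem homologyπ_surjective (n : ℕ) : Function.Surjective ((chains X).homologyπ n) :=
  (ModuleCat.epi_iff_surjective _).1 inferInstance

/-- The homology class of a cycle. -/
def cls (n : ℕ) : cyc n X →+ Homology n X where
  toFun c := (chains X).homologyπ n (exists_cycle c).choose
  map_zero' := by
    have h : (exists_cycle (0 : cyc n X)).choose = 0 := iCycles_injective n <| by
      rw [(exists_cycle (0 : cyc n X)).choose_spec]; simp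
    rw [h]; exact map_zero ((chains X).homologyπ n).hom
  map_add' a b := by
    have h : (exists_cycle (a + b)).choose =
        (exists_cycle a).choose + (exists_cycle b).choose := iCycles_injective n <| by
      rw [(exists_cycle (a + b)).choose_spec]
      refine Eq.trans ?_ (map_add ((chains X).iCycles n).hom _ _).symm
      rw [AddSubgroup.coe_add, map_add]
      exact congrArg₂ (· + ·) (exists_cycle a).choose_spec.symm (exists_cycle b).choose_spec.symm
    rw [h]; exact map_add ((chains X).homologyπ n).hom _ _

theorem homologyπ_eq_cls {n : ℕ} {c : cyc n X} {z : (chains X).cycles n}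
    (h : (chains X).iCycles n z = ofChain n c.1) : (chains X).homologyπ n z = cls n c := by
  have : z = (exists_cycle c).choose :=
    iCycles_injective n (h.trans (exists_cycle c).choose_spec.symm)
  rw [this]; rfl

theorem cls_surjective (n : ℕ) : Function.Surjective (cls n : cyc n X →+ Homology n X) := by
  intro x
  obtain ⟨z, rfl⟩ := homologyπ_surjective n x
  have hz : toChain n ((chains X).iCycles n z) ∈ cyc n X := by
    rw [mem_cyc_iff_d, ofChain_toChain]
    exact congrArg (fun f => f.hom z) ((chains X).iCycles_d n ((ComplexShape.down ℕ).next n))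
  exact ⟨⟨_, hz⟩, (homologyπ_eq_cls (ofChain_toChain n _).symm).symm⟩

/-- The projection `homologyπ` is a cokernel of `toCycles`, which gives exactness at the cycles.
Together with `cls_surjective` this reduces every later argument to explicit chains modulo
boundaries. -/
theorem cls_eq_zero_iff {n : ℕ} (c : cyc n X) : cls n c = 0 ↔ ∃ w, bd n w = c.1 := by
  have hex : ∀ z : (chains X).cycles n, (chains X).homologyπ n z = 0 →
      ∃ w, (chains X).toCycles (n + 1) n w = z := by
    have e : (ShortComplex.mk _ _ ((chains X).toCycles_comp_homologyπ (n + 1) n)).Exact :=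
      ShortComplex.exact_of_g_is_cokernel _
        ((chains X).homologyIsCokernel (n + 1) n (by simp))
    exact (ShortComplex.moduleCat_exact_iff _).1 e
  have hi : ∀ w, (chains X).iCycles n ((chains X).toCycles (n + 1) n w) =
      ((chains X).d (n + 1) n).hom w := fun w =>
    congrArg (fun f => f.hom w) ((chains X).toCycles_i (n + 1) n)
  constructor
  · intro h
    obtain ⟨w, hw⟩ := hex _ h
    refine ⟨toChain (n + 1) w, ?_⟩
    rw [← toChain_ofChain n (bd n _), ofChain_bd, ofChain_toChain, ← hi, hw,
      (exists_cycle c).choose_spec, toChain_ofChain]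
  · rintro ⟨w, hw⟩
    rw [← homologyπ_eq_cls (z := (chains X).toCycles (n + 1) n (ofChain (n + 1) w))]
    · exact congrArg (fun f => f.hom (ofChain (n + 1) w))
        ((chains X).toCycles_comp_homologyπ (n + 1) n)
    · rw [hi, ← ofChain_bd, hw]

/-- The map on homology induced by a continuous map. -/
def Hmap (n : ℕ) (f : C(X, Y)) : Homology n X →+ Homology n Y :=
  (((singularHomologyFunctor (ModuleCat.{0} ℤ) n).obj (ModuleCat.of ℤ ℤ)).map
    (TopCat.ofHom f)).hom.toAddMonoidHom

theorem Hmap_cls {n : ℕ} (f : C(X, Y)) (c : cyc n X) :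
    Hmap n f (cls n c) = cls n ⟨push n f c.1, push_mem_cyc f c.2⟩ := by
  set F := ((singularChainComplexFunctor (ModuleCat.{0} ℤ)).obj (ModuleCat.of ℤ ℤ)).map
    (TopCat.ofHom f)
  have h1 := congrArg (fun g => g.hom (exists_cycle c).choose)
    (HomologicalComplex.homologyπ_naturality F n)
  refine h1.trans (homologyπ_eq_cls ?_)
  have h2 := congrArg (fun g => g.hom (exists_cycle c).choose)
    (HomologicalComplex.cyclesMap_i F n)
  refine h2.trans ?_
  rw [ofChain_push]
  exact congrArg (F.f n).hom (exists_cycle c).choose_spec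

theorem Hmap_id (n : ℕ) (x : Homology n X) : Hmap n (ContinuousMap.id X) x = x :=
  congrArg (fun g => g.hom x)
    (((singularHomologyFunctor (ModuleCat.{0} ℤ) n).obj (ModuleCat.of ℤ ℤ)).map_id (TopCat.of X))

theorem Hmap_comp (n : ℕ) (g : C(Y, Z)) (f : C(X, Y)) (x : Homology n X) :
    Hmap n (g.comp f) x = Hmap n g (Hmap n f x) :=
  congrArg (fun g => g.hom x)
    (((singularHomologyFunctor (ModuleCat.{0} ℤ) n).obj (ModuleCat.of ℤ ℤ)).map_comp
      (TopCat.ofHom f) (TopCat.ofHom g))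

theorem Hmap_homotopic (n : ℕ) {f g : C(X, Y)} (h : f.Homotopic g) : Hmap n f = Hmap n g := by
  obtain ⟨F⟩ := h
  have := TopCat.Homotopy.congr_homologyMap_singularChainComplexFunctor
    (X := TopCat.of X) (Y := TopCat.of Y) (f := TopCat.ofHom f) (g := TopCat.ofHom g) F
    (ModuleCat.of ℤ ℤ) n
  ext x
  exact congrArg (fun g => g.hom x) this

/-! ### Classes of loops -/

/-- The singular simplex of a loop. -/
def loopMap (γ : C(UnitAddCircle, X)) : C(Simplex 1, X) :=
  ⟨fun s => γ ((s.1 1 : ℝ) : UnitAddCircle), by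
    refine γ.continuous.comp ((AddCircle.continuous_mk' (1 : ℝ)).comp ?_)
    exact (continuous_apply _).comp continuous_subtype_val⟩

theorem loopMap_mem_cyc (γ : C(UnitAddCircle, X)) :
    Finsupp.single (loopMap γ) (1 : ℤ) ∈ cyc 1 X := by
  rw [mem_cyc_succ, bd_single, Fin.sum_univ_two]
  have : (loopMap γ).comp (face 0) = (loopMap γ).comp (face 1) := by
    ext s
    obtain rfl : s = stdSimplex.vertex 0 := Subsingleton.elim _ _
    simpa [loopMap, face_vertex] using congrArg γ (AddCircle.coe_period (1 : ℝ))
  simp [this]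

/-- The homology class of a loop. -/
def loopClass (γ : C(UnitAddCircle, X)) : Homology 1 X := cls 1 ⟨_, loopMap_mem_cyc γ⟩

theorem isLoopClass_loopClass (γ : C(UnitAddCircle, X)) : IsLoopClass γ (loopClass γ) := by
  obtain ⟨z, hz⟩ := exists_cycle ⟨_, loopMap_mem_cyc γ⟩
  exact ⟨z, hz.trans (ofChain_single _ _), homologyπ_eq_cls hz⟩

theorem Hmap_loopClass (f : C(X, Y)) (γ : C(UnitAddCircle, X)) :
    Hmap 1 f (loopClass γ) = loopClass (f.comp γ) := by
  rw [loopClass, Hmap_cls]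
  congr 2
  simp only [push_single]
  rfl

end

end HeegaardGauss
end

open scoped Manifold ContDiff Topology
noncomputable section
namespace HeegaardGauss

/-! ### Affine simplices and barycentric subdivision -/

/-- The affine simplex in a standard simplex with given vertices. -/
def comb {n k : ℕ} (v : Fin (k + 1) → Simplex n) : C(Simplex k, Simplex n) where
  toFun t := ⟨fun x => ∑ i, t.1 i * (v i).1 x,
    fun x => Finset.sum_nonneg fun i _ => mul_nonneg (t.2.1 i) ((v i).2.1 x), by
      rw [Finset.sum_comm]
      simp_rw [← Finset.mul_sum, fun i => (v i).2.2, mul_one]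
      exact t.2.2⟩
  continuous_toFun := by
    refine Continuous.subtype_mk (continuous_pi fun x => continuous_finsetSum _ fun i _ => ?_) _
    exact ((continuous_apply i).comp continuous_subtype_val).mul continuous_const

theorem comb_apply {n k : ℕ} (v : Fin (k + 1) → Simplex n) (t : Simplex k) (x : Fin (n + 1)) :
    (comb v t).1 x = ∑ i, t.1 i * (v i).1 x := rfl

theorem comb_vertex {n k : ℕ} (v : Fin (k + 1) → Simplex n) (i : Fin (k + 1)) :
    comb v (stdSimplex.vertex i) = v i := by
  refine Subtype.ext (funext fun x => ?_)
  rw [comb_apply, Finset.sum_eq_single i]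
  · simp
  · intro j _ hj; simp [hj]
  · simp

theorem comb_comb {n m k : ℕ} (w : Fin (n + 1) → Simplex m) (v : Fin (k + 1) → Simplex n) :
    (comb w).comp (comb v) = comb fun i => comb w (v i) := by
  refine ContinuousMap.ext fun t => Subtype.ext (funext fun x => ?_)
  simp only [ContinuousMap.comp_apply, comb_apply, Finset.sum_mul, Finset.mul_sum]
  rw [Finset.sum_comm]
  exact Finset.sum_congr rfl fun i _ => Finset.sum_congr rfl fun j _ => by ring

theorem comb_vertices (n : ℕ) :
    comb (fun i : Fin (n + 1) => (stdSimplex.vertex i : Simplex n)) = ContinuousMap.id _ := by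
  refine ContinuousMap.ext fun t => Subtype.ext (funext fun x => ?_)
  rw [comb_apply, Finset.sum_eq_single x]
  · simp
  · intro j _ hj; simp [hj.symm]
  · simp

theorem comb_face {n k : ℕ} (v : Fin (k + 2) → Simplex n) (i : Fin (k + 2)) :
    (comb v).comp (face i) = comb fun j => v (i.succAbove j) := by
  have h : face i = comb fun j => (stdSimplex.vertex (i.succAbove j) : Simplex (k + 1)) := by
    refine ContinuousMap.ext fun t => Subtype.ext (funext fun x => ?_)
    change stdSimplex.map i.succAbove t x = _
    rw [stdSimplex.map_coe, FunOnFinite.linearMap_apply_apply, comb_apply, Finset.sum_filter]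
    refine Finset.sum_congr rfl fun j _ => ?_
    by_cases hj : i.succAbove j = x
    · simp [hj]; rfl
    · simp [hj, Ne.symm hj]
  rw [h, comb_comb]
  simp_rw [comb_vertex]

/-- The barycenter of an affine simplex. -/
def bary {n k : ℕ} (v : Fin (k + 1) → Simplex n) : Simplex n := comb v stdSimplex.barycenter

theorem comb_bary {n m k : ℕ} (w : Fin (n + 1) → Simplex m) (v : Fin (k + 1) → Simplex n) :
    comb w (bary v) = bary fun i => comb w (v i) :=
  DFunLike.congr_fun (comb_comb w v) _

/-- Integral chains of affine simplices in the standard `n`-simplex. -/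
abbrev AffChain (k n : ℕ) : Type := (Fin (k + 1) → Simplex n) →₀ ℤ

theorem affChain_hom_ext {k n : ℕ} {A : Type*} [AddCommGroup A] {f g : AffChain k n →ₗ[ℤ] A}
    (h : ∀ v, f (Finsupp.single v 1) = g (Finsupp.single v 1)) : f = g := by
  ext σ
  simpa using h σ

/-- The boundary of affine chains. -/
def affBd (k n : ℕ) : AffChain (k + 1) n →ₗ[ℤ] AffChain k n :=
  Finsupp.linearCombination ℤ fun v =>
    ∑ i : Fin (k + 2), (-1 : ℤ) ^ (i : ℕ) • Finsupp.single (fun j => v (i.succAbove j)) (1 : ℤ)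

@[simp]
theorem affBd_single {k n : ℕ} (v : Fin (k + 2) → Simplex n) :
    affBd k n (Finsupp.single v 1) =
      ∑ i : Fin (k + 2), (-1 : ℤ) ^ (i : ℕ) •
        Finsupp.single (fun j => v (i.succAbove j)) (1 : ℤ) := by
  simp [affBd]

/-- The singular chain of an affine chain. -/
def real (k n : ℕ) : AffChain k n →ₗ[ℤ] Chain k (Simplex n) := Finsupp.lmapDomain ℤ ℤ comb

@[simp]
theorem real_single {k n : ℕ} (v : Fin (k + 1) → Simplex n) (a : ℤ) :
    real k n (Finsupp.single v a) = Finsupp.single (comb v) a := by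
  simp [real]

/-- An affine simplex remembers its vertices. This lets identities of singular chains, such as
`bd_bd`, be pulled back to affine chains. -/
theorem real_injective (k n : ℕ) : Function.Injective (real k n) :=
  Finsupp.mapDomain_injective fun v w h => funext fun i => by
    rw [← comb_vertex v, h, comb_vertex]

theorem real_affBd {k n : ℕ} (c : AffChain (k + 1) n) :
    real k n (affBd k n c) = bd k (real (k + 1) n c) := by
  have : (real k n).comp (affBd k n) = (bd k).comp (real (k + 1) n) :=
    affChain_hom_ext fun v => by simp [comb_face]
  exact LinearMap.congr_fun this c

theorem affBd_affBd {k n : ℕ} (c : AffChain (k + 2) n) :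
    affBd k n (affBd (k + 1) n c) = 0 := by
  apply real_injective
  rw [real_affBd, real_affBd, bd_bd, map_zero]

/-- The cone over an affine chain. -/
def cone {k n : ℕ} (b : Simplex n) : AffChain k n →ₗ[ℤ] AffChain (k + 1) n :=
  Finsupp.lmapDomain ℤ ℤ fun v => Fin.cons b v

@[simp]
theorem cone_single {k n : ℕ} (b : Simplex n) (v : Fin (k + 1) → Simplex n) (a : ℤ) :
    cone b (Finsupp.single v a) = Finsupp.single (Fin.cons b v : Fin (k + 2) → Simplex n) a := by
  simp [cone]

theorem affBd_cone {k n : ℕ} (b : Simplex n) (c : AffChain (k + 1) n) :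
    affBd (k + 1) n (cone b c) = c - cone b (affBd k n c) := by
  have : (affBd (k + 1) n).comp (cone b) = LinearMap.id - (cone b).comp (affBd k n) :=
    affChain_hom_ext fun v => by
      have key : ∀ i : Fin (k + 2), (fun j => (Fin.cons b v : Fin (k + 3) → Simplex n)
          (i.succ.succAbove j)) = Fin.cons b fun j => v (i.succAbove j) := fun i => by
        funext j
        refine Fin.cases ?_ (fun m => ?_) j
        · simp
        · simp
      simp [Fin.sum_univ_succ (n := k + 2), key, pow_succ, sub_eq_add_neg, Finset.sum_neg_distrib]
  exact LinearMap.congr_fun this c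

/-- In degree zero the cone formula has an extra term, the augmentation of the chain times the apex.
It vanishes on boundaries, which is all that subdivision needs. -/
theorem affBd_cone_affBd {n : ℕ} (b : Simplex n) (c : AffChain 1 n) :
    affBd 0 n (cone b (affBd 0 n c)) = affBd 0 n c := by
  have : (affBd 0 n).comp ((cone b).comp (affBd 0 n)) = affBd 0 n :=
    affChain_hom_ext fun v => by
      have key : ∀ u : Fin 1 → Simplex n, (fun j => (Fin.cons b u : Fin 2 → Simplex n)
          ((1 : Fin 2).succAbove j)) = fun _ => b := fun u => by
        funext j
        obtain rfl : j = 0 := Subsingleton.elim _ _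
        rfl
      simp [Fin.sum_univ_two, key]
  exact LinearMap.congr_fun this c

/-- Barycentric subdivision of affine chains. -/
def affSd : (k n : ℕ) → AffChain k n →ₗ[ℤ] AffChain k n
  | 0, _ => LinearMap.id
  | k + 1, n => Finsupp.linearCombination ℤ fun v =>
      cone (bary v) (affSd k n (affBd k n (Finsupp.single v 1)))

/-- The chain homotopy from the identity to the barycentric subdivision. -/
def affHt : (k n : ℕ) → AffChain k n →ₗ[ℤ] AffChain (k + 1) n
  | 0, _ => 0
  | k + 1, n => Finsupp.linearCombination ℤ fun v =>
      cone (bary v) (Finsupp.single v 1 - affHt k n (affBd k n (Finsupp.single v 1)))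

theorem affSd_single {k n : ℕ} (v : Fin (k + 2) → Simplex n) :
    affSd (k + 1) n (Finsupp.single v 1) =
      cone (bary v) (affSd k n (affBd k n (Finsupp.single v 1))) := by
  simp [affSd]

theorem affHt_single {k n : ℕ} (v : Fin (k + 2) → Simplex n) :
    affHt (k + 1) n (Finsupp.single v 1) =
      cone (bary v) (Finsupp.single v 1 - affHt k n (affBd k n (Finsupp.single v 1))) := by
  simp [affHt]

theorem affBd_affSd {k n : ℕ} (c : AffChain (k + 1) n) :
    affBd k n (affSd (k + 1) n c) = affSd k n (affBd k n c) := by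
  induction k with
  | zero =>
    have : (affBd 0 n).comp (affSd 1 n) = (affSd 0 n).comp (affBd 0 n) :=
      affChain_hom_ext fun v => by
        simp only [LinearMap.comp_apply, affSd_single]
        simp only [affSd, LinearMap.id_apply]
        exact affBd_cone_affBd _ _
    exact LinearMap.congr_fun this c
  | succ k ih =>
    have : (affBd (k + 1) n).comp (affSd (k + 2) n) = (affSd (k + 1) n).comp (affBd (k + 1) n) :=
      affChain_hom_ext fun v => by
        simp only [LinearMap.comp_apply, affSd_single]
        rw [affBd_cone, ih, affBd_affBd, map_zero, map_zero, sub_zero]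
    exact LinearMap.congr_fun this c

/-- On a simplex `v` the homotopy is the cone over `z = v - H∂v`, whose boundary is `z` minus the
cone over `∂z`. By induction `∂z` is the subdivision of `∂v`, and the cone over that is the
subdivision of `v`. -/
theorem affBd_affHt {k n : ℕ} (c : AffChain (k + 1) n) :
    affBd (k + 1) n (affHt (k + 1) n c) =
      c - affSd (k + 1) n c - affHt k n (affBd k n c) := by
  induction k with
  | zero =>
    have : (affBd 1 n).comp (affHt 1 n) =
        LinearMap.id - affSd 1 n - (affHt 0 n).comp (affBd 0 n) :=
      affChain_hom_ext fun v => by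
        simp only [LinearMap.comp_apply, LinearMap.sub_apply, affSd_single, affHt_single]
        rw [affBd_cone]
        simp only [affSd, affHt, LinearMap.zero_apply, sub_zero, LinearMap.id_apply]
    exact LinearMap.congr_fun this c
  | succ k ih =>
    have : (affBd (k + 2) n).comp (affHt (k + 2) n) =
        LinearMap.id - affSd (k + 2) n - (affHt (k + 1) n).comp (affBd (k + 1) n) :=
      affChain_hom_ext fun v => by
        simp only [LinearMap.comp_apply, LinearMap.sub_apply, affSd_single, affHt_single]
        rw [affBd_cone, map_sub (affBd (k + 1) n), ih, affBd_affBd, map_zero, sub_zero,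
          sub_sub_cancel]
        simp only [LinearMap.id_apply]
        abel
    exact LinearMap.congr_fun this c

/-- The effect of an affine map on affine chains. -/
def affMap (k : ℕ) {n m : ℕ} (w : Fin (n + 1) → Simplex m) : AffChain k n →ₗ[ℤ] AffChain k m :=
  Finsupp.lmapDomain ℤ ℤ fun v i => comb w (v i)

@[simp]
theorem affMap_single {k n m : ℕ} (w : Fin (n + 1) → Simplex m) (v : Fin (k + 1) → Simplex n)
    (a : ℤ) : affMap k w (Finsupp.single v a) = Finsupp.single (fun i => comb w (v i)) a := by
  simp [affMap]

theorem push_comb_real {k n m : ℕ} (w : Fin (n + 1) → Simplex m) (c : AffChain k n) :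
    push k (comb w) (real k n c) = real k m (affMap k w c) := by
  have : (push k (comb w)).comp (real k n) = (real k m).comp (affMap k w) :=
    affChain_hom_ext fun v => by simp [comb_comb]
  exact LinearMap.congr_fun this c

theorem affMap_affBd {k n m : ℕ} (w : Fin (n + 1) → Simplex m) (c : AffChain (k + 1) n) :
    affMap k w (affBd k n c) = affBd k m (affMap (k + 1) w c) := by
  have : (affMap k w).comp (affBd k n) = (affBd k m).comp (affMap (k + 1) w) :=
    affChain_hom_ext fun v => by simp
  exact LinearMap.congr_fun this c

theorem affMap_cone {k n m : ℕ} (w : Fin (n + 1) → Simplex m) (b : Simplex n)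
    (c : AffChain k n) : affMap (k + 1) w (cone b c) = cone (comb w b) (affMap k w c) := by
  have : (affMap (k + 1) w).comp (cone b) = (cone (comb w b)).comp (affMap k w) :=
    affChain_hom_ext fun v => by
      simp only [LinearMap.comp_apply, cone_single, affMap_single]
      congr 1
      funext i
      refine Fin.cases ?_ (fun m => ?_) i <;> simp
  exact LinearMap.congr_fun this c

theorem affMap_affSd {k n m : ℕ} (w : Fin (n + 1) → Simplex m) (c : AffChain k n) :
    affMap k w (affSd k n c) = affSd k m (affMap k w c) := by
  induction k with
  | zero => rfl
  | succ k ih =>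
    have : (affMap (k + 1) w).comp (affSd (k + 1) n) = (affSd (k + 1) m).comp (affMap (k + 1) w) :=
      affChain_hom_ext fun v => by
        simp only [LinearMap.comp_apply, affSd_single, affMap_single]
        rw [affMap_cone, ih, affMap_affBd, comb_bary, affMap_single]
    exact LinearMap.congr_fun this c

theorem affMap_affHt {k n m : ℕ} (w : Fin (n + 1) → Simplex m) (c : AffChain k n) :
    affMap (k + 1) w (affHt k n c) = affHt k m (affMap k w c) := by
  induction k with
  | zero => simp [affHt]
  | succ k ih =>
    have : (affMap (k + 2) w).comp (affHt (k + 1) n) = (affHt (k + 1) m).comp (affMap (k + 1) w) :=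
      affChain_hom_ext fun v => by
        simp only [LinearMap.comp_apply, affHt_single, affMap_single]
        rw [affMap_cone, map_sub, ih, affMap_affBd, comb_bary, affMap_single]
    exact LinearMap.congr_fun this c

/-- The identity simplex, as an affine simplex. -/
def idAff (n : ℕ) : AffChain n n := Finsupp.single (fun i => stdSimplex.vertex i) 1

theorem affMap_idAff {k n : ℕ} (v : Fin (k + 1) → Simplex n) :
    affMap k v (idAff k) = Finsupp.single v 1 := by
  simp [idAff, comb_vertex]

theorem affBd_idAff (k : ℕ) : affBd k (k + 1) (idAff (k + 1)) = ∑ i : Fin (k + 2),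
    (-1 : ℤ) ^ (i : ℕ) • affMap k (fun j => stdSimplex.vertex (i.succAbove j)) (idAff k) := by
  simp_rw [affMap_idAff]
  simp [idAff]

/-! ### Mesh of the subdivision -/

theorem dist_comb_le {n k : ℕ} {v : Fin (k + 1) → Simplex n} {x : Simplex n} {r : ℝ}
    (h : ∀ i, dist x (v i) ≤ r) (t : Simplex k) : dist x (comb v t) ≤ r := by
  have hr : 0 ≤ r := dist_nonneg.trans (h 0)
  rw [Subtype.dist_eq, dist_pi_le_iff hr]
  intro c
  have e : x.1 c - (comb v t).1 c = ∑ i, t.1 i * (x.1 c - (v i).1 c) := by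
    simp_rw [mul_sub, Finset.sum_sub_distrib, ← Finset.sum_mul, t.2.2, one_mul, comb_apply]
  rw [Real.dist_eq, e]
  calc |∑ i, t.1 i * (x.1 c - (v i).1 c)| ≤ ∑ i, |t.1 i * (x.1 c - (v i).1 c)| :=
        Finset.abs_sum_le_sum_abs _ _
    _ ≤ ∑ i, t.1 i * r := Finset.sum_le_sum fun i _ => by
        rw [abs_mul, abs_of_nonneg (t.2.1 i)]
        refine mul_le_mul_of_nonneg_left ?_ (t.2.1 i)
        have := h i
        rw [Subtype.dist_eq, dist_pi_le_iff hr] at this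
        simpa [Real.dist_eq] using this c
    _ = r := by rw [← Finset.sum_mul, t.2.2, one_mul]

theorem dist_bary_le {n k : ℕ} {v : Fin (k + 1) → Simplex n} {D : ℝ} (hD : 0 ≤ D)
    (h : ∀ i j, dist (v i) (v j) ≤ D) (j : Fin (k + 1)) :
    dist (bary v) (v j) ≤ k / (k + 1) * D := by
  have hk : (0 : ℝ) < k + 1 := by positivity
  rw [Subtype.dist_eq, dist_pi_le_iff (by positivity)]
  intro c
  -- The term `i = j` drops out of the average; the `k` remaining terms with weight `1 / (k + 1)`
  -- give the factor `k / (k + 1)`.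
  have e : (bary v).1 c - (v j).1 c =
      (k + 1 : ℝ)⁻¹ * ∑ i ∈ Finset.univ.erase j, ((v i).1 c - (v j).1 c) := by
    rw [Finset.sum_erase _ (by simp), Finset.sum_sub_distrib, bary, comb_apply]
    have hb : ∀ i, (stdSimplex.barycenter : Simplex k).1 i = (k + 1 : ℝ)⁻¹ := fun i => by
      have := stdSimplex.barycenter_apply (𝕜 := ℝ) i
      simpa using this
    simp_rw [hb, ← Finset.mul_sum]
    simp
    field_simp
  rw [Real.dist_eq, e, abs_mul, abs_of_pos (by positivity)]
  have hs : |∑ i ∈ Finset.univ.erase j, ((v i).1 c - (v j).1 c)| ≤ k * D := by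
    refine (Finset.abs_sum_le_sum_abs _ _).trans ?_
    have : ∀ i ∈ Finset.univ.erase j, |(v i).1 c - (v j).1 c| ≤ D := fun i _ => by
      have := h i j
      rw [Subtype.dist_eq, dist_pi_le_iff hD] at this
      simpa [Real.dist_eq] using this c
    refine (Finset.sum_le_card_nsmul _ _ _ this).trans ?_
    simp
  calc (k + 1 : ℝ)⁻¹ * |∑ i ∈ Finset.univ.erase j, ((v i).1 c - (v j).1 c)|
      ≤ (k + 1 : ℝ)⁻¹ * (k * D) := by gcongr
    _ = k / (k + 1) * D := by field_simp

/-- A linear map on finitely supported functions preserves supports as soon as it does so on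
basis elements. -/
theorem map_mem_supported {α β : Type*} {s : Set α} {t : Set β} (f : (α →₀ ℤ) →ₗ[ℤ] (β →₀ ℤ))
    (h : ∀ a ∈ s, f (Finsupp.single a 1) ∈ Finsupp.supported ℤ ℤ t) {c : α →₀ ℤ}
    (hc : c ∈ Finsupp.supported ℤ ℤ s) : f c ∈ Finsupp.supported ℤ ℤ t := by
  rw [Finsupp.supported_eq_span_single] at hc
  have : Submodule.span ℤ ((fun i => Finsupp.single i (1 : ℤ)) '' s) ≤
      (Finsupp.supported ℤ ℤ t).comap f := by
    rw [Submodule.span_le]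
    rintro _ ⟨a, ha, rfl⟩
    exact h a ha
  exact this hc

/-- The first clause, that the new vertices lie in the old simplex, is carried along for the
induction: a new simplex is a cone from the barycenter over a piece of a face, and the clause bounds
the distance from the apex to that piece. -/
theorem affSd_mesh {k n : ℕ} {v : Fin (k + 1) → Simplex n} {D : ℝ} (hD : 0 ≤ D)
    (h : ∀ i j, dist (v i) (v j) ≤ D) :
    affSd k n (Finsupp.single v 1) ∈ Finsupp.supported ℤ ℤ
      {w | (∀ i, ∃ t, w i = comb v t) ∧ ∀ i j, dist (w i) (w j) ≤ k / (k + 1) * D} := by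
  induction k with
  | zero =>
    refine Finsupp.single_mem_supported _ _ ⟨fun i => ⟨stdSimplex.vertex i, ?_⟩, fun i j => ?_⟩
    · rw [comb_vertex]
    · rw [Subsingleton.elim (α := Fin 1) i j, dist_self]; simp
  | succ k ih =>
    rw [affSd_single, affBd_single, map_sum, map_sum]
    refine Submodule.sum_mem _ fun a _ => ?_
    rw [map_smul, map_smul]
    refine Submodule.smul_mem _ _ ?_
    refine map_mem_supported (cone (bary v)) ?_
      (ih (v := fun j => v (a.succAbove j)) fun i j => h _ _)
    rintro w ⟨hw1, hw2⟩
    rw [cone_single]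
    have hb : ∀ i, dist (bary v) (w i) ≤ ((k + 1 : ℕ) : ℝ) / ((k + 1 : ℕ) + 1) * D := fun i => by
      obtain ⟨t, ht⟩ := hw1 i
      rw [ht]
      exact dist_comb_le (fun i => dist_bary_le hD h _) t
    have hmono : (k : ℝ) / (k + 1) * D ≤ ((k + 1 : ℕ) : ℝ) / ((k + 1 : ℕ) + 1) * D := by
      refine mul_le_mul_of_nonneg_right ?_ hD
      rw [div_le_div_iff₀ (by positivity) (by positivity)]
      push_cast
      nlinarith
    have h0 : 0 ≤ ((k + 1 : ℕ) : ℝ) / ((k + 1 : ℕ) + 1) * D := by positivity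
    refine Finsupp.single_mem_supported _ _ ⟨fun i => ?_, fun i j => ?_⟩
    · refine Fin.cases ⟨_, rfl⟩ (fun i => ?_) i
      obtain ⟨t, ht⟩ := hw1 i
      exact ⟨face a t, by
        rw [Fin.cons_succ, ht, ← comb_face]; rfl⟩
    · refine Fin.cases (Fin.cases ?_ (fun j => ?_) j) (fun i => Fin.cases ?_ (fun j => ?_) j) i
      · simpa using h0
      · simpa using hb j
      · simpa [dist_comm] using hb i
      · simpa using (hw2 i j).trans hmono

theorem affSd_iterate_mesh (k n m : ℕ) {D : ℝ} (hD : 0 ≤ D) {c : AffChain k n}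
    (hc : c ∈ Finsupp.supported ℤ ℤ {w | ∀ i j, dist (w i) (w j) ≤ D}) :
    (affSd k n)^[m] c ∈ Finsupp.supported ℤ ℤ
      {w | ∀ i j, dist (w i) (w j) ≤ ((k : ℝ) / (k + 1)) ^ m * D} := by
  induction m with
  | zero => simpa using hc
  | succ m ih =>
    rw [Function.iterate_succ_apply']
    refine map_mem_supported (affSd k n) (fun v hv => ?_) ih
    refine Finsupp.supported_mono (fun w hw => ?_) (affSd_mesh (by positivity) hv)
    intro i j
    have := hw.2 i j
    rw [pow_succ']
    linarith

/-! ### Subdivision of singular chains -/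

section

variable {X Y : Type} [TopologicalSpace X] [TopologicalSpace Y]

/-- Barycentric subdivision of singular chains. -/
def sd (k : ℕ) : Chain k X →ₗ[ℤ] Chain k X :=
  Finsupp.linearCombination ℤ fun σ : C(Simplex k, X) => push k σ (real k k (affSd k k (idAff k)))

/-- The chain homotopy from the identity to the subdivision of singular chains. -/
def ht (k : ℕ) : Chain k X →ₗ[ℤ] Chain (k + 1) X :=
  Finsupp.linearCombination ℤ fun σ : C(Simplex k, X) =>
    push (k + 1) σ (real (k + 1) k (affHt k k (idAff k)))

theorem sd_single {k : ℕ} (σ : C(Simplex k, X)) :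
    sd k (Finsupp.single σ 1) = push k σ (real k k (affSd k k (idAff k))) := by
  simp [sd]

theorem ht_single {k : ℕ} (σ : C(Simplex k, X)) :
    ht k (Finsupp.single σ 1) = push (k + 1) σ (real (k + 1) k (affHt k k (idAff k))) := by
  simp [ht]

theorem sd_push {k : ℕ} (f : C(X, Y)) (c : Chain k X) : sd k (push k f c) = push k f (sd k c) := by
  have : (sd k).comp (push k f) = (push k f).comp (sd k) := chain_hom_ext fun σ => by
    simp [sd_single, push_comp]
  exact LinearMap.congr_fun this c

theorem sd_real {k n : ℕ} (c : AffChain k n) : sd k (real k n c) = real k n (affSd k n c) := by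
  have : (sd k).comp (real k n) = (real k n).comp (affSd k n) := affChain_hom_ext fun v => by
    simp only [LinearMap.comp_apply, real_single, sd_single]
    rw [push_comb_real, affMap_affSd, affMap_idAff]
  exact LinearMap.congr_fun this c

theorem push_face_real {k m : ℕ} (i : Fin (k + 2)) (c : AffChain m k) :
    push m (face i) (real m k c) =
      real m (k + 1) (affMap m (fun j => stdSimplex.vertex (i.succAbove j)) c) := by
  rw [← push_comb_real]
  congr 2
  rw [← comb_face (fun j => stdSimplex.vertex j), comb_vertices, ContinuousMap.id_comp]

theorem bd_sd {k : ℕ} (c : Chain (k + 1) X) : bd k (sd (k + 1) c) = sd k (bd k c) := by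
  have : (bd k).comp (sd (k + 1)) = (sd k).comp (bd (X := X) k) := chain_hom_ext fun σ => by
    simp only [LinearMap.comp_apply, sd_single, bd_single]
    rw [← push_bd, ← real_affBd, affBd_affSd, affBd_idAff]
    simp only [map_sum, map_smul, sd_single, push_comp, push_face_real, affMap_affSd]
  exact LinearMap.congr_fun this c

theorem bd_ht {k : ℕ} (c : Chain (k + 1) X) :
    bd (k + 1) (ht (k + 1) c) = c - sd (k + 1) c - ht k (bd k c) := by
  have : (bd (k + 1)).comp (ht (k + 1)) =
      LinearMap.id - sd (k + 1) - (ht k).comp (bd (X := X) k) := chain_hom_ext fun σ => by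
    simp only [LinearMap.comp_apply, LinearMap.sub_apply, sd_single, ht_single, bd_single]
    rw [← push_bd, ← real_affBd, affBd_affHt, affBd_idAff]
    simp only [map_sum, map_sub, map_smul, ht_single, push_comp, push_face_real, affMap_affHt]
    congr 2
    simp [idAff, comb_vertices]
  exact LinearMap.congr_fun this c

/-- The chains all of whose simplices lie in one of the sets `A` and `B`. -/
def smallChains (k : ℕ) (A B : Set X) : Submodule ℤ (Chain k X) :=
  Finsupp.supported ℤ ℤ {σ | Set.range σ ⊆ A ∨ Set.range σ ⊆ B}

theorem push_mem_supported_range {k m : ℕ} (σ : C(Simplex k, X)) (c : Chain m (Simplex k)) :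
    push m σ c ∈ Finsupp.supported ℤ ℤ {τ : C(Simplex m, X) | Set.range τ ⊆ Set.range σ} := by
  refine map_mem_supported (s := Set.univ) (push m σ) (fun τ _ => ?_) (by simp)
  rw [push_single]
  refine Finsupp.single_mem_supported _ _ ?_
  rintro _ ⟨x, rfl⟩
  exact ⟨_, rfl⟩

theorem sd_mem_small {k : ℕ} {A B : Set X} {c : Chain k X} (hc : c ∈ smallChains k A B) :
    sd k c ∈ smallChains k A B := by
  refine map_mem_supported (sd k) (fun σ hσ => ?_) hc
  rw [sd_single]
  exact Finsupp.supported_mono (fun τ hτ => hσ.imp hτ.trans hτ.trans) (push_mem_supported_range _ _)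

theorem ht_mem_small {k : ℕ} {A B : Set X} {c : Chain k X} (hc : c ∈ smallChains k A B) :
    ht k c ∈ smallChains (k + 1) A B := by
  refine map_mem_supported (ht k) (fun σ hσ => ?_) hc
  rw [ht_single]
  exact Finsupp.supported_mono (fun τ hτ => hσ.imp hτ.trans hτ.trans) (push_mem_supported_range _ _)

theorem sd_iterate_mem_small {k : ℕ} {A B : Set X} {c : Chain k X} (hc : c ∈ smallChains k A B)
    (m : ℕ) : (sd k)^[m] c ∈ smallChains k A B := by
  induction m with
  | zero => exact hc
  | succ m ih => rw [Function.iterate_succ_apply']; exact sd_mem_small ih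

/-- For one simplex, compare a Lebesgue number of the pulled back cover with the mesh of the
iterated subdivision. For sums, small chains stay small under further subdivision, so the exponents
may be added. -/
theorem exists_sd_iterate_small {k : ℕ} {A B : Set X} (hA : IsOpen A) (hB : IsOpen B)
    (hAB : A ∪ B = Set.univ) (c : Chain k X) : ∃ m, (sd k)^[m] c ∈ smallChains k A B := by
  induction c using Finsupp.induction_linear with
  | zero => exact ⟨0, Submodule.zero_mem _⟩
  | add f g hf hg =>
    obtain ⟨m, hm⟩ := hf
    obtain ⟨m', hm'⟩ := hg
    refine ⟨m' + m, ?_⟩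
    rw [← Module.End.pow_apply, map_add, Module.End.pow_apply, Module.End.pow_apply]
    refine Submodule.add_mem _ ?_ ?_
    · rw [Function.iterate_add_apply]; exact sd_iterate_mem_small hm _
    · rw [add_comm m' m, Function.iterate_add_apply]; exact sd_iterate_mem_small hm' _
  | single σ a =>
    obtain ⟨δ, hδ, hball⟩ := lebesgue_number_lemma_of_metric (s := (Set.univ : Set (Simplex k)))
      (c := fun b : Bool => σ ⁻¹' (if b then A else B)) isCompact_univ
      (fun b => by cases b <;> simp [hA.preimage σ.continuous, hB.preimage σ.continuous])
      (fun x _ => by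
        rcases (hAB ▸ Set.mem_univ (σ x) : σ x ∈ A ∪ B) with h | h
        · exact Set.mem_iUnion.2 ⟨true, by simpa using h⟩
        · exact Set.mem_iUnion.2 ⟨false, by simpa using h⟩)
    obtain ⟨D, hD⟩ := (Metric.isBounded_iff.1 (isCompact_univ (X := Simplex k)).isBounded)
    have hD0 : 0 ≤ D := by
      have := hD (Set.mem_univ (stdSimplex.vertex 0)) (Set.mem_univ (stdSimplex.vertex 0))
      simpa using this
    have hk : (k : ℝ) / (k + 1) < 1 := by rw [div_lt_one (by positivity)]; linarith
    have hlim : Filter.Tendsto (fun m : ℕ => ((k : ℝ) / (k + 1)) ^ m * D) Filter.atTop (𝓝 0) := by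
      simpa using (tendsto_pow_atTop_nhds_zero_of_lt_one (by positivity) hk).mul_const D
    obtain ⟨m, hm⟩ := (hlim.eventually (gt_mem_nhds hδ)).exists
    refine ⟨m, ?_⟩
    have hmesh := affSd_iterate_mesh k k m hD0 (c := idAff k)
      (Finsupp.single_mem_supported _ _ fun i j => hD trivial trivial)
    -- By naturality, iterated subdivision of `σ` is the image under `σ` of the affine subdivision
    -- of the identity simplex, where the mesh estimate is available.
    have e : (sd k)^[m] (Finsupp.single σ a) = a • push k σ (real k k ((affSd k k)^[m] (idAff k))) := by
      have h1 : Finsupp.single σ a = a • push k σ (real k k (idAff k)) := by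
        simp [idAff, comb_vertices]
      rw [h1, ← Module.End.pow_apply, map_smul, Module.End.pow_apply]
      congr 1
      clear hmesh hm h1
      induction m with
      | zero => rfl
      | succ m ih => rw [Function.iterate_succ_apply', Function.iterate_succ_apply', ih, sd_push,
          sd_real]
    rw [e]
    refine Submodule.smul_mem _ _ ?_
    refine map_mem_supported ((push k σ).comp (real k k)) (fun w hw => ?_) hmesh
    simp only [LinearMap.comp_apply, real_single, push_single]
    refine Finsupp.single_mem_supported _ _ ?_
    obtain ⟨b, hb⟩ := hball (w 0) trivial
    have hsub : Set.range (σ.comp (comb w)) ⊆ if b then A else B := by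
      rintro _ ⟨t, rfl⟩
      refine hb ?_
      rw [Metric.mem_ball, dist_comm]
      exact (dist_comb_le (fun i => hw 0 i) t).trans_lt hm
    cases b
    · exact Or.inr (by simpa using hsub)
    · exact Or.inl (by simpa using hsub)

/-- A chain with small boundary is homologous to a small chain. -/
theorem exists_small_add_bd {k : ℕ} {A B : Set X} (hA : IsOpen A) (hB : IsOpen B)
    (hAB : A ∪ B = Set.univ) (c : Chain (k + 1) X) (hc : bd k c ∈ smallChains k A B) :
    ∃ s ∈ smallChains (k + 1) A B, ∃ w, c = s + bd (k + 1) w := by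
  -- Each subdivision changes the chain by a boundary and by the homotopy applied to the boundary of
  -- the chain. The latter is small because the boundary is small.
  have key : ∀ m, ∃ s ∈ smallChains (k + 1) A B, ∃ w,
      c = (sd (k + 1))^[m] c + s + bd (k + 1) w := by
    intro m
    induction m with
    | zero => exact ⟨0, Submodule.zero_mem _, 0, by simp⟩
    | succ m ih =>
      obtain ⟨s, hs, w, h⟩ := ih
      have hbd : bd k ((sd (k + 1))^[m] c) = (sd k)^[m] (bd k c) := by
        clear h
        induction m with
        | zero => rfl
        | succ m ih => rw [Function.iterate_succ_apply', Function.iterate_succ_apply', bd_sd, ih]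
      refine ⟨ht k ((sd k)^[m] (bd k c)) + s,
        Submodule.add_mem _ (ht_mem_small (sd_iterate_mem_small hc m)) hs,
        ht (k + 1) ((sd (k + 1))^[m] c) + w, ?_⟩
      rw [map_add, bd_ht, hbd, Function.iterate_succ_apply']
      conv_lhs => rw [h]
      abel
  obtain ⟨m, hm⟩ := exists_sd_iterate_small hA hB hAB c
  obtain ⟨s, hs, w, h⟩ := key m
  exact ⟨_, Submodule.add_mem _ hm hs, w, h⟩

end

end HeegaardGauss
end

open scoped Manifold ContDiff Topology
noncomputable section
namespace HeegaardGauss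

/-! ### The Mayer-Vietoris sequence -/

section

variable {Y : Type} [TopologicalSpace Y]

/-- The inclusion of a subspace in a larger one. -/
def incl {A B : Set Y} (h : A ⊆ B) : C(A, B) := ⟨Set.inclusion h, continuous_inclusion h⟩

theorem incl_injective {A B : Set Y} (h : A ⊆ B) : Function.Injective (incl h) :=
  Set.inclusion_injective h

theorem push_incl_incl {n : ℕ} {A B C : Set Y} (h : A ⊆ B) (h' : B ⊆ C) (c : Chain n A) :
    push n (incl h') (push n (incl h) c) = push n (incl (h.trans h')) c := by
  rw [← push_comp]; rfl

theorem Hmap_incl_incl {n : ℕ} {A B C : Set Y} (h : A ⊆ B) (h' : B ⊆ C) (c : Homology n A) :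
    Hmap n (incl h') (Hmap n (incl h) c) = Hmap n (incl (h.trans h')) c := by
  rw [← Hmap_comp]; rfl

theorem exists_push_incl {n : ℕ} {A X : Set Y} (h : A ⊆ X) {c : Chain n X}
    (hc : c ∈ Finsupp.supported ℤ ℤ {σ : C(Simplex n, X) | ∀ t, (σ t : Y) ∈ A}) :
    ∃ a, push n (incl h) a = c := by
  rw [Finsupp.supported_eq_span_single] at hc
  refine Submodule.span_induction (p := fun c _ => ∃ a, push n (incl h) a = c)
    ?_ ⟨0, map_zero _⟩ ?_ ?_ hc
  · rintro _ ⟨σ, hσ, rfl⟩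
    refine ⟨Finsupp.single ⟨fun t => ⟨σ t, hσ t⟩, ?_⟩ 1, ?_⟩
    · exact Continuous.subtype_mk (continuous_subtype_val.comp σ.continuous) _
    · rw [push_single]; rfl
  · rintro _ _ _ _ ⟨a, rfl⟩ ⟨b, rfl⟩
    exact ⟨a + b, map_add _ _ _⟩
  · rintro k _ _ ⟨a, rfl⟩
    exact ⟨k • a, map_smul _ _ _⟩

theorem push_incl_mem {n : ℕ} {A X : Set Y} (h : A ⊆ X) (a : Chain n A) :
    push n (incl h) a ∈ Finsupp.supported ℤ ℤ {σ : C(Simplex n, X) | ∀ t, (σ t : Y) ∈ A} := by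
  refine map_mem_supported (s := Set.univ) (push n (incl h)) (fun σ _ => ?_) (by simp)
  rw [push_single]
  exact Finsupp.single_mem_supported _ _ fun t => (σ t).2

/-- `X` is the union of its relatively open subsets `A` and `B`, whose intersection is `P`. -/
structure IsOpenUnion (A B X P : Set Y) : Prop where
  union : A ∪ B = X
  inter : A ∩ B = P
  open_left : ∃ U, IsOpen U ∧ A = X ∩ U
  open_right : ∃ U, IsOpen U ∧ B = X ∩ U

namespace IsOpenUnion

variable {A B X P : Set Y} (h : IsOpenUnion A B X P)
include h

theorem left : A ⊆ X := h.union ▸ Set.subset_union_left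
theorem right : B ⊆ X := h.union ▸ Set.subset_union_right
theorem interLeft : P ⊆ A := h.inter ▸ Set.inter_subset_left
theorem interRight : P ⊆ B := h.inter ▸ Set.inter_subset_right

/-- A chain of `X` supported both on simplices in `A` and on simplices in `B` is supported on
simplices in `P`. -/
theorem exists_inter {n : ℕ} {a : Chain n A} {b : Chain n B}
    (hab : push n (incl h.left) a = push n (incl h.right) b) :
    ∃ p, push n (incl h.interLeft) p = a ∧ push n (incl h.interRight) p = b := by
  have h1 := push_incl_mem h.left a
  have h2 := push_incl_mem h.right b
  rw [← hab] at h2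
  obtain ⟨p, hp⟩ := exists_push_incl (h.interLeft.trans h.left)
    (c := push n (incl h.left) a) <| by
    rw [Finsupp.mem_supported] at h1 h2 ⊢
    intro σ hσ t
    rw [← h.inter]
    exact ⟨h1 hσ t, h2 hσ t⟩
  refine ⟨p, push_injective n (incl_injective h.left) ?_,
    push_injective n (incl_injective h.right) ?_⟩
  · rw [push_incl_incl, hp]
  · rw [push_incl_incl, ← hab, ← hp]

theorem exists_of_small {n : ℕ} {c : Chain n X}
    (hc : c ∈ smallChains n (Subtype.val ⁻¹' A : Set X) (Subtype.val ⁻¹' B)) :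
    ∃ a b, c = push n (incl h.left) a + push n (incl h.right) b := by
  rw [smallChains, Set.ofPred_or, Finsupp.supported_union, Submodule.mem_sup] at hc
  obtain ⟨y, hy, z, hz, rfl⟩ := hc
  have hs : ∀ B' : Set Y, {σ : C(Simplex n, X) | Set.range σ ⊆ Subtype.val ⁻¹' B'} ⊆
      {σ : C(Simplex n, X) | ∀ t, (σ t : Y) ∈ B'} := fun B' σ hσ t => hσ ⟨t, rfl⟩
  obtain ⟨a, rfl⟩ := exists_push_incl h.left (c := y) (Finsupp.supported_mono (hs A) hy)
  obtain ⟨b, rfl⟩ := exists_push_incl h.right (c := z) (Finsupp.supported_mono (hs B) hz)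
  exact ⟨a, b, rfl⟩

theorem small_left {n : ℕ} (a : Chain n A) : push n (incl h.left) a ∈
    smallChains n (Subtype.val ⁻¹' A : Set X) (Subtype.val ⁻¹' B) := by
  refine Finsupp.supported_mono (fun σ hσ => Or.inl ?_) (push_incl_mem h.left a)
  rintro _ ⟨t, rfl⟩
  exact hσ t

theorem small_right {n : ℕ} (b : Chain n B) : push n (incl h.right) b ∈
    smallChains n (Subtype.val ⁻¹' A : Set X) (Subtype.val ⁻¹' B) := by
  refine Finsupp.supported_mono (fun σ hσ => Or.inr ?_) (push_incl_mem h.right b)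
  rintro _ ⟨t, rfl⟩
  exact hσ t

theorem exists_decomp {n : ℕ} (c : Chain (n + 1) X) (hc : bd n c ∈
    smallChains n (Subtype.val ⁻¹' A : Set X) (Subtype.val ⁻¹' B)) :
    ∃ a b w, c = push (n + 1) (incl h.left) a + push (n + 1) (incl h.right) b + bd (n + 1) w := by
  have ho : ∀ {B' : Set Y}, (∃ U, IsOpen U ∧ B' = X ∩ U) →
      IsOpen (Subtype.val ⁻¹' B' : Set X) := by
    rintro _ ⟨U, hU, rfl⟩
    rw [Set.preimage_inter, Subtype.coe_preimage_self, Set.univ_inter]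
    exact hU.preimage continuous_subtype_val
  obtain ⟨s, hs, w, rfl⟩ := exists_small_add_bd (ho h.open_left) (ho h.open_right) (by
    rw [← Set.preimage_union, h.union, Subtype.coe_preimage_self]) c hc
  obtain ⟨a, b, rfl⟩ := h.exists_of_small hs
  exact ⟨a, b, w, rfl⟩

/-- Exactness of the Mayer-Vietoris sequence at `H_n(A) ⊕ H_n(B)`. -/
theorem exact_mid {n : ℕ} {a : Homology n A} {b : Homology n B}
    (hab : Hmap n (incl h.left) a = Hmap n (incl h.right) b) :
    ∃ p, Hmap n (incl h.interLeft) p = a ∧ Hmap n (incl h.interRight) p = b := by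
  obtain ⟨α, rfl⟩ := cls_surjective n a
  obtain ⟨β, rfl⟩ := cls_surjective n b
  rw [Hmap_cls, Hmap_cls, ← sub_eq_zero, ← map_sub, cls_eq_zero_iff] at hab
  obtain ⟨w, hw⟩ := hab
  replace hw : bd n w = push n (incl h.left) α.1 - push n (incl h.right) β.1 := hw
  -- Up to a boundary, `w` is the sum of a chain `u` of `A` and a chain `v` of `B`. Then `α - ∂u`
  -- and `β + ∂v` agree in `X`, so they come from one chain of `P`.
  obtain ⟨u, v, w', rfl⟩ := h.exists_decomp w
    (hw ▸ Submodule.sub_mem _ (h.small_left _) (h.small_right _))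
  rw [map_add, map_add, bd_bd, add_zero, ← push_bd, ← push_bd] at hw
  obtain ⟨p, hpa, hpb⟩ := h.exists_inter (a := α.1 - bd n u) (b := β.1 + bd n v) <| by
    rw [map_sub, map_add, sub_eq_iff_eq_add, add_assoc, add_comm (push n _ _) (push n _ _), hw]
    abel
  have hp : p ∈ cyc n P := by
    cases n with
    | zero => trivial
    | succ n =>
      rw [mem_cyc_succ]
      apply push_injective n (incl_injective h.interLeft)
      rw [push_bd, hpa, map_sub, bd_bd, mem_cyc_succ.1 α.2, sub_zero, map_zero]
  refine ⟨cls n ⟨p, hp⟩, ?_, ?_⟩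
  · rw [Hmap_cls, ← sub_eq_zero, ← map_sub, cls_eq_zero_iff]
    exact ⟨-u, by simp [hpa]⟩
  · rw [Hmap_cls, ← sub_eq_zero, ← map_sub, cls_eq_zero_iff]
    exact ⟨v, by simp [hpb]⟩

-- Constructs a homomorphism from its graph. The connecting map depends on choices of chains;
-- described as a relation it is visibly additive, and only totality and single-valuedness are left
-- to prove.
omit h in
theorem exists_addHom_of_rel {α β : Type*} [AddCommGroup α] [AddCommGroup β]
    (R : AddSubgroup (α × β)) (tot : ∀ x, ∃ y, (x, y) ∈ R) (sv : ∀ y, (0, y) ∈ R → y = 0) :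
    ∃ f : α →+ β, ∀ x y, (x, y) ∈ R ↔ f x = y := by
  choose f hf using tot
  have uniq : ∀ x y, (x, y) ∈ R → y = f x := fun x y hxy => by
    have := R.sub_mem hxy (hf x)
    rw [Prod.mk_sub_mk, sub_self] at this
    exact sub_eq_zero.1 (sv _ this)
  refine ⟨⟨⟨f, (uniq 0 0 R.zero_mem).symm⟩, fun x y => (uniq _ _ ?_).symm⟩, fun x y =>
    ⟨fun h => (uniq x y h).symm, ?_⟩⟩
  · exact R.add_mem (hf x) (hf y)
  · rintro rfl
    exact hf x

/-- The relation defining the connecting homomorphism. -/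
def deltaRel (n : ℕ) : AddSubgroup (Homology (n + 1) X × Homology n P) where
  carrier := {xy | ∃ (u : Chain (n + 1) A) (v : Chain (n + 1) B) (p : cyc n P)
    (z : cyc (n + 1) X), push n (incl h.interLeft) p.1 = bd n u ∧
      push n (incl h.interRight) p.1 = -bd n v ∧
      z.1 = push (n + 1) (incl h.left) u + push (n + 1) (incl h.right) v ∧
      cls (n + 1) z = xy.1 ∧ cls n p = xy.2}
  zero_mem' := ⟨0, 0, 0, 0, by simp, by simp, by simp, map_zero _, map_zero _⟩
  add_mem' := by
    rintro ⟨_, _⟩ ⟨_, _⟩ ⟨u, v, p, z, h1, h2, h3, rfl, rfl⟩ ⟨u', v', p', z', h1', h2', h3', rfl, rfl⟩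
    refine ⟨u + u', v + v', p + p', z + z', ?_, ?_, ?_, map_add _ _ _, map_add _ _ _⟩
    · rw [AddSubgroup.coe_add, map_add, map_add, h1, h1']
    · rw [AddSubgroup.coe_add, map_add, map_add, h2, h2', neg_add]
    · rw [AddSubgroup.coe_add, map_add, map_add, h3, h3']; abel
  neg_mem' := by
    rintro ⟨_, _⟩ ⟨u, v, p, z, h1, h2, h3, rfl, rfl⟩
    refine ⟨-u, -v, -p, -z, ?_, ?_, ?_, map_neg _ _, map_neg _ _⟩
    · rw [AddSubgroup.coe_neg, map_neg, map_neg, h1]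
    · rw [AddSubgroup.coe_neg, map_neg, map_neg, h2]
    · rw [AddSubgroup.coe_neg, map_neg, map_neg, h3]; abel

/-- Totality is subdivision of a cycle into a part in `A` and a part in `B`. For single-valuedness,
subdivide a chain bounding the cycle: the two parts correct `u` and `-v` to a common chain of `P`,
which bounds `p`. -/
theorem exists_delta (n : ℕ) : ∃ δ : Homology (n + 1) X →+ Homology n P,
    ∀ x y, (x, y) ∈ h.deltaRel n ↔ δ x = y := by
  refine exists_addHom_of_rel _ (fun x => ?_) ?_
  · obtain ⟨z, rfl⟩ := cls_surjective _ x
    obtain ⟨u, v, w, hz⟩ := h.exists_decomp z.1 (by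
      rw [mem_cyc_succ.1 z.2]; exact Submodule.zero_mem _)
    have hbd : bd n (push (n + 1) (incl h.left) u + push (n + 1) (incl h.right) v) = 0 := by
      have := mem_cyc_succ.1 z.2
      rwa [hz, map_add, bd_bd, add_zero] at this
    obtain ⟨p, hpa, hpb⟩ := h.exists_inter (a := bd n u) (b := -bd n v) <| by
      rw [map_neg, push_bd, push_bd, eq_neg_iff_add_eq_zero, ← map_add, hbd]
    have hp : p ∈ cyc n P := by
      cases n with
      | zero => trivial
      | succ n =>
        rw [mem_cyc_succ]
        apply push_injective n (incl_injective h.interLeft)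
        rw [push_bd, hpa, bd_bd, map_zero]
    refine ⟨cls n ⟨p, hp⟩, u, v, ⟨p, hp⟩, ⟨_, mem_cyc_succ.2 hbd⟩, hpa, hpb, rfl, ?_, rfl⟩
    rw [← sub_eq_zero, ← map_sub, cls_eq_zero_iff]
    exact ⟨-w, by simp [hz]⟩
  · rintro _ ⟨u, v, p, z, h1, h2, h3, h4, rfl⟩
    rw [cls_eq_zero_iff] at h4
    obtain ⟨w, hw⟩ := h4
    rw [h3] at hw
    obtain ⟨u', v', w', rfl⟩ := h.exists_decomp w
      (hw ▸ Submodule.add_mem _ (h.small_left _) (h.small_right _))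
    rw [map_add, map_add, bd_bd, add_zero, ← push_bd, ← push_bd] at hw
    obtain ⟨q, hqa, -⟩ := h.exists_inter (a := u - bd (n + 1) u') (b := bd (n + 1) v' - v) <| by
      rw [map_sub, map_sub, sub_eq_sub_iff_add_eq_add, ← hw]
      abel
    rw [cls_eq_zero_iff]
    refine ⟨q, push_injective n (incl_injective h.interLeft) ?_⟩
    rw [push_bd, hqa, map_sub, bd_bd, sub_zero, h1]

/-- The connecting homomorphism of the Mayer-Vietoris sequence. -/
def delta (n : ℕ) : Homology (n + 1) X →+ Homology n P := (h.exists_delta n).choose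

theorem mem_deltaRel {n : ℕ} {x : Homology (n + 1) X} {y : Homology n P} :
    (x, y) ∈ h.deltaRel n ↔ h.delta n x = y := (h.exists_delta n).choose_spec x y

/-- Exactness of the Mayer-Vietoris sequence at `H_{n+1}(X)`. -/
theorem exists_of_delta_eq_zero {n : ℕ} {x : Homology (n + 1) X} (hx : h.delta n x = 0) :
    ∃ a b, x = Hmap (n + 1) (incl h.left) a + Hmap (n + 1) (incl h.right) b := by
  obtain ⟨u, v, p, z, h1, h2, h3, rfl, h5⟩ := h.mem_deltaRel.2 hx
  obtain ⟨q, hq⟩ := (cls_eq_zero_iff p).1 h5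
  have hu : u - push (n + 1) (incl h.interLeft) q ∈ cyc (n + 1) A := by
    rw [mem_cyc_succ, map_sub, ← push_bd, hq, h1, sub_self]
  have hv : v + push (n + 1) (incl h.interRight) q ∈ cyc (n + 1) B := by
    rw [mem_cyc_succ, map_add, ← push_bd, hq, h2, add_neg_cancel]
  refine ⟨cls (n + 1) ⟨_, hu⟩, cls (n + 1) ⟨_, hv⟩, ?_⟩
  rw [Hmap_cls, Hmap_cls, ← map_add]
  congr 1
  apply Subtype.ext
  rw [AddSubgroup.coe_add, h3]
  simp only [map_sub, map_add, push_incl_incl]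
  abel

/-- Exactness of the Mayer-Vietoris sequence at `H_n(P)`. -/
theorem exists_delta_eq {n : ℕ} {p : Homology n P} (ha : Hmap n (incl h.interLeft) p = 0)
    (hb : Hmap n (incl h.interRight) p = 0) : ∃ x, h.delta n x = p := by
  obtain ⟨π, rfl⟩ := cls_surjective _ p
  rw [Hmap_cls, cls_eq_zero_iff] at ha hb
  obtain ⟨u, hu⟩ := ha
  obtain ⟨v, hv⟩ := hb
  have hz : push (n + 1) (incl h.left) u + push (n + 1) (incl h.right) (-v) ∈ cyc (n + 1) X := by
    rw [mem_cyc_succ, map_add, ← push_bd, ← push_bd, map_neg, map_neg, hu, hv, push_incl_incl,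
      push_incl_incl, add_neg_cancel]
  exact ⟨cls (n + 1) ⟨_, hz⟩, h.mem_deltaRel.1
    ⟨u, -v, π, ⟨_, hz⟩, hu.symm, by rw [map_neg, neg_neg, hv], rfl, rfl, rfl⟩⟩

theorem delta_inter_left {n : ℕ} (x : Homology (n + 1) X) :
    Hmap n (incl h.interLeft) (h.delta n x) = 0 := by
  obtain ⟨u, v, p, z, h1, h2, h3, rfl, h5⟩ := h.mem_deltaRel.2 (rfl : h.delta n x = _)
  replace h5 : cls n p = h.delta n (cls (n + 1) z) := h5
  rw [← h5, Hmap_cls, cls_eq_zero_iff]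
  exact ⟨u, h1.symm⟩

theorem delta_inter_right {n : ℕ} (x : Homology (n + 1) X) :
    Hmap n (incl h.interRight) (h.delta n x) = 0 := by
  obtain ⟨u, v, p, z, h1, h2, h3, rfl, h5⟩ := h.mem_deltaRel.2 (rfl : h.delta n x = _)
  replace h5 : cls n p = h.delta n (cls (n + 1) z) := h5
  rw [← h5, Hmap_cls, cls_eq_zero_iff]
  exact ⟨-v, (map_neg _ _).trans h2.symm⟩

end IsOpenUnion

end

end HeegaardGauss
end

open scoped Manifold ContDiff Topology
noncomputable section
namespace HeegaardGauss

/-! ### Homotopy invariance, degree zero, and acyclic spaces -/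

section

variable {X Y : Type} [TopologicalSpace X] [TopologicalSpace Y]

theorem Hmap_bijective_of_inverse {f : C(X, Y)} {g : C(Y, X)}
    (h1 : (g.comp f).Homotopic (ContinuousMap.id X))
    (h2 : (f.comp g).Homotopic (ContinuousMap.id Y)) (n : ℕ) :
    Function.Bijective (Hmap n f) := by
  refine Function.bijective_iff_has_inverse.2 ⟨Hmap n g, fun x => ?_, fun y => ?_⟩
  · rw [← Hmap_comp, Hmap_homotopic n h1, Hmap_id]
  · rw [← Hmap_comp, Hmap_homotopic n h2, Hmap_id]

theorem Hmap_comp_bijective {Z : Type} [TopologicalSpace Z] {n : ℕ} {f : C(X, Y)} {g : C(Y, Z)}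
    (hg : Function.Bijective (Hmap n g)) (hf : Function.Bijective (Hmap n f)) :
    Function.Bijective (Hmap n (g.comp f)) := by
  have : ⇑(Hmap n (g.comp f)) = Hmap n g ∘ Hmap n f := funext fun x => Hmap_comp _ _ _ _
  rw [this]
  exact hg.comp hf

theorem Hmap_bijective_homeomorph (e : X ≃ₜ Y) (n : ℕ) :
    Function.Bijective (Hmap n (e : C(X, Y))) := by
  refine Hmap_bijective_of_inverse (g := (e.symm : C(Y, X))) ?_ ?_ n
  · convert ContinuousMap.Homotopic.refl _; ext x; simp
  · convert ContinuousMap.Homotopic.refl _; ext x; simp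

/-- Two maps into a subset of a topological vector space are homotopic if the segments joining
corresponding values stay in the subset. -/
theorem homotopic_of_segment {E : Type} [AddCommGroup E] [Module ℝ E] [TopologicalSpace E]
    [ContinuousAdd E] [ContinuousSMul ℝ E] {S : Set E} {f g : C(X, S)}
    (h : ∀ x, ∀ t ∈ Set.Icc (0 : ℝ) 1, (1 - t) • (f x : E) + t • (g x : E) ∈ S) :
    f.Homotopic g := by
  refine ⟨⟨⟨fun p => ⟨(1 - (p.1 : ℝ)) • (f p.2 : E) + (p.1 : ℝ) • (g p.2 : E),
    h p.2 p.1 p.1.2⟩, ?_⟩, fun x => ?_, fun x => ?_⟩⟩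
  · refine Continuous.subtype_mk ?_ _
    fun_prop
  · simp
  · simp

theorem subsingleton_homology_of_bijective {n : ℕ} {f : C(X, Y)}
    (h : Function.Bijective (Hmap n f)) [Subsingleton (Homology n X)] :
    Subsingleton (Homology n Y) := h.2.subsingleton

instance subsingleton_homology_of_contractible [ContractibleSpace X] (n : ℕ) :
    Subsingleton (Homology (n + 1) X) := by
  have h0 : Subsingleton (Homology (n + 1) Unit) :=
    ModuleCat.subsingleton_of_isZero
      (AlgebraicTopology.isZero_singularHomologyFunctor_of_totallyDisconnectedSpace
        (ModuleCat.{0} ℤ) (n + 1) (ModuleCat.of ℤ ℤ) (TopCat.of Unit) n.succ_ne_zero)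
  obtain ⟨e⟩ := ContractibleSpace.hequiv_unit X
  have := Hmap_bijective_of_inverse e.left_inv e.right_inv (n + 1)
  exact this.1.subsingleton

theorem subsingleton_homology_of_isEmpty [IsEmpty X] (n : ℕ) : Subsingleton (Homology n X) := by
  have : IsEmpty C(Simplex n, X) := ⟨fun σ => isEmptyElim (σ (stdSimplex.vertex 0))⟩
  have : Subsingleton (Chain n X) := inferInstance
  exact (cls_surjective n).subsingleton

/-- A homomorphism on cycles that vanishes on boundaries descends to homology. -/
def liftCls {A : Type*} [AddCommGroup A] {n : ℕ} (f : cyc n X →+ A)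
    (hf : ∀ w, f ⟨bd n w, bd_mem_cyc w⟩ = 0) : Homology n X →+ A :=
  (cls n).liftOfSurjective (cls_surjective n) ⟨f, fun c hc => by
    obtain ⟨w, hw⟩ := (cls_eq_zero_iff c).1 hc
    obtain rfl : ⟨bd n w, bd_mem_cyc w⟩ = c := Subtype.ext hw
    exact hf w⟩

@[simp]
theorem liftCls_cls {A : Type*} [AddCommGroup A] {n : ℕ} (f : cyc n X →+ A)
    (hf : ∀ w, f ⟨bd n w, bd_mem_cyc w⟩ = 0) (c : cyc n X) :
    liftCls f hf (cls n c) = f c :=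
  AddMonoidHom.liftOfRightInverse_comp_apply _ _ _ _ _

/-! ### Homology in degree zero -/

/-- The sum of the coefficients of a chain. -/
def coeffSum (X : Type) [TopologicalSpace X] (n : ℕ) : Chain n X →+ ℤ :=
  Finsupp.liftAddHom fun _ => AddMonoidHom.id ℤ

@[simp]
theorem coeffSum_single {n : ℕ} (σ : C(Simplex n, X)) (a : ℤ) :
    coeffSum X n (Finsupp.single σ a) = a := by
  simp [coeffSum]

theorem coeffSum_bd (w : Chain 1 X) : coeffSum X 0 (bd 0 w) = 0 := by
  have : (coeffSum X 0).comp (bd 0).toAddMonoidHom = 0 := chain_addHom_ext fun σ => by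
    simp [Fin.sum_univ_two]
  exact DFunLike.congr_fun this w

/-- The augmentation. -/
def aug (X : Type) [TopologicalSpace X] : Homology 0 X →+ ℤ :=
  liftCls ((coeffSum X 0).comp (cyc 0 X).subtype) fun w => coeffSum_bd w

/-- The class of a `0`-chain. -/
def cls₀ (X : Type) [TopologicalSpace X] : Chain 0 X →+ Homology 0 X :=
  (cls 0).comp ((AddMonoidHom.id _).codRestrict (cyc 0 X) fun _ => trivial)

theorem cls₀_surjective : Function.Surjective (cls₀ X) := fun x => by
  obtain ⟨c, rfl⟩ := cls_surjective 0 x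
  exact ⟨c.1, rfl⟩

/-- The class of a point. -/
def pt (x : X) : Homology 0 X := cls₀ X (Finsupp.single (ContinuousMap.const _ x) 1)

theorem cls₀_single (σ : C(Simplex 0, X)) :
    cls₀ X (Finsupp.single σ 1) = pt (σ (stdSimplex.vertex 0)) := by
  rw [pt]
  congr 2
  ext t
  rw [Subsingleton.elim t (stdSimplex.vertex 0)]
  rfl

@[simp]
theorem aug_pt (x : X) : aug X (pt x) = 1 :=
  (liftCls_cls _ _ _).trans (coeffSum_single _ _)

@[simp]
theorem Hmap_pt (f : C(X, Y)) (x : X) : Hmap 0 f (pt x) = pt (f x) := by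
  refine (Hmap_cls f _).trans ?_
  rw [pt, cls₀, AddMonoidHom.comp_apply]
  congr 1
  exact Subtype.ext (push_single _ _ _ _)

/-- Degree zero homology is generated by points. Applied to quotient maps, this also yields the
generation statements below. -/
theorem homology_zero_hom_ext {A : Type*} [AddCommGroup A] {f g : Homology 0 X →+ A}
    (h : ∀ x, f (pt x) = g (pt x)) : f = g := by
  have : f.comp (cls₀ X) = g.comp (cls₀ X) := chain_addHom_ext fun σ => by
    rw [AddMonoidHom.comp_apply, AddMonoidHom.comp_apply, cls₀_single, h]
  ext x
  obtain ⟨c, rfl⟩ := cls₀_surjective x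
  exact DFunLike.congr_fun this c

theorem aug_Hmap (f : C(X, Y)) (x : Homology 0 X) : aug Y (Hmap 0 f x) = aug X x :=
  DFunLike.congr_fun (homology_zero_hom_ext (f := (aug Y).comp (Hmap 0 f)) (g := aug X)
    fun x => by simp) x

theorem pt_eq_of_joined {x y : X} (h : Joined x y) : pt x = pt y := by
  have := Hmap_homotopic 0 ((ContinuousMap.homotopic_const_iff (Y := Unit)).2 h)
  have h2 := DFunLike.congr_fun this (pt ())
  simpa using h2

theorem eq_aug_smul_pt [PathConnectedSpace X] (x₀ : X) (x : Homology 0 X) :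
    x = aug X x • pt x₀ :=
  DFunLike.congr_fun (homology_zero_hom_ext (f := AddMonoidHom.id (Homology 0 X))
    (g := (zmultiplesHom _ (pt x₀)).comp (aug X)) fun x => by
      simpa using pt_eq_of_joined (PathConnectedSpace.joined x x₀)) x

theorem aug_bijective [PathConnectedSpace X] : Function.Bijective (aug X) := by
  have x₀ : X := Classical.choice PathConnectedSpace.nonempty
  refine ⟨(injective_iff_map_eq_zero _).2 fun x hx => ?_, fun k => ⟨k • pt x₀, by simp⟩⟩
  rw [eq_aug_smul_pt x₀ x, hx, zero_smul]

theorem exists_eq_add_of_joined {p q : X} (h : ∀ x, Joined x p ∨ Joined x q)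
    (x : Homology 0 X) : ∃ n m : ℤ, x = n • pt p + m • pt q := by
  have : (⊤ : AddSubgroup (Homology 0 X)) ≤ AddSubgroup.closure {pt p, pt q} := by
    intro y _
    rw [← QuotientAddGroup.eq_zero_iff]
    refine DFunLike.congr_fun (homology_zero_hom_ext
      (f := QuotientAddGroup.mk' (AddSubgroup.closure {pt p, pt q})) (g := 0) fun z => ?_) y
    rw [QuotientAddGroup.mk'_apply, AddMonoidHom.zero_apply, QuotientAddGroup.eq_zero_iff]
    rcases h z with h | h <;> rw [pt_eq_of_joined h] <;> exact AddSubgroup.subset_closure (by simp)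
  obtain ⟨n, m, h⟩ := AddSubgroup.mem_closure_pair.1 (this (AddSubgroup.mem_top x))
  exact ⟨n, m, h.symm⟩

end

/-! ### Consequences of the Mayer-Vietoris sequence -/

namespace IsOpenUnion

variable {Y : Type} [TopologicalSpace Y] {A B X P : Set Y} (h : IsOpenUnion A B X P)
include h

/-- The end of the Mayer-Vietoris sequence, where no connecting map is left: every point of `X` lies
in `A` or in `B`. -/
theorem exists_zero (x : Homology 0 X) :
    ∃ a b, x = Hmap 0 (incl h.left) a + Hmap 0 (incl h.right) b := by
  have : (⊤ : AddSubgroup (Homology 0 X)) ≤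
      (Hmap 0 (incl h.left)).range ⊔ (Hmap 0 (incl h.right)).range := by
    intro y _
    rw [← QuotientAddGroup.eq_zero_iff]
    refine DFunLike.congr_fun (homology_zero_hom_ext
      (f := QuotientAddGroup.mk' ((Hmap 0 (incl h.left)).range ⊔ (Hmap 0 (incl h.right)).range))
      (g := 0) fun z => ?_) y
    rw [QuotientAddGroup.mk'_apply, AddMonoidHom.zero_apply, QuotientAddGroup.eq_zero_iff]
    obtain ⟨z, hz⟩ := z
    rcases (h.union ▸ hz : z ∈ A ∪ B) with hz' | hz'
    · exact AddSubgroup.mem_sup_left ⟨pt ⟨z, hz'⟩, Hmap_pt _ _⟩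
    · exact AddSubgroup.mem_sup_right ⟨pt ⟨z, hz'⟩, Hmap_pt _ _⟩
  obtain ⟨_, ⟨a, rfl⟩, _, ⟨b, rfl⟩, h⟩ := AddSubgroup.mem_sup.1 (this (AddSubgroup.mem_top x))
  exact ⟨a, b, h.symm⟩

theorem subsingleton {n : ℕ} [Subsingleton (Homology (n + 1) A)]
    [Subsingleton (Homology (n + 1) B)] [Subsingleton (Homology n P)] :
    Subsingleton (Homology (n + 1) X) := by
  refine subsingleton_of_forall_eq 0 fun x => ?_
  obtain ⟨a, b, rfl⟩ := h.exists_of_delta_eq_zero (Subsingleton.elim (h.delta n x) 0)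
  rw [Subsingleton.elim a 0, Subsingleton.elim b 0, map_zero, map_zero, add_zero]

/-- Gluing `B` along a part with the same homology changes nothing. Degree `n + 1` of the conclusion
also uses degree `n` of the hypothesis: the connecting map dies in `B`, hence is zero. -/
theorem bijective_left (hP : ∀ n, Function.Bijective (Hmap n (incl h.interRight))) (n : ℕ) :
    Function.Bijective (Hmap n (incl h.left)) := by
  have key : ∀ (a : Homology n A) (b : Homology n B), ∃ a',
      Hmap n (incl h.left) a + Hmap n (incl h.right) b = Hmap n (incl h.left) a' := fun a b => by
    obtain ⟨p, rfl⟩ := (hP n).2 b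
    exact ⟨a + Hmap n (incl h.interLeft) p, by
      rw [map_add, Hmap_incl_incl, Hmap_incl_incl]⟩
  refine ⟨(injective_iff_map_eq_zero _).2 fun a ha => ?_, fun x => ?_⟩
  · obtain ⟨p, rfl, hp⟩ := h.exact_mid (a := a) (b := 0) (by rw [ha, map_zero])
    rw [(injective_iff_map_eq_zero _).1 (hP n).1 p hp, map_zero]
  · have : ∃ a b, x = Hmap n (incl h.left) a + Hmap n (incl h.right) b := by
      cases n with
      | zero => exact h.exists_zero x
      | succ n =>
        exact h.exists_of_delta_eq_zero
          ((injective_iff_map_eq_zero _).1 (hP n).1 _ (h.delta_inter_right x))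
    obtain ⟨a, b, rfl⟩ := this
    obtain ⟨a', h'⟩ := key a b
    exact ⟨a', h'.symm⟩

theorem bijective_left_of_contractible [ContractibleSpace P] [ContractibleSpace B] (n : ℕ) :
    Function.Bijective (Hmap n (incl h.left)) := by
  refine h.bijective_left (fun n => ?_) n
  cases n with
  | zero =>
    have e : aug B ∘ Hmap 0 (incl h.interRight) = aug P := funext fun x => aug_Hmap _ x
    exact (aug_bijective.of_comp_iff' _).1 (e ▸ aug_bijective)
  | succ n =>
    exact ⟨fun x y _ => Subsingleton.elim _ _, fun y => ⟨0, Subsingleton.elim _ _⟩⟩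

/-- The image of the connecting map dies in `B`, so it has augmentation zero. Injectivity of the
augmentation is the form of connectedness that is available for overlaps known only up to homology.
-/
theorem delta_zero_eq_zero (hP : Function.Injective (aug P)) (x : Homology 1 X) :
    h.delta 0 x = 0 := by
  apply hP
  rw [← aug_Hmap (incl h.interRight), h.delta_inter_right, map_zero, map_zero]

theorem surjective_one (hP : Function.Injective (aug P)) [Subsingleton (Homology 1 B)] :
    Function.Surjective (Hmap 1 (incl h.left)) := fun x => by
  obtain ⟨a, b, rfl⟩ := h.exists_of_delta_eq_zero (h.delta_zero_eq_zero hP x)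
  exact ⟨a, by rw [Subsingleton.elim b 0, map_zero, add_zero]⟩

theorem exists_of_map_eq_zero {n : ℕ} {a : Homology n A} (ha : Hmap n (incl h.left) a = 0) :
    ∃ p, Hmap n (incl h.interLeft) p = a := by
  obtain ⟨p, hp, -⟩ := h.exact_mid (a := a) (b := 0) (by rw [ha, map_zero])
  exact ⟨p, hp⟩

theorem delta_injective {n : ℕ} [Subsingleton (Homology (n + 1) A)]
    [Subsingleton (Homology (n + 1) B)] : Function.Injective (h.delta n) := by
  refine (injective_iff_map_eq_zero _).2 fun x hx => ?_
  obtain ⟨a, b, rfl⟩ := h.exists_of_delta_eq_zero hx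
  rw [Subsingleton.elim a 0, Subsingleton.elim b 0, map_zero, map_zero, add_zero]

theorem delta_bijective {n : ℕ} [Subsingleton (Homology (n + 1) A)]
    [Subsingleton (Homology (n + 1) B)] [Subsingleton (Homology n A)]
    [Subsingleton (Homology n B)] : Function.Bijective (h.delta n) :=
  ⟨h.delta_injective, fun _ => h.exists_delta_eq (Subsingleton.elim _ _) (Subsingleton.elim _ _)⟩

theorem subsingleton_one [PathConnectedSpace P] [Subsingleton (Homology 1 A)]
    [Subsingleton (Homology 1 B)] : Subsingleton (Homology 1 X) :=
  subsingleton_of_forall_eq 0 fun x => h.delta_injective (by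
    rw [h.delta_zero_eq_zero aug_bijective.1, map_zero])

/-- Gluing two path connected spaces along a space with two path components adds at most one
generator to the first homology. -/
theorem exists_generator_one [PathConnectedSpace A] [PathConnectedSpace B] {p q : P}
    (hpq : ∀ x, Joined x p ∨ Joined x q) : ∃ e : Homology 1 X, ∀ x, ∃ a b, ∃ k : ℤ,
      x = Hmap 1 (incl h.left) a + Hmap 1 (incl h.right) b + k • e := by
  -- The new generator runs from one component of the overlap to the other through `A` and back
  -- through `B`.
  obtain ⟨e, he⟩ := h.exists_delta_eq (n := 0) (p := pt p - pt q)
    (aug_bijective.1 (by simp)) (aug_bijective.1 (by simp))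
  refine ⟨e, fun x => ?_⟩
  obtain ⟨n, m, hnm⟩ := exists_eq_add_of_joined hpq (h.delta 0 x)
  have h0 : n + m = 0 := by
    have := congrArg (aug P) hnm
    rw [← aug_Hmap (incl h.interRight), h.delta_inter_right] at this
    simpa using this.symm
  obtain ⟨a, b, hab⟩ := h.exists_of_delta_eq_zero (x := x - n • e) <| by
    rw [map_sub, map_zsmul, he, hnm, eq_neg_of_add_eq_zero_right h0, zsmul_sub, neg_zsmul]
    abel
  exact ⟨a, b, n, by rw [← hab, sub_add_cancel]⟩

end IsOpenUnion

/-! ### Punctured vector spaces -/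

section

theorem sphere_homotopy {E : Type} [NormedAddCommGroup E] [NormedSpace ℝ E] {r : ℝ} (hr : 0 < r)
    {O : Set E} (hO : Convex ℝ O) (hsub : Metric.sphere (0 : E) r ⊆ O \ {0}) (n : ℕ) :
    Function.Bijective (Hmap n (incl hsub)) := by
  have hne : ∀ x : (O \ {0} : Set E), ‖(x : E)‖ ≠ 0 := fun x => norm_ne_zero_iff.2 x.2.2
  let g : C((O \ {0} : Set E), Metric.sphere (0 : E) r) :=
    ⟨fun x => ⟨(r / ‖(x : E)‖) • (x : E), by
      rw [mem_sphere_zero_iff_norm, norm_smul, norm_div, norm_norm, Real.norm_of_nonneg hr.le,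
        div_mul_cancel₀ _ (hne x)]⟩, by
      refine Continuous.subtype_mk ?_ _
      exact (continuous_const.div (continuous_norm.comp continuous_subtype_val) hne).smul
        continuous_subtype_val⟩
  refine Hmap_bijective_of_inverse (g := g) ?_ ?_ n
  · convert ContinuousMap.Homotopic.refl _
    ext x
    have hx : ‖(x : E)‖ = r := mem_sphere_zero_iff_norm.1 x.2
    change (x : E) = (r / ‖(x : E)‖) • (x : E)
    rw [hx, div_self hr.ne', one_smul]
  · refine homotopic_of_segment fun x t ht => ?_
    have hg : ((incl hsub).comp g) x = (r / ‖(x : E)‖) • (x : E) := rfl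
    refine ⟨hO (hsub (g x).2).1 x.2.1 (sub_nonneg.2 ht.2) ht.1 (by ring), ?_⟩
    -- The segment from `x` to its radial projection consists of positive multiples of `x`, so it
    -- misses the origin.
    have hpos : 0 < (1 - t) * (r / ‖(x : E)‖) + t := by
      have : 0 < r / ‖(x : E)‖ := div_pos hr (norm_pos_iff.2 x.2.2)
      rcases ht.1.eq_or_lt with rfl | h0
      · simpa using this
      · have := mul_nonneg (sub_nonneg.2 ht.2) this.le
        linarith
    rw [hg, smul_smul, ContinuousMap.id_apply, ← add_smul]
    exact smul_ne_zero hpos.ne' x.2.2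

variable (E : Type) [NormedAddCommGroup E] [NormedSpace ℝ E]

/-- The complement of the origin. -/
abbrev punctured : Set E := {x | x ≠ 0}

/-- The complement of the axis in `E × ℝ`. -/
abbrev offAxis : Set (E × ℝ) := {p | p.1 ≠ 0}

-- A suspension: removing from `E × ℝ` one closed half of the axis leaves a star-shaped set, and two
-- such sets cover the complement of the origin and meet in the complement of the axis.
omit [NormedSpace ℝ E] in
theorem punctured_isOpenUnion : IsOpenUnion {p : E × ℝ | p.1 ≠ 0 ∨ 0 < p.2}
    {p : E × ℝ | p.1 ≠ 0 ∨ p.2 < 0} (punctured (E × ℝ)) (offAxis E) := by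
  refine ⟨?_, ?_, ⟨_, ?_, (Set.inter_eq_right.2 ?_).symm⟩, ⟨_, ?_, (Set.inter_eq_right.2 ?_).symm⟩⟩
  · ext ⟨e, t⟩
    simp only [Set.mem_union, Set.mem_ofPred_eq, ne_eq, Prod.mk_eq_zero]
    rcases lt_trichotomy t 0 with h | h | h
    · have := h.ne; tauto
    · simp [h]
    · have := h.ne'; tauto
  · ext ⟨e, t⟩
    simp only [Set.mem_inter_iff, Set.mem_ofPred_eq, ne_eq]
    constructor
    · rintro ⟨h | h, h' | h'⟩
      · exact h
      · exact h
      · exact h'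
      · exact absurd h h'.not_gt
    · exact fun h => ⟨Or.inl h, Or.inl h⟩
  · exact (isOpen_ne_fun continuous_fst continuous_const).union
      (isOpen_lt continuous_const continuous_snd)
  · rintro ⟨e, t⟩ h h0
    rw [Prod.mk_eq_zero] at h0
    rcases h with h | h
    · exact h h0.1
    · exact h.ne' h0.2
  · exact (isOpen_ne_fun continuous_fst continuous_const).union
      (isOpen_lt continuous_snd continuous_const)
  · rintro ⟨e, t⟩ h h0
    rw [Prod.mk_eq_zero] at h0
    rcases h with h | h
    · exact h h0.1
    · exact h.ne h0.2

instance contractible_upper : ContractibleSpace {p : E × ℝ | p.1 ≠ 0 ∨ 0 < p.2} := by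
  refine StarConvex.contractibleSpace (x := ((0 : E), (1 : ℝ))) ?_ ⟨(0, 1), Or.inr one_pos⟩
  rintro ⟨e, t⟩ h a b ha hb hab
  simp only [Set.mem_ofPred_eq, Prod.smul_mk, Prod.mk_add_mk, smul_zero, zero_add, smul_eq_mul,
    mul_one] at h ⊢
  rcases hb.eq_or_lt with rfl | hb
  · right; linarith
  · rcases h with h | h
    · exact Or.inl (smul_ne_zero hb.ne' h)
    · exact Or.inr (by positivity)

instance contractible_lower : ContractibleSpace {p : E × ℝ | p.1 ≠ 0 ∨ p.2 < 0} := by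
  refine StarConvex.contractibleSpace (x := ((0 : E), (-1 : ℝ))) ?_ ⟨(0, -1), Or.inr (by simp)⟩
  rintro ⟨e, t⟩ h a b ha hb hab
  simp only [Set.mem_ofPred_eq, Prod.smul_mk, Prod.mk_add_mk, smul_zero, zero_add, smul_eq_mul,
    mul_neg, mul_one] at h ⊢
  rcases hb.eq_or_lt with rfl | hb
  · right; linarith
  · rcases h with h | h
    · exact Or.inl (smul_ne_zero hb.ne' h)
    · exact Or.inr (by nlinarith)

theorem offAxis_bijective : ∃ f : C(punctured E, offAxis E),
    ∀ n, Function.Bijective (Hmap n f) := by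
  let f : C(punctured E, offAxis E) := ⟨fun x => ⟨(x.1, 0), x.2⟩, by fun_prop⟩
  let g : C(offAxis E, punctured E) := ⟨fun x => ⟨x.1.1, x.2⟩, by fun_prop⟩
  refine ⟨f, fun n => Hmap_bijective_of_inverse (g := g) ?_ ?_ n⟩
  · exact ContinuousMap.Homotopic.refl _
  · refine homotopic_of_segment fun x t ht => ?_
    have : (1 - t) • (((f.comp g) x : E × ℝ)).1 + t • (x : E × ℝ).1 = (x : E × ℝ).1 := by
      change (1 - t) • (x : E × ℝ).1 + t • (x : E × ℝ).1 = (x : E × ℝ).1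
      rw [← add_smul, sub_add_cancel, one_smul]
    change (1 - t) • (((f.comp g) x : E × ℝ)).1 + t • (x : E × ℝ).1 ≠ 0
    rw [this]
    exact x.2

/-- The suspension isomorphism. Low degrees are excluded since the two halves have homology in
degree zero; degree one is treated separately by connectedness of the overlap. -/
theorem punctured_prod_equiv (n : ℕ) :
    Nonempty (Homology (n + 2) (punctured (E × ℝ)) ≃+ Homology (n + 1) (punctured E)) := by
  obtain ⟨f, hf⟩ := offAxis_bijective E
  exact ⟨(AddEquiv.ofBijective _ (punctured_isOpenUnion E).delta_bijective).trans
    (AddEquiv.ofBijective _ (hf (n + 1))).symm⟩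

theorem punctured_prod_one [PathConnectedSpace (punctured E)] :
    Subsingleton (Homology 1 (punctured (E × ℝ))) := by
  have : PathConnectedSpace (offAxis E) :=
    Function.Surjective.pathConnectedSpace
      (f := fun p : punctured E × ℝ => (⟨(p.1.1, p.2), p.1.2⟩ : offAxis E))
      (fun x => ⟨(⟨x.1.1, x.2⟩, x.1.2), rfl⟩) (by fun_prop)
  exact (punctured_isOpenUnion E).subsingleton_one

instance pathConnected_punctured_prod (F : Type) [NormedAddCommGroup F] [NormedSpace ℝ F]
    [Nontrivial F] : PathConnectedSpace (punctured (F × ℝ)) := by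
  have hu := (punctured_isOpenUnion F).union
  have h1 : IsPathConnected {p : F × ℝ | p.1 ≠ 0 ∨ 0 < p.2} :=
    isPathConnected_iff_pathConnectedSpace.2 inferInstance
  have h2 : IsPathConnected {p : F × ℝ | p.1 ≠ 0 ∨ p.2 < 0} :=
    isPathConnected_iff_pathConnectedSpace.2 inferInstance
  rw [← isPathConnected_iff_pathConnectedSpace, ← hu]
  obtain ⟨e, he⟩ := exists_ne (0 : F)
  exact h1.union h2 ⟨(e, 0), Or.inl he, Or.inl he⟩

theorem joined_of_convex {F : Type} [NormedAddCommGroup F] [NormedSpace ℝ F] {C S : Set F}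
    (hC : Convex ℝ C) (hCS : C ⊆ S) {x y : S} (hx : x.1 ∈ C) (hy : y.1 ∈ C) : Joined x y := by
  have h := (hC.isPathConnected ⟨_, hx⟩).joinedIn _ hx _ hy
  have := (h.mono hCS).joined_subtype
  exact this

/-- A union of two disjoint open convex sets has no homology in positive degrees. -/
theorem subsingleton_homology_of_two_convex {F : Type} [NormedAddCommGroup F] [NormedSpace ℝ F]
    {A B X : Set F} (h : IsOpenUnion A B X ∅) (hA : Convex ℝ A) (hB : Convex ℝ B)
    (hA' : A.Nonempty) (hB' : B.Nonempty) (n : ℕ) : Subsingleton (Homology (n + 1) X) := by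
  have := hA.contractibleSpace hA'
  have := hB.contractibleSpace hB'
  have := subsingleton_homology_of_isEmpty (X := (∅ : Set F)) n
  exact h.subsingleton

theorem punctured_real_isOpenUnion :
    IsOpenUnion (Set.Iio (0 : ℝ)) (Set.Ioi 0) (punctured ℝ) ∅ := by
  refine ⟨?_, ?_, ⟨_, isOpen_Iio, (Set.inter_eq_right.2 ?_).symm⟩,
    ⟨_, isOpen_Ioi, (Set.inter_eq_right.2 ?_).symm⟩⟩
  · ext x; simp
  · ext x; simp only [Set.mem_inter_iff, Set.mem_Iio, Set.mem_Ioi, Set.mem_empty_iff_false,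
      iff_false]; rintro ⟨h, h'⟩; linarith
  · exact fun x hx => (show x < 0 from hx).ne
  · exact fun x hx => (show 0 < x from hx).ne'

instance subsingleton_homology_punctured_real (n : ℕ) :
    Subsingleton (Homology (n + 1) (punctured ℝ)) :=
  subsingleton_homology_of_two_convex punctured_real_isOpenUnion (convex_Iio 0) (convex_Ioi 0)
    ⟨-1, by simp⟩ ⟨1, by simp⟩ n

instance subsingleton_homology_punctured_plane (n : ℕ) :
    Subsingleton (Homology (n + 2) (punctured (ℝ × ℝ))) :=
  (punctured_prod_equiv ℝ n).some.toEquiv.subsingleton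

/-- Here the overlap of the two halves is a pair of half planes, so there is at most one generator.
That it has infinite order will follow from winding numbers. -/
theorem exists_generator_punctured_plane :
    ∃ e : Homology 1 (punctured (ℝ × ℝ)), ∀ x, ∃ k : ℤ, x = k • e := by
  have hj : ∀ x : offAxis ℝ, Joined x ⟨((-1 : ℝ), 0), by simp⟩ ∨
      Joined x ⟨((1 : ℝ), 0), by simp⟩ := by
    rintro ⟨⟨a, b⟩, ha⟩
    rcases lt_or_gt_of_ne (show a ≠ 0 from ha) with h | h
    · exact Or.inl (joined_of_convex (C := Set.Iio (0 : ℝ) ×ˢ Set.univ)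
        ((convex_Iio 0).prod convex_univ) (fun x hx => (show x.1 < 0 from hx.1).ne)
        ⟨h, trivial⟩ ⟨by simp, trivial⟩)
    · exact Or.inr (joined_of_convex (C := Set.Ioi (0 : ℝ) ×ˢ Set.univ)
        ((convex_Ioi 0).prod convex_univ) (fun x hx => (show 0 < x.1 from hx.1).ne')
        ⟨h, trivial⟩ ⟨by simp, trivial⟩)
  obtain ⟨e, he⟩ := (punctured_isOpenUnion ℝ).exists_generator_one hj
  refine ⟨e, fun x => ?_⟩
  obtain ⟨a, b, k, hx⟩ := he x
  rw [Subsingleton.elim a 0, Subsingleton.elim b 0, map_zero, map_zero, zero_add, zero_add] at hx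
  exact ⟨k, hx⟩

end

end HeegaardGauss
end

open scoped Manifold ContDiff Topology
noncomputable section
namespace HeegaardGauss

/-! ### Winding numbers -/

section

/-- A contraction of `A` gives a homotopy from a constant map to `σ`; the constant lifts, and the
covering `ℝ → ℝ/ℤ` has the homotopy lifting property. -/
theorem exists_lift_circle {A : Type} [TopologicalSpace A] [ContractibleSpace A]
    (σ : C(A, UnitAddCircle)) : ∃ τ : C(A, ℝ), ∀ a, (τ a : UnitAddCircle) = σ a := by
  obtain ⟨a₀, ⟨F⟩⟩ := id_nullhomotopic A
  obtain ⟨r, hr⟩ := QuotientAddGroup.mk_surjective (σ a₀)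
  let H : C(unitInterval × A, UnitAddCircle) :=
    σ.comp F.symm.toContinuousMap
  have H0 : ∀ a, H (0, a) = ((ContinuousMap.const A r a : ℝ) : UnitAddCircle) := fun a => by
    change σ (F.symm (0, a)) = _
    rw [F.symm.apply_zero]; exact hr.symm
  let L := (AddCircle.isCoveringMap_coe (1 : ℝ)).liftHomotopy H (ContinuousMap.const A r) H0
  have hL := (AddCircle.isCoveringMap_coe (1 : ℝ)).liftHomotopy_lifts H (ContinuousMap.const A r) H0
  refine ⟨⟨fun a => L (1, a), by fun_prop⟩, fun a => ?_⟩
  refine (congrFun hL (1, a)).trans ?_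
  change σ (F.symm (1, a)) = _
  rw [F.symm.apply_one]; rfl

theorem lift_sub_eq {A : Type} [TopologicalSpace A] [PreconnectedSpace A] {τ τ' : A → ℝ}
    (hτ : Continuous τ) (hτ' : Continuous τ')
    (h : ∀ a, (τ a : UnitAddCircle) = (τ' a : UnitAddCircle)) (a b : A) :
    τ b - τ a = τ' b - τ' a := by
  have h1 : (τ : A → ℝ) = fun x => τ' x + (τ a - τ' a) := by
    refine (AddCircle.isCoveringMap_coe (1 : ℝ)).eq_of_comp_eq hτ (hτ'.add continuous_const) ?_ a
      (by ring)
    funext x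
    simp [h]
  rw [h1]; ring

instance (n : ℕ) : ContractibleSpace (Simplex n) :=
  (convex_stdSimplex ℝ (Fin (n + 1))).contractibleSpace ⟨_, single_mem_stdSimplex ℝ 0⟩

/-- The increment of a lift of a singular `1`-simplex of the circle. -/
def rise (σ : C(Simplex 1, UnitAddCircle)) : ℝ :=
  (exists_lift_circle σ).choose (stdSimplex.vertex 1) -
    (exists_lift_circle σ).choose (stdSimplex.vertex 0)

theorem rise_eq {σ : C(Simplex 1, UnitAddCircle)} {τ : Simplex 1 → ℝ} (hτ : Continuous τ)
    (h : ∀ a, (τ a : UnitAddCircle) = σ a) :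
    rise σ = τ (stdSimplex.vertex 1) - τ (stdSimplex.vertex 0) :=
  lift_sub_eq (ContinuousMap.continuous _) hτ (fun a => by
    rw [h, (exists_lift_circle σ).choose_spec]) _ _

/-- The total increment of a singular `1`-chain of the circle. -/
def riseSum : Chain 1 UnitAddCircle →+ ℝ :=
  Finsupp.liftAddHom fun σ => zmultiplesHom ℝ (rise σ)

@[simp]
theorem riseSum_single (σ : C(Simplex 1, UnitAddCircle)) :
    riseSum (Finsupp.single σ 1) = rise σ := by
  simp [riseSum]

theorem riseSum_bd (w : Chain 2 UnitAddCircle) : riseSum (bd 1 w) = 0 := by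
  have : riseSum.comp (bd 1).toAddMonoidHom = 0 := chain_addHom_ext fun σ => by
    -- One lift on the whole triangle serves for its three edges, so the increments telescope.
    obtain ⟨τ, hτ⟩ := exists_lift_circle σ
    have e : ∀ i : Fin 3, rise (σ.comp (face i)) =
        τ (stdSimplex.vertex (i.succAbove 1)) - τ (stdSimplex.vertex (i.succAbove 0)) := fun i => by
      rw [rise_eq (τ := fun a => τ (face i a)) (by fun_prop) (fun a => hτ _), face_vertex,
        face_vertex]
    rw [AddMonoidHom.comp_apply, LinearMap.toAddMonoidHom_coe, bd_single, map_sum]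
    simp only [map_zsmul, riseSum_single, e, AddMonoidHom.zero_apply]
    refine (Fin.sum_univ_three _).trans ?_
    change (-1 : ℤ) ^ 0 • (τ (stdSimplex.vertex 2) - τ (stdSimplex.vertex 1)) +
      (-1 : ℤ) ^ 1 • (τ (stdSimplex.vertex 2) - τ (stdSimplex.vertex 0)) +
      (-1 : ℤ) ^ 2 • (τ (stdSimplex.vertex 1) - τ (stdSimplex.vertex 0)) = 0
    simp
  exact DFunLike.congr_fun this w

/-- Modulo `1` the total increment depends only on the boundary of the chain; hence it is an integer
on cycles. -/
theorem coe_riseSum (c : Chain 1 UnitAddCircle) : ((riseSum c : ℝ) : UnitAddCircle) =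
    Finsupp.liftAddHom (fun σ : C(Simplex 0, UnitAddCircle) =>
      zmultiplesHom UnitAddCircle (σ (stdSimplex.vertex 0))) (bd 0 c) := by
  have : (QuotientAddGroup.mk' (AddSubgroup.zmultiples (1 : ℝ))).comp riseSum =
      (Finsupp.liftAddHom (fun σ : C(Simplex 0, UnitAddCircle) =>
        zmultiplesHom UnitAddCircle (σ (stdSimplex.vertex 0)))).comp (bd 0).toAddMonoidHom :=
    chain_addHom_ext fun σ => by
      obtain ⟨τ, hτ⟩ := exists_lift_circle σ
      simp only [AddMonoidHom.comp_apply, riseSum_single, LinearMap.toAddMonoidHom_coe, bd_single,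
        map_sum, map_zsmul, Finsupp.liftAddHom_apply_single]
      rw [rise_eq τ.continuous hτ]
      have b0 : (face (n := 0) 0) (stdSimplex.vertex 0) = stdSimplex.vertex 1 := face_vertex _ _
      have b1 : (face (n := 0) 1) (stdSimplex.vertex 0) = stdSimplex.vertex 0 := face_vertex _ _
      refine Eq.trans ?_ (Fin.sum_univ_two _).symm
      simp [b0, b1, hτ, sub_eq_add_neg]
  exact DFunLike.congr_fun this c

/-- The winding number of a class of the circle, as a real number. -/
def windReal : Homology 1 UnitAddCircle →+ ℝ :=
  liftCls (riseSum.comp (cyc 1 UnitAddCircle).subtype) riseSum_bd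

theorem exists_windReal_eq (x : Homology 1 UnitAddCircle) : ∃ n : ℤ, (n : ℝ) = windReal x := by
  obtain ⟨c, rfl⟩ := cls_surjective 1 x
  have h := coe_riseSum c.1
  rw [mem_cyc_succ.1 c.2, map_zero, AddCircle.coe_eq_zero_iff] at h
  obtain ⟨n, hn⟩ := h
  refine ⟨n, Eq.trans ?_ (liftCls_cls _ _ _).symm⟩
  rw [zsmul_eq_mul, mul_one] at hn
  exact hn

/-- The winding number. -/
def wind : Homology 1 UnitAddCircle →+ ℤ where
  toFun x := (exists_windReal_eq x).choose
  map_zero' := by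
    have := (exists_windReal_eq 0).choose_spec.trans (map_zero _)
    exact_mod_cast this
  map_add' x y := by
    have h := (exists_windReal_eq (x + y)).choose_spec.trans ((map_add _ _ _).trans
      (congrArg₂ (· + ·) (exists_windReal_eq x).choose_spec.symm
        (exists_windReal_eq y).choose_spec.symm))
    exact_mod_cast h

theorem coe_wind (x : Homology 1 UnitAddCircle) : (wind x : ℝ) = windReal x :=
  (exists_windReal_eq x).choose_spec

theorem wind_loopClass {γ : C(UnitAddCircle, UnitAddCircle)} {g : ℝ → ℝ} (hg : Continuous g)
    (h : ∀ t ∈ Set.Icc (0 : ℝ) 1, (g t : UnitAddCircle) = γ t) : (wind (loopClass γ) : ℝ) = g 1 - g 0 := by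
  rw [coe_wind]
  refine (liftCls_cls _ _ _).trans ((riseSum_single _).trans ?_)
  rw [rise_eq (τ := fun s : Simplex 1 => g (s.1 1)) (hg.comp ((continuous_apply _).comp
    continuous_subtype_val)) fun s => h _ (mem_Icc_of_mem_stdSimplex s.2 1)]
  simp

theorem wind_loopClass_id : wind (loopClass (ContinuousMap.id _)) = 1 := by
  have := wind_loopClass (γ := ContinuousMap.id _) (g := id) continuous_id fun t _ => rfl
  simp only [id, sub_zero] at this
  exact_mod_cast this

theorem loopClass_eq {X : Type} [TopologicalSpace X] (γ : C(UnitAddCircle, X)) :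
    loopClass γ = Hmap 1 γ (loopClass (ContinuousMap.id _)) := by
  rw [Hmap_loopClass, ContinuousMap.comp_id]

/-! ### Homology of spheres -/

theorem sphere_punctured (E : Type) [NormedAddCommGroup E] [NormedSpace ℝ E] {r : ℝ}
    (hr : 0 < r) : ∃ f : C(Metric.sphere (0 : E) r, punctured E),
      ∀ n, Function.Bijective (Hmap n f) := by
  have hsub : Metric.sphere (0 : E) r ⊆ Set.univ \ {0} := fun x hx => by
    refine ⟨trivial, fun h0 => ?_⟩
    rw [Set.mem_singleton_iff.1 h0, mem_sphere_zero_iff_norm, norm_zero] at hx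
    exact hr.ne hx
  have h : ∀ T : Set E, Set.univ \ {0} = T →
      ∃ f : C(Metric.sphere (0 : E) r, T), ∀ n, Function.Bijective (Hmap n f) := by
    rintro T rfl
    exact ⟨incl hsub, sphere_homotopy hr convex_univ hsub⟩
  exact h _ (by ext; simp [punctured])

/-- A linear homeomorphism restricts to the complements of the origins. -/
def puncturedHomeomorph {E F : Type} [NormedAddCommGroup E] [NormedSpace ℝ E]
    [NormedAddCommGroup F] [NormedSpace ℝ F] (e : E ≃L[ℝ] F) : punctured E ≃ₜ punctured F :=
  e.toHomeomorph.subtype fun x => by simp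

theorem circle_equiv_punctured_plane (n : ℕ) :
    Nonempty (Homology n UnitAddCircle ≃+ Homology n (punctured (ℝ × ℝ))) := by
  obtain ⟨f, hf⟩ := sphere_punctured ℂ one_pos
  let e1 : UnitAddCircle ≃ₜ Circle := AddCircle.homeomorphCircle one_ne_zero
  let e2 : Circle ≃ₜ Metric.sphere (0 : ℂ) 1 := Homeomorph.setCongr (by ext; simp)
  exact ⟨(AddEquiv.ofBijective _ (Hmap_bijective_homeomorph (e1.trans e2) n)).trans
    ((AddEquiv.ofBijective _ (hf n)).trans
    (AddEquiv.ofBijective _ (Hmap_bijective_homeomorph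
      (puncturedHomeomorph Complex.equivRealProdCLM) n)))⟩

/-- The group is cyclic, and the class of the identity is `k` times a generator. Its winding number
is `1`, so `k` divides `1` and the identity generates too. -/
theorem eq_smul_loopClass_id (x : Homology 1 UnitAddCircle) :
    ∃ k : ℤ, x = k • loopClass (ContinuousMap.id _) := by
  obtain ⟨φ⟩ := circle_equiv_punctured_plane 1
  obtain ⟨e, he⟩ := exists_generator_punctured_plane
  have he' : ∀ y, ∃ k : ℤ, y = k • φ.symm e := fun y => by
    obtain ⟨k, hk⟩ := he (φ y)
    exact ⟨k, by rw [← map_zsmul, ← hk, AddEquiv.symm_apply_apply]⟩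
  obtain ⟨k, hk⟩ := he' (loopClass (ContinuousMap.id _))
  obtain ⟨m, hm⟩ := he' x
  have h1 := wind_loopClass_id
  rw [hk, map_zsmul, smul_eq_mul] at h1
  refine ⟨m * k, ?_⟩
  rw [hm, hk, smul_smul]
  rcases Int.isUnit_iff.1 (IsUnit.of_mul_eq_one _ h1) with rfl | rfl <;> simp

theorem wind_bijective : Function.Bijective wind := by
  refine ⟨(injective_iff_map_eq_zero _).2 fun x hx => ?_, fun k =>
    ⟨k • loopClass (ContinuousMap.id _), by rw [map_zsmul, wind_loopClass_id, smul_eq_mul, mul_one]⟩⟩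
  obtain ⟨k, rfl⟩ := eq_smul_loopClass_id x
  rw [map_zsmul, wind_loopClass_id, smul_eq_mul, mul_one] at hx
  rw [hx, zero_smul]

/-- Euclidean space minus a point, in a form adapted to induction on the dimension. -/
abbrev R3 : Type := (ℝ × ℝ) × ℝ

theorem homology_punctured_plane_one : Nonempty (Homology 1 (punctured (ℝ × ℝ)) ≃+ ℤ) :=
  ⟨(circle_equiv_punctured_plane 1).some.symm.trans (AddEquiv.ofBijective _ wind_bijective)⟩

theorem homology_punctured_R3_two : Nonempty (Homology 2 (punctured R3) ≃+ ℤ) :=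
  ⟨(punctured_prod_equiv (ℝ × ℝ) 0).some.trans homology_punctured_plane_one.some⟩

instance subsingleton_homology_punctured_R3_one : Subsingleton (Homology 1 (punctured R3)) :=
  punctured_prod_one (ℝ × ℝ)

instance subsingleton_homology_punctured_R3 (n : ℕ) :
    Subsingleton (Homology (n + 3) (punctured R3)) :=
  (punctured_prod_equiv (ℝ × ℝ) (n + 1)).some.toEquiv.subsingleton

/-- The unit sphere in four-dimensional Euclidean space. -/
abbrev S3 : Type := Metric.sphere (0 : EuclideanSpace ℝ (Fin 4)) 1

theorem sphere_equiv_punctured (n : ℕ) :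
    Nonempty (Homology n S3 ≃+ Homology n (punctured (R3 × ℝ))) := by
  obtain ⟨f, hf⟩ := sphere_punctured (EuclideanSpace ℝ (Fin 4)) one_pos
  have e : EuclideanSpace ℝ (Fin 4) ≃L[ℝ] R3 × ℝ := ContinuousLinearEquiv.ofFinrankEq (by simp)
  exact ⟨(AddEquiv.ofBijective _ (hf n)).trans (AddEquiv.ofBijective _
    (Hmap_bijective_homeomorph (puncturedHomeomorph e) n))⟩

theorem homology_sphere_zero : Nonempty (Homology 0 S3 ≃+ ℤ) :=
  ⟨(sphere_equiv_punctured 0).some.trans (AddEquiv.ofBijective _ aug_bijective)⟩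

theorem subsingleton_homology_sphere_one : Subsingleton (Homology 1 S3) := by
  have := punctured_prod_one R3
  exact (sphere_equiv_punctured 1).some.toEquiv.subsingleton

theorem subsingleton_homology_sphere_two : Subsingleton (Homology 2 S3) :=
  have : Subsingleton (Homology (0 + 1) (punctured R3)) := subsingleton_homology_punctured_R3_one
  ((sphere_equiv_punctured 2).some.trans (punctured_prod_equiv R3 0).some).toEquiv.subsingleton

theorem homology_sphere_three : Nonempty (Homology 3 S3 ≃+ ℤ) :=
  ⟨(sphere_equiv_punctured 3).some.trans ((punctured_prod_equiv R3 1).some.trans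
    homology_punctured_R3_two.some)⟩

theorem subsingleton_homology_sphere (n : ℕ) : Subsingleton (Homology (n + 4) S3) :=
  ((sphere_equiv_punctured (n + 4)).some.trans
    (punctured_prod_equiv R3 (n + 2)).some).toEquiv.subsingleton

end

end HeegaardGauss
end

open scoped Manifold ContDiff Topology
noncomputable section
namespace HeegaardGauss

/-! ### The homology of the standard handlebody -/

section

variable {g : ℕ}

/-- The part of the standard handlebody over an open interval. -/
def slab (g : ℕ) (a b : ℝ) : Set (ℝ × ℝ × ℝ) := {p | p ∈ stdHandlebody g ∧ a < p.1 ∧ p.1 < b}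

/-- A closed box. -/
def box (a b c d e f : ℝ) : Set (ℝ × ℝ × ℝ) :=
  Set.Icc a b ×ˢ (Set.Icc c d ×ˢ Set.Icc e f)

theorem convex_box (a b c d e f : ℝ) : Convex ℝ (box a b c d e f) :=
  (convex_Icc a b).prod ((convex_Icc c d).prod (convex_Icc e f))

theorem clamp_segment {a b t x : ℝ} (hab : a ≤ b) (ht : t ∈ Set.Icc (0 : ℝ) 1) :
    ((a ≤ x ∧ x ≤ b) ∧ (1 - t) * max a (min b x) + t * x = x) ∨
    (x < a ∧ x ≤ (1 - t) * max a (min b x) + t * x ∧ (1 - t) * max a (min b x) + t * x ≤ a) ∨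
    (b < x ∧ b ≤ (1 - t) * max a (min b x) + t * x ∧ (1 - t) * max a (min b x) + t * x ≤ x) := by
  obtain ⟨h0, h1⟩ := ht
  rcases lt_or_ge x a with h | h
  · rw [min_eq_right (by linarith), max_eq_left h.le]
    exact Or.inr (Or.inl ⟨h, by nlinarith, by nlinarith⟩)
  rcases lt_or_ge b x with h' | h'
  · rw [min_eq_left h'.le, max_eq_right hab]
    exact Or.inr (Or.inr ⟨h', by nlinarith, by nlinarith⟩)
  · rw [min_eq_right h', max_eq_right h]
    exact Or.inl ⟨⟨h, h'⟩, by ring⟩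

/-- The slab is the solid column over `[2k, 2k+1]` with pieces of arms on both sides that do not
reach another column. Clamping the first coordinate pushes the arms straight into the column without
meeting a hole. -/
theorem contractible_slab {k : ℕ} (hk : k ≤ g) {a b : ℝ} (ha : 2 * (k : ℝ) - 1 ≤ a)
    (ha' : a < 2 * k) (hb : 2 * (k : ℝ) + 1 < b) (hb' : b ≤ 2 * k + 2) :
    ContractibleSpace (slab g a b) := by
  have hkg : (k : ℝ) ≤ g := by exact_mod_cast hk
  have hk0 : (0 : ℝ) ≤ k := k.cast_nonneg
  let K := box (2 * k : ℝ) (2 * k + 1) 0 3 0 1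
  have hK : ContractibleSpace K := (convex_box _ _ _ _ _ _).contractibleSpace
    ⟨(2 * k, 0, 0), by simp [box]⟩
  let f : C(slab g a b, K) := ⟨fun p => ⟨(max (2 * (k : ℝ)) (min (2 * k + 1) p.1.1), p.1.2), by
    refine ⟨⟨le_max_left _ _, max_le (by linarith) (min_le_left _ _)⟩, p.2.1.2.1, p.2.1.2.2.1⟩⟩,
    by fun_prop⟩
  let i : C(K, slab g a b) := ⟨fun p => ⟨p.1, by
    obtain ⟨⟨x, y, z⟩, ⟨hx, hx'⟩, hy, hz⟩ := p
    dsimp only at *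
    refine ⟨⟨⟨by linarith, by dsimp only; linarith⟩, hy, hz, fun i hi => ?_⟩, by dsimp only; linarith,
      by dsimp only; linarith⟩
    have h1 : (2 * i + 1 : ℝ) < 2 * k + 1 := hi.1.1.trans_le hx'
    have h2 : (2 * k : ℝ) < 2 * i + 2 := hx.trans_lt hi.1.2
    have h1' : 2 * (i : ℕ) + 1 < 2 * k + 1 := by exact_mod_cast h1
    have h2' : 2 * k < 2 * (i : ℕ) + 2 := by exact_mod_cast h2
    omega⟩, by fun_prop⟩
  refine ContinuousMap.HomotopyEquiv.contractibleSpace (Y := K) ⟨f, i, ?_, ?_⟩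
  · refine homotopic_of_segment ?_
    rintro ⟨⟨x, y, z⟩, hp, hxa, hxb⟩ t ht
    change ((1 - t) * max (2 * (k : ℝ)) (min (2 * k + 1) x) + t * x,
      (1 - t) * y + t * y, (1 - t) * z + t * z) ∈ slab g a b
    rw [← add_mul, ← add_mul, sub_add_cancel, one_mul, one_mul]
    obtain ⟨h1, h2, h3, h4⟩ := hp
    dsimp only at *
    rcases clamp_segment (a := 2 * (k : ℝ)) (b := 2 * k + 1) (x := x) (by linarith) ht with
      ⟨-, e⟩ | ⟨e1, e2, e3⟩ | ⟨e1, e2, e3⟩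
    · rw [e]; exact ⟨⟨h1, h2, h3, h4⟩, hxa, hxb⟩
    · refine ⟨⟨⟨h1.1.trans e2, by dsimp only; linarith⟩, h2, h3, fun i hi => ?_⟩,
        hxa.trans_le e2, by dsimp only; linarith⟩
      have h5 : (2 * i + 1 : ℝ) < 2 * k := hi.1.1.trans_le e3
      have h5' : 2 * (i : ℕ) + 1 < 2 * k := by exact_mod_cast h5
      have h6 : (2 * k : ℝ) < 2 * i + 2 + 1 := by have := hi.1.2; dsimp only at this; linarith
      have h6' : 2 * k < 2 * (i : ℕ) + 2 + 1 := by exact_mod_cast h6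
      have h7 : (k : ℝ) = i + 1 := by exact_mod_cast (by omega : k = (i : ℕ) + 1)
      exact h4 i ⟨⟨by linarith, by linarith⟩, hi.2⟩
    · refine ⟨⟨⟨by dsimp only; linarith, e3.trans h1.2⟩, h2, h3, fun i hi => ?_⟩,
        by dsimp only; linarith, e3.trans_lt hxb⟩
      have h5 : (2 * i + 1 : ℝ) < 2 * k + 2 := by have := hi.1.1; dsimp only at this; linarith
      have h5' : 2 * (i : ℕ) + 1 < 2 * k + 2 := by exact_mod_cast h5
      have h6 : (2 * k + 1 : ℝ) < 2 * i + 2 := e2.trans_lt hi.1.2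
      have h6' : 2 * k + 1 < 2 * (i : ℕ) + 2 := by exact_mod_cast h6
      have h7 : (k : ℝ) = i := by exact_mod_cast (by omega : k = (i : ℕ))
      exact h4 i ⟨⟨by linarith, by linarith⟩, hi.2⟩
  · convert ContinuousMap.Homotopic.refl _
    refine ContinuousMap.ext fun p => Subtype.ext (Prod.ext ?_ rfl)
    change p.1.1 = max (2 * (k : ℝ)) (min (2 * k + 1) p.1.1)
    rw [min_eq_right p.2.1.2, max_eq_right p.2.1.1]

theorem slab_isOpenUnion (k : ℕ) : IsOpenUnion (slab g (-1) (2 * k + 2)) (slab g (2 * k + 1) (2 * k + 4))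
    (slab g (-1) (2 * (k + 1 : ℕ) + 2)) (slab g (2 * k + 1) (2 * k + 2)) := by
  have hk0 : (0 : ℝ) ≤ k := k.cast_nonneg
  refine ⟨?_, ?_, ⟨{p | p.1 < 2 * k + 2}, isOpen_lt continuous_fst continuous_const, ?_⟩,
    ⟨{p | 2 * k + 1 < p.1}, isOpen_lt continuous_const continuous_fst, ?_⟩⟩
  all_goals
    ext ⟨x, y, z⟩
    simp only [slab, Set.mem_union, Set.mem_inter_iff, Set.mem_ofPred_eq]
    push_cast
  · constructor
    · rintro (⟨h1, h2, h3⟩ | ⟨h1, h2, h3⟩) <;> exact ⟨h1, by linarith, by linarith⟩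
    · rintro ⟨h1, h2, h3⟩
      rcases lt_or_ge x (2 * k + 2) with h | h
      · exact Or.inl ⟨h1, h2, h⟩
      · exact Or.inr ⟨h1, by linarith, by linarith⟩
  · constructor
    · rintro ⟨⟨h1, h2, h3⟩, h4, h5, h6⟩; exact ⟨h1, h5, h3⟩
    · rintro ⟨h1, h2, h3⟩; exact ⟨⟨h1, by linarith, h3⟩, h1, h2, by linarith⟩
  · constructor
    · rintro ⟨h1, h2, h3⟩; exact ⟨⟨h1, h2, by linarith⟩, h3⟩
    · rintro ⟨⟨h1, h2, h3⟩, h4⟩; exact ⟨h1, h2, h4⟩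
  · constructor
    · rintro ⟨h1, h2, h3⟩; exact ⟨⟨h1, by linarith, by linarith⟩, h2⟩
    · rintro ⟨⟨h1, h2, h3⟩, h4⟩; exact ⟨h1, h4, by linarith⟩

/-- An arm of the standard handlebody, next to a hole. -/
def arm (k : ℕ) (c d : ℝ) : Set (ℝ × ℝ × ℝ) :=
  Set.Ioo (2 * (k : ℝ) + 1) (2 * k + 2) ×ˢ (Set.Icc c d ×ˢ Set.Icc 0 1)

theorem convex_arm (k : ℕ) (c d : ℝ) : Convex ℝ (arm k c d) :=
  (convex_Ioo _ _).prod ((convex_Icc c d).prod (convex_Icc 0 1))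

/-- Strictly over a hole the handlebody is two disjoint convex arms, below and above the hole; they
are separated by the plane `y = 3 / 2`. -/
theorem arm_isOpenUnion {k : ℕ} (hk : k < g) :
    IsOpenUnion (arm k 0 1) (arm k 2 3) (slab g (2 * k + 1) (2 * k + 2)) ∅ := by
  have hkg : (k : ℝ) + 1 ≤ g := by exact_mod_cast hk
  have hk0 : (0 : ℝ) ≤ k := k.cast_nonneg
  have key : ∀ x y z : ℝ, (x, y, z) ∈ slab g (2 * k + 1) (2 * k + 2) ↔
      (2 * (k : ℝ) + 1 < x ∧ x < 2 * k + 2) ∧ (0 ≤ z ∧ z ≤ 1) ∧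
        ((0 ≤ y ∧ y ≤ 1) ∨ (2 ≤ y ∧ y ≤ 3)) := fun x y z => by
    constructor
    · rintro ⟨⟨h1, h2, h3, h4⟩, h5, h6⟩
      refine ⟨⟨h5, h6⟩, h3, ?_⟩
      by_contra hc
      push Not at hc
      dsimp only at h2
      refine h4 ⟨k, hk⟩ ⟨⟨h5, h6⟩, ?_, ?_⟩
      · by_contra h; exact absurd (hc.1 h2.1) (by dsimp only at h; linarith)
      · by_contra h; exact absurd (hc.2 (by dsimp only at h; linarith)) (by linarith [h2.2])
    · rintro ⟨⟨h5, h6⟩, h3, h⟩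
      refine ⟨⟨⟨by dsimp only; linarith, by dsimp only; linarith⟩, ⟨?_, ?_⟩, h3,
        fun i hi => ?_⟩, h5, h6⟩
      · rcases h with h | h <;> dsimp only <;> linarith
      · rcases h with h | h <;> dsimp only <;> linarith
      · obtain ⟨h7, h8⟩ : 1 < y ∧ y < 2 := hi.2; rcases h with h | h <;> linarith
  refine ⟨?_, ?_, ⟨{p | p.2.1 < 3 / 2}, isOpen_lt (by fun_prop) continuous_const, ?_⟩,
    ⟨{p | 3 / 2 < p.2.1}, isOpen_lt continuous_const (by fun_prop), ?_⟩⟩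
  all_goals
    ext ⟨x, y, z⟩
    simp only [Set.mem_union, Set.mem_inter_iff, key, arm, Set.mem_prod, Set.mem_Icc, Set.mem_Ioo,
      Set.mem_ofPred_eq, Set.mem_empty_iff_false]
  · tauto
  · constructor
    · rintro ⟨⟨-, ⟨-, h⟩, -⟩, -, ⟨h', -⟩, -⟩; linarith
    · exact False.elim
  · constructor
    · rintro ⟨h1, h2, h3⟩; exact ⟨⟨h1, h3, Or.inl h2⟩, by linarith⟩
    · rintro ⟨⟨h1, h3, h2 | h2⟩, h4⟩
      · exact ⟨h1, h2, h3⟩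
      · linarith
  · constructor
    · rintro ⟨h1, h2, h3⟩; exact ⟨⟨h1, h3, Or.inr h2⟩, by linarith⟩
    · rintro ⟨⟨h1, h3, h2 | h2⟩, h4⟩
      · linarith
      · exact ⟨h1, h2, h3⟩

theorem arm_nonempty (k : ℕ) {c d : ℝ} (h : c ≤ d) : (arm k c d).Nonempty :=
  ⟨(2 * k + 3 / 2, c, 0), ⟨by dsimp only; linarith, by dsimp only; linarith⟩, ⟨le_rfl, h⟩,
    ⟨le_rfl, zero_le_one⟩⟩

/-- Columns are added from left to right. A new column is contractible and meets the previous part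
in two arms, so it creates at most one class in degree one and none above. Independence of the
generators is shown later, by degrees. -/
theorem homology_slab {k : ℕ} (hk : k ≤ g) : PathConnectedSpace (slab g (-1) (2 * k + 2)) ∧
    (∀ n, Subsingleton (Homology (n + 2) (slab g (-1) (2 * k + 2)))) ∧
    ∃ e : Fin k → Homology 1 (slab g (-1) (2 * k + 2)), ∀ x, ∃ a : Fin k → ℤ,
      x = ∑ i, a i • e i := by
  induction k with
  | zero =>
    have := contractible_slab (g := g) hk (a := -1) (b := 2 * (0 : ℕ) + 2) (by simp) (by simp)
      (by norm_num) (by norm_num)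
    refine ⟨inferInstance, fun n => inferInstance, fun i => 0, fun x => ⟨fun _ => 0, ?_⟩⟩
    have : Subsingleton (Homology (0 + 1) (slab g (-1) (2 * (0 : ℕ) + 2))) := inferInstance
    exact this.elim _ _
  | succ k ih =>
    obtain ⟨h1, h2, e, he⟩ := ih (by omega)
    have hB : ContractibleSpace (slab g (2 * k + 1) (2 * k + 4)) :=
      contractible_slab hk (by push_cast; linarith) (by push_cast; linarith)
        (by push_cast; linarith) (by push_cast; linarith)
    have h := slab_isOpenUnion (g := g) k
    have hP := arm_isOpenUnion (g := g) hk
    have hP' := subsingleton_homology_of_two_convex hP (convex_arm _ _ _) (convex_arm _ _ _)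
      (arm_nonempty k zero_le_one) (arm_nonempty k (by norm_num))
    obtain ⟨p, hp⟩ := arm_nonempty k (zero_le_one (α := ℝ))
    obtain ⟨q, hq⟩ := arm_nonempty k (c := 2) (d := 3) (by norm_num)
    obtain ⟨e', he'⟩ := h.exists_generator_one (p := ⟨p, hP.left hp⟩) (q := ⟨q, hP.right hq⟩)
      fun x => by
        rcases hP.union.symm.subset x.2 with hx | hx
        · exact Or.inl (joined_of_convex (convex_arm _ _ _) hP.left hx hp)
        · exact Or.inr (joined_of_convex (convex_arm _ _ _) hP.right hx hq)
    refine ⟨?_, fun n => ?_, Fin.snoc (fun i => Hmap 1 (incl h.left) (e i)) e', fun x => ?_⟩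
    · have hu := h.union
      rw [← isPathConnected_iff_pathConnectedSpace] at h1 ⊢
      rw [← hu]
      refine h1.union (isPathConnected_iff_pathConnectedSpace.2 inferInstance) ?_
      rw [h.inter]
      exact ⟨p, hP.left hp⟩
    · have := h2 n
      have : Subsingleton (Homology (n + 1 + 1) (slab g (-1) (2 * k + 2))) := h2 n
      exact h.subsingleton
    · obtain ⟨a, b, m, rfl⟩ := he' x
      obtain ⟨c, rfl⟩ := he a
      have : Subsingleton (Homology (0 + 1) (slab g (2 * k + 1) (2 * k + 4))) := inferInstance
      refine ⟨Fin.snoc c m, ?_⟩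
      rw [Fin.sum_univ_castSucc, this.elim b 0, map_zero, add_zero, map_sum]
      simp only [Fin.snoc_castSucc, Fin.snoc_last, map_zsmul]

theorem slab_eq_stdHandlebody (g : ℕ) : slab g (-1) (2 * g + 2) = stdHandlebody g := by
  ext p
  refine ⟨fun h => h.1, fun h => ⟨h, by linarith [h.1.1], by linarith [h.1.2]⟩⟩

instance pathConnected_stdHandlebody (g : ℕ) : PathConnectedSpace (stdHandlebody g) := by
  have := (homology_slab (g := g) le_rfl).1
  rwa [slab_eq_stdHandlebody] at this

instance subsingleton_homology_stdHandlebody (g n : ℕ) :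
    Subsingleton (Homology (n + 2) (stdHandlebody g)) := by
  have := (homology_slab (g := g) le_rfl).2.1 n
  rwa [slab_eq_stdHandlebody] at this

theorem exists_generators_stdHandlebody (g : ℕ) :
    ∃ e : Fin g → Homology 1 (stdHandlebody g), ∀ x, ∃ a : Fin g → ℤ, x = ∑ i, a i • e i := by
  have := (homology_slab (g := g) le_rfl).2.2
  rwa [slab_eq_stdHandlebody] at this

end

end HeegaardGauss
end

open scoped Manifold ContDiff Topology
noncomputable section
namespace HeegaardGauss

/-! ### The first homology of the standard handlebody -/

section

variable {g : ℕ}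

/-- The map from the standard handlebody to the circle that is dual to the `i`-th disc: the
`i`-th arm runs once around the circle, and everything else goes to the base point. -/
def discMap (i : Fin g) : C(stdHandlebody g, UnitAddCircle) where
  toFun p := if p.1.2.1 ≤ 3 / 2 then ((max 0 (min 1 (p.1.1 - (2 * (i : ℝ) + 1))) : ℝ) : UnitAddCircle)
    else 0
  continuous_toFun := by
    refine Continuous.if_le ?_ continuous_const (by fun_prop) continuous_const fun p hp => ?_
    · exact (AddCircle.continuous_mk' (1 : ℝ)).comp (by fun_prop)
    -- On the plane `y = 3 / 2` the hole keeps `x` out of `(2i+1, 2i+2)`. The clamped coordinate is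
    -- then `0` or `1`, and both are the base point of the circle.
    · have h := p.2.2.2.2 i
      have hy : p.1.2.1 ∈ Set.Ioo (1 : ℝ) 2 := by rw [hp]; constructor <;> norm_num
      have h' : ¬ (2 * (i : ℝ) + 1 < p.1.1 ∧ p.1.1 < 2 * i + 2) := fun hx => h ⟨hx, hy⟩
      rcases le_or_gt p.1.1 (2 * i + 1) with h1 | h1
      · rw [min_eq_right (by linarith), max_eq_left (by linarith)]; simp
      · have : 2 * (i : ℝ) + 2 ≤ p.1.1 := by by_contra hc; exact h' ⟨h1, by linarith⟩
        rw [min_eq_left (by linarith), max_eq_right (by norm_num)]; simp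

theorem coe_one : ((1 : ℝ) : UnitAddCircle) = ((0 : ℝ) : UnitAddCircle) := by
  rw [AddCircle.coe_period, AddCircle.coe_zero]

theorem coe_eq_half_iff {x : ℝ} (h0 : 0 ≤ x) (h1 : x ≤ 1) :
    (x : UnitAddCircle) = ((1 / 2 : ℝ) : UnitAddCircle) ↔ x = 1 / 2 := by
  refine ⟨fun h => ?_, fun h => by rw [h]⟩
  rw [← sub_eq_zero, ← AddCircle.coe_sub, AddCircle.coe_eq_zero_iff] at h
  obtain ⟨n, hn⟩ := h
  rw [zsmul_eq_mul, mul_one] at hn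
  have h2 : (-1 : ℝ) < n := by linarith
  have h3 : (n : ℝ) < 1 := by linarith
  have h2' : -1 < n := by exact_mod_cast h2
  have h3' : n < 1 := by exact_mod_cast h3
  obtain rfl : n = 0 := by omega
  rw [Int.cast_zero] at hn
  linarith

theorem discMap_of_le {i : Fin g} {p : stdHandlebody g} (h : p.1.2.1 ≤ 3 / 2) :
    discMap i p = ((max 0 (min 1 (p.1.1 - (2 * (i : ℝ) + 1))) : ℝ) : UnitAddCircle) := if_pos h

theorem discMap_of_lt {i : Fin g} {p : stdHandlebody g} (h : 3 / 2 < p.1.2.1) :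
    discMap i p = 0 := if_neg h.not_ge

/-- The disc is a full level set of the circle map; this is what will make degrees count crossings
with the meridian. -/
theorem discMap_eq_half_iff {i : Fin g} {p : stdHandlebody g} :
    discMap i p = ((1 / 2 : ℝ) : UnitAddCircle) ↔ p.1 ∈ stdMeridianDisc i := by
  rcases le_or_gt p.1.2.1 (3 / 2) with h | h
  · rw [discMap_of_le h, coe_eq_half_iff (le_max_left _ _)
      (max_le zero_le_one (min_le_left _ _))]
    constructor
    · intro h'
      have h1 : p.1.1 = 2 * (i : ℝ) + 3 / 2 := by
        rcases max_choice 0 (min 1 (p.1.1 - (2 * (i : ℝ) + 1))) with e | e <;> rw [e] at h'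
        · norm_num at h'
        rcases min_choice 1 (p.1.1 - (2 * (i : ℝ) + 1)) with e | e <;> rw [e] at h'
        · norm_num at h'
        · linarith
      refine ⟨h1, ⟨p.2.2.1.1, ?_⟩, p.2.2.2.1⟩
      by_contra hc
      exact p.2.2.2.2 i ⟨⟨by linarith, by linarith⟩, by linarith, by linarith⟩
    · rintro ⟨h1, -⟩
      rw [h1, min_eq_right (by linarith), max_eq_right (by linarith)]
      ring
  · rw [discMap_of_lt h]
    constructor
    · intro h'
      have := (coe_eq_half_iff le_rfl zero_le_one).1 (Eq.trans (by simp) h')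
      norm_num at this
    · rintro ⟨-, h2, -⟩
      linarith [h2.2]

/-- The degrees of the circle maps dual to the discs. -/
def degrees (g : ℕ) : Homology 1 (stdHandlebody g) →+ (Fin g → ℤ) where
  toFun x i := wind (Hmap 1 (discMap i) x)
  map_zero' := by ext; simp
  map_add' x y := by ext; simp

theorem degrees_loopClass (γ : C(UnitAddCircle, stdHandlebody g)) (i : Fin g) :
    degrees g (loopClass γ) i = wind (loopClass ((discMap i).comp γ)) := by
  change wind (Hmap 1 (discMap i) (loopClass γ)) = _
  rw [Hmap_loopClass]

/-! ### Loops around the holes and their degrees -/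

/-- The truncation of a real number to `[-1, 1]`. -/
def trunc (x : ℝ) : ℝ := max (-1) (min 1 x)

theorem trunc_mem (x : ℝ) : -1 ≤ trunc x ∧ trunc x ≤ 1 :=
  ⟨le_max_left _ _, max_le (by norm_num) (min_le_left _ _)⟩

theorem trunc_of_one_le {x : ℝ} (h : 1 ≤ x) : trunc x = 1 := by
  rw [trunc, min_eq_left h, max_eq_right (by norm_num)]

theorem trunc_of_le {x : ℝ} (h : x ≤ -1) : trunc x = -1 := by
  rw [trunc, min_eq_right (by linarith), max_eq_left h]

theorem trunc_nonpos {x : ℝ} (h : x ≤ 0) : trunc x ≤ 0 :=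
  max_le (by norm_num) ((min_le_right _ _).trans h)

@[fun_prop]
theorem continuous_trunc : Continuous trunc := by unfold trunc; fun_prop

/-- Sine and cosine cannot both be less than `1 / 2` in absolute value, so the truncated curve stays
on the boundary of a square and avoids the hole inside it. -/
theorem trunc_cos_sin (t : ℝ) : (trunc (2 * Real.cos t) = 1 ∨ trunc (2 * Real.cos t) = -1) ∨
    (trunc (2 * Real.sin t) = 1 ∨ trunc (2 * Real.sin t) = -1) := by
  by_contra! h
  obtain ⟨⟨h1, h2⟩, h3, h4⟩ := h
  have a1 : 2 * Real.cos t < 1 := by by_contra hc; exact h1 (trunc_of_one_le (not_lt.1 hc))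
  have a2 : -1 < 2 * Real.cos t := by by_contra hc; exact h2 (trunc_of_le (not_lt.1 hc))
  have a3 : 2 * Real.sin t < 1 := by by_contra hc; exact h3 (trunc_of_one_le (not_lt.1 hc))
  have a4 : -1 < 2 * Real.sin t := by by_contra hc; exact h4 (trunc_of_le (not_lt.1 hc))
  nlinarith [Real.sin_sq_add_cos_sq t]

/-- The point at angle `t` of the square loop around the `j`-th hole. -/
def holePoint (j : Fin g) (t : ℝ) : ℝ × ℝ × ℝ :=
  (2 * (j : ℝ) + 3 / 2 + 3 / 4 * trunc (2 * Real.cos t), 3 / 2 + 3 / 4 * trunc (2 * Real.sin t), 1 / 2)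

theorem holePoint_mem (j : Fin g) (t : ℝ) : holePoint j t ∈ stdHandlebody g := by
  have hx := trunc_mem (2 * Real.cos t)
  have hy := trunc_mem (2 * Real.sin t)
  have hj : (j : ℝ) + 1 ≤ g := by exact_mod_cast j.2
  have hj0 : (0 : ℝ) ≤ j := Nat.cast_nonneg _
  have h := trunc_cos_sin t
  unfold holePoint
  refine ⟨⟨?_, ?_⟩, ⟨?_, ?_⟩, ⟨?_, ?_⟩, ?_⟩
  iterate 6 dsimp only; linarith
  rintro i ⟨⟨h1, h2⟩, h3, h4⟩
  dsimp only at h1 h2 h3 h4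
  have h5 : (2 * i + 1 : ℝ) < 2 * j + 3 := by linarith
  have h5' : 2 * (i : ℕ) + 1 < 2 * j + 3 := by exact_mod_cast h5
  have h6 : (2 * j : ℝ) < 2 * i + 2 := by linarith
  have h6' : 2 * (j : ℕ) < 2 * i + 2 := by exact_mod_cast h6
  obtain rfl : i = j := Fin.ext (by omega)
  rcases h with (h | h) | (h | h) <;> simp only [h] at h1 h2 h3 h4 <;> linarith

/-- The square loop around the `j`-th hole. -/
def holeLoop (j : Fin g) : C(UnitAddCircle, stdHandlebody g) where
  toFun θ := ⟨holePoint j (Complex.arg (AddCircle.toCircle θ)), holePoint_mem _ _⟩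
  continuous_toFun := by
    refine Continuous.subtype_mk ?_ _
    -- The argument jumps, but only its cosine and sine enter, and these are the coordinates of the
    -- point of the circle.
    simp only [holePoint, Complex.cos_arg (Circle.coe_ne_zero _), Complex.sin_arg, Circle.norm_coe,
      div_one]
    have : Continuous fun θ : UnitAddCircle => (AddCircle.toCircle θ : ℂ) :=
      continuous_subtype_val.comp AddCircle.continuous_toCircle
    have h1 := Complex.continuous_re.comp this
    have h2 := Complex.continuous_im.comp this
    simp only [Function.comp_def] at h1 h2
    fun_prop

theorem holeLoop_coe (j : Fin g) (t : ℝ) :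
    (holeLoop j (t : UnitAddCircle)).1 = holePoint j (2 * Real.pi * t) := by
  have h : ((AddCircle.toCircle (t : UnitAddCircle) : Circle) : ℂ) =
      Complex.exp ((2 * Real.pi * t : ℝ) * Complex.I) := by
    rw [AddCircle.toCircle_apply_mk, Circle.coe_exp, div_one]
  have h1 : (AddCircle.toCircle (t : UnitAddCircle) : ℂ).re = Real.cos (2 * Real.pi * t) := by
    rw [h, Complex.exp_ofReal_mul_I_re]
  have h2 : (AddCircle.toCircle (t : UnitAddCircle) : ℂ).im = Real.sin (2 * Real.pi * t) := by
    rw [h, Complex.exp_ofReal_mul_I_im]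
  change holePoint j (Complex.arg _) = _
  simp only [holePoint, Complex.cos_arg (Circle.coe_ne_zero _), Complex.sin_arg, Circle.norm_coe,
      div_one, h1, h2]

theorem sin_two_pi_nonneg {t : ℝ} (h0 : 0 ≤ t) (h1 : t ≤ 1 / 2) : 0 ≤ Real.sin (2 * Real.pi * t) := by
  have := Real.pi_pos
  exact Real.sin_nonneg_of_nonneg_of_le_pi (by positivity) (by nlinarith)

theorem sin_two_pi_nonpos {t : ℝ} (h0 : 1 / 2 ≤ t) (h1 : t ≤ 1) : Real.sin (2 * Real.pi * t) ≤ 0 := by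
  have := Real.pi_pos
  have h := Real.sin_nonneg_of_nonneg_of_le_pi (x := 2 * Real.pi * t - Real.pi)
    (by nlinarith) (by nlinarith)
  rw [Real.sin_sub_pi] at h
  linarith

theorem degrees_holeLoop_self (j : Fin g) : degrees g (loopClass (holeLoop j)) j = 1 := by
  rw [degrees_loopClass]
  let X : ℝ → ℝ := fun t => max 0 (min 1 (1 / 2 + 3 / 4 * trunc (2 * Real.cos (2 * Real.pi * t))))
  have hX : Continuous X := by fun_prop
  have hhalf : X (1 / 2) = 0 := by
    have e : 2 * Real.pi * (1 / 2) = Real.pi := by ring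
    simp only [X]
    rw [e, Real.cos_pi, trunc_of_le (by norm_num)]
    norm_num
  have hone : X 1 = 1 := by
    simp only [X]
    rw [mul_one, Real.cos_two_pi, trunc_of_one_le (by norm_num)]
    norm_num
  -- An explicit lift. During the first half the loop passes above the hole, where the circle map is
  -- constant; during the second half it runs through the lower arm in the direction of increasing
  -- `x`.
  have h := wind_loopClass (γ := (discMap j).comp (holeLoop j))
    (g := fun t => if t ≤ 1 / 2 then 0 else X t)
    (Continuous.if_le continuous_const hX continuous_id continuous_const
      (fun t ht => by rw [show t = 1 / 2 from ht, hhalf])) ?_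
  · norm_num [hone] at h
    exact_mod_cast h
  · rintro t ⟨h0, h1⟩
    have hp := holeLoop_coe j t
    have hd : ∀ h : (holeLoop j (t : UnitAddCircle)).1.2.1 ≤ 3 / 2,
        discMap j (holeLoop j t) = (X t : UnitAddCircle) := fun h => by
      rw [discMap_of_le h, hp]
      simp only [X, holePoint]
      congr 5
      ring
    change _ = discMap j (holeLoop j t)
    split_ifs with ht
    · have hs := sin_two_pi_nonneg h0 ht
      -- At the two ends of the first half the height is exactly `3 / 2` and the other branch of
      -- `discMap` applies; its value `0` or `1` is again the base point.
      rcases hs.eq_or_lt with hs | hs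
      · rw [hd (by rw [hp]; simp only [holePoint]; rw [← hs, mul_zero]; norm_num [trunc])]
        have hc : Real.cos (2 * Real.pi * t) = 1 ∨ Real.cos (2 * Real.pi * t) = -1 := by
          have := Real.sin_sq_add_cos_sq (2 * Real.pi * t)
          rw [← hs] at this
          exact mul_self_eq_one_iff.1 (by nlinarith)
        simp only [X]
        rcases hc with hc | hc <;> rw [hc] <;> norm_num [trunc, coe_one]
      · rw [discMap_of_lt, AddCircle.coe_zero]
        rw [hp]
        simp only [holePoint]
        have : 0 < trunc (2 * Real.sin (2 * Real.pi * t)) :=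
          (lt_min one_pos (by linarith)).trans_le (le_max_right _ _)
        linarith
    · have hs := sin_two_pi_nonpos (not_le.1 ht).le h1
      refine (hd ?_).symm
      rw [hp]
      simp only [holePoint]
      have : trunc (2 * Real.sin (2 * Real.pi * t)) ≤ 0 := trunc_nonpos (by linarith)
      linarith

theorem degrees_holeLoop_of_ne {i j : Fin g} (hij : i ≠ j) :
    degrees g (loopClass (holeLoop j)) i = 0 := by
  rw [degrees_loopClass]
  have h := wind_loopClass (γ := (discMap i).comp (holeLoop j)) (g := fun _ => 0)
    continuous_const ?_
  · rw [sub_zero] at h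
    exact_mod_cast h
  · intro t _
    change _ = discMap i (holeLoop j t)
    have hp := holeLoop_coe j t
    have hx := trunc_mem (2 * Real.cos (2 * Real.pi * t))
    rcases le_or_gt (holeLoop j (t : UnitAddCircle)).1.2.1 (3 / 2) with h | h
    · rw [discMap_of_le h, hp]
      simp only [holePoint]
      rcases lt_or_gt_of_ne (Fin.val_ne_of_ne hij) with hlt | hlt
      · have : (i : ℝ) + 1 ≤ j := by exact_mod_cast hlt
        rw [min_eq_left (by linarith), max_eq_right (by norm_num), coe_one]
      · have : (j : ℝ) + 1 ≤ i := by exact_mod_cast hlt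
        rw [min_eq_right (by linarith), max_eq_left (by linarith)]
    · rw [discMap_of_lt h, AddCircle.coe_zero]

/-- The hole loops form a dual basis, so the degrees are onto. Composed with the `g` generators they
give a surjective endomorphism of `ℤ^g`, which is injective; hence the generators satisfy no
relation and the degrees are injective. -/
theorem degrees_bijective (g : ℕ) : Function.Bijective (degrees g) := by
  obtain ⟨e, he⟩ := exists_generators_stdHandlebody g
  have hsurj : Function.Surjective (degrees g) := fun a => by
    refine ⟨∑ j, a j • loopClass (holeLoop j), ?_⟩
    ext i
    rw [map_sum, Finset.sum_apply, Finset.sum_eq_single i]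
    · simp [degrees_holeLoop_self]
    · intro j _ hj
      simp [degrees_holeLoop_of_ne hj.symm]
    · simp
  let f : (Fin g → ℤ) →ₗ[ℤ] (Fin g → ℤ) :=
    { toFun := fun a => degrees g (∑ i, a i • e i)
      map_add' := fun a b => by simp [add_smul, Finset.sum_add_distrib]
      map_smul' := fun c a => by simp [mul_smul, Finset.smul_sum] }
  have hf : Function.Surjective f := fun b => by
    obtain ⟨x, rfl⟩ := hsurj b
    obtain ⟨a, rfl⟩ := he x
    exact ⟨a, rfl⟩
  have hinj := OrzechProperty.injective_of_surjective_endomorphism f hf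
  refine ⟨(injective_iff_map_eq_zero _).2 fun x hx => ?_, hsurj⟩
  obtain ⟨a, rfl⟩ := he x
  have : a = 0 := hinj (by rw [map_zero]; exact hx)
  simp [this]

end

end HeegaardGauss
end

open scoped Manifold ContDiff Topology
noncomputable section
namespace HeegaardGauss

/-! ### The collar of the standard handlebody -/

section

/-- The signed distance of `x` to the complement of the union of the intervals `[2n, 2n+1]`. -/
def cellDepth (x : ℝ) : ℝ := 1 / 2 - ‖((x - 1 / 2 : ℝ) : AddCircle (2 : ℝ))‖

/-- The inward displacement of a collar of the union of the intervals `[2n, 2n+1]`. -/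
def inward (x : ℝ) : ℝ := 1 - 2 * ‖(x : AddCircle (2 : ℝ))‖

/-- The expansion of the line that carries the intervals `[2n+s, 2n+1-s]` onto the intervals
`[2n, 2n+1]`. -/
def expand (s x : ℝ) : ℝ :=
  x + max (-(s * (1 + 2 * cellDepth x) / (1 + 2 * s)))
    (min (s * (1 + 2 * cellDepth x) / (1 + 2 * s)) (-(s * inward x / (1 - 2 * s))))

/-- The expansion of one cell, centred at the origin. -/
def expandCell (s u : ℝ) : ℝ :=
  max ((u - 2 * s) / (1 + 2 * s)) (min (u / (1 - 2 * s)) ((u + 2 * s) / (1 + 2 * s)))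

@[fun_prop]
theorem continuous_cellDepth : Continuous cellDepth :=
  continuous_const.sub (continuous_norm.comp
    ((AddCircle.continuous_mk' (2 : ℝ)).comp (continuous_id.sub continuous_const)))

@[fun_prop]
theorem continuous_inward : Continuous inward :=
  continuous_const.sub (continuous_const.mul (continuous_norm.comp (AddCircle.continuous_mk' (2 : ℝ))))

theorem continuousOn_expand :
    ContinuousOn (fun q : ℝ × ℝ => expand q.1 q.2) {q | 0 ≤ q.1 ∧ q.1 < 1 / 2} := by
  have h1 : ∀ q ∈ {q : ℝ × ℝ | 0 ≤ q.1 ∧ q.1 < 1 / 2}, 1 + 2 * q.1 ≠ 0 := fun q hq => by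
    have := hq.1; positivity
  have h2 : ∀ q ∈ {q : ℝ × ℝ | 0 ≤ q.1 ∧ q.1 < 1 / 2}, 1 - 2 * q.1 ≠ 0 := fun q hq => by
    have := hq.2; linarith
  have hb : ContinuousOn (fun q : ℝ × ℝ => q.1 * (1 + 2 * cellDepth q.2) / (1 + 2 * q.1))
      {q | 0 ≤ q.1 ∧ q.1 < 1 / 2} :=
    ContinuousOn.div (by fun_prop) (by fun_prop) h1
  have hq : ContinuousOn (fun q : ℝ × ℝ => q.1 * inward q.2 / (1 - 2 * q.1))
      {q | 0 ≤ q.1 ∧ q.1 < 1 / 2} :=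
    ContinuousOn.div (by fun_prop) (by fun_prop) h2
  exact continuousOn_snd.add (ContinuousOn.sup hb.neg (ContinuousOn.inf hb hq.neg))

theorem exists_cell (x : ℝ) : ∃ (n : ℤ) (u : ℝ), x = 2 * n + 1 / 2 + u ∧ -1 ≤ u ∧ u ≤ 1 := by
  refine ⟨⌊(x + 1 / 2) / 2⌋, x - (2 * ⌊(x + 1 / 2) / 2⌋ + 1 / 2), by ring, ?_, ?_⟩
  · linarith [Int.floor_le ((x + 1 / 2) / 2)]
  · linarith [Int.lt_floor_add_one ((x + 1 / 2) / 2)]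

theorem coe_two_mul_add (n : ℤ) (x : ℝ) :
    ((2 * n + x : ℝ) : AddCircle (2 : ℝ)) = (x : AddCircle (2 : ℝ)) := by
  rw [AddCircle.coe_add, (AddCircle.coe_eq_zero_iff (2 : ℝ)).2 ⟨n, by simp [mul_comm]⟩, zero_add]

theorem norm_coe_two {x : ℝ} (h : |x| ≤ 1) : ‖(x : AddCircle (2 : ℝ))‖ = |x| :=
  (AddCircle.norm_coe_eq_abs_iff (2 : ℝ) (by norm_num)).2 (by norm_num; exact h)

theorem cellDepth_cell (n : ℤ) {u : ℝ} (h0 : -1 ≤ u) (h1 : u ≤ 1) :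
    cellDepth (2 * n + 1 / 2 + u) = min (1 / 2 + u) (1 / 2 - u) := by
  rw [cellDepth, show (2 * n + 1 / 2 + u - 1 / 2 : ℝ) = 2 * n + u by ring, coe_two_mul_add,
    norm_coe_two (abs_le.2 ⟨h0, h1⟩)]
  rcases le_total 0 u with h | h
  · rw [abs_of_nonneg h, min_eq_right (by linarith)]
  · rw [abs_of_nonpos h, min_eq_left (by linarith), sub_neg_eq_add]

theorem inward_cell (n : ℤ) {u : ℝ} (h0 : 0 ≤ u) (h1 : u ≤ 1) :
    inward (2 * n + 1 / 2 + u) = max (-(2 * u)) (2 * u - 2) := by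
  rw [inward, add_assoc, coe_two_mul_add]
  rcases le_total u (1 / 2) with h | h
  · rw [norm_coe_two (abs_le.2 ⟨by linarith, by linarith⟩), abs_of_nonneg (by linarith),
      max_eq_left (by linarith)]
    ring
  · rw [show (1 / 2 + u : ℝ) = 2 * (1 : ℤ) + (u - 3 / 2) by push_cast; ring, coe_two_mul_add,
      norm_coe_two (abs_le.2 ⟨by linarith, by linarith⟩), abs_of_nonpos (by linarith),
      max_eq_right (by linarith)]
    ring

theorem inward_cell_nonpos (n : ℤ) {u : ℝ} (h0 : 0 ≤ u) (h1 : u ≤ 1) :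
    inward (2 * n + 1 / 2 + -u) = -max (-(2 * u)) (2 * u - 2) := by
  rw [inward, add_assoc, coe_two_mul_add]
  rcases le_total u (1 / 2) with h | h
  · rw [norm_coe_two (abs_le.2 ⟨by linarith, by linarith⟩), abs_of_nonneg (by linarith),
      max_eq_left (by linarith)]
    ring
  · rw [norm_coe_two (abs_le.2 ⟨by linarith, by linarith⟩), abs_of_nonpos (by linarith),
      max_eq_right (by linarith)]
    ring

/-- On the right half of a cell the lower clamp in `expand` is inactive. The steep piece and the
outer piece meet at `u = 1/2 - s`, so beyond `u = 1/2`, where `inward` turns back, only the outer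
piece matters. -/
theorem expandCell_nonneg_aux {s u : ℝ} (hs : 0 ≤ s) (hs' : s < 1 / 2) (h0 : 0 ≤ u) (h1 : u ≤ 1) :
    expandCell s u = min (u / (1 - 2 * s)) ((u + 2 * s) / (1 + 2 * s)) ∧
    u + min (2 * s * (1 - u) / (1 + 2 * s)) (-(s * max (-(2 * u)) (2 * u - 2) / (1 - 2 * s))) =
      expandCell s u ∧
    0 ≤ min (2 * s * (1 - u) / (1 + 2 * s)) (-(s * max (-(2 * u)) (2 * u - 2) / (1 - 2 * s))) := by
  have hp : 0 < 1 + 2 * s := by linarith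
  have hm : 0 < 1 - 2 * s := by linarith
  have e1 : expandCell s u = min (u / (1 - 2 * s)) ((u + 2 * s) / (1 + 2 * s)) := by
    refine max_eq_right (le_min ?_ ?_)
    · rw [div_le_div_iff₀ hp hm]; nlinarith
    · exact div_le_div_of_nonneg_right (by linarith) hp.le
  have e2 : u + 2 * s * (1 - u) / (1 + 2 * s) = (u + 2 * s) / (1 + 2 * s) := by
    field_simp; ring
  have e3 : 0 ≤ 2 * s * (1 - u) / (1 + 2 * s) := by
    apply div_nonneg _ hp.le; nlinarith
  refine ⟨e1, ?_, le_min e3 ?_⟩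
  · rw [e1]
    rcases le_total u (1 / 2) with h | h
    · rw [max_eq_left (by linarith), ← min_add_add_left, e2, min_comm]
      congr 1
      rw [eq_div_iff hm.ne', add_mul, ← neg_div, div_mul_cancel₀ _ hm.ne']
      ring
    · rw [max_eq_right (by linarith), min_eq_left, min_eq_right, e2]
      · rw [div_le_div_iff₀ hp hm]; nlinarith
      · rw [← neg_div, div_le_div_iff₀ hp hm]; nlinarith [mul_nonneg hs (by linarith : 0 ≤ 1 - u)]
  · rw [← neg_div]
    apply div_nonneg _ hm.le
    rcases le_total u (1 / 2) with h | h
    · rw [max_eq_left (by linarith)]; nlinarith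
    · rw [max_eq_right (by linarith)]; nlinarith

/-- The function is the median of three lines, two of which are ordered; its max-min and min-max
forms agree, and a change of sign exchanges them. -/
theorem expandCell_neg {s u : ℝ} (hs : 0 ≤ s) (hs' : s < 1 / 2) :
    expandCell s (-u) = -expandCell s u := by
  have hp : 0 < 1 + 2 * s := by linarith
  have hm : 0 < 1 - 2 * s := by linarith
  have key : ∀ v, expandCell s v =
      min ((v + 2 * s) / (1 + 2 * s)) (max (v / (1 - 2 * s)) ((v - 2 * s) / (1 + 2 * s))) := fun v => by
    rw [expandCell, max_min_distrib_left, min_comm, max_eq_right, max_comm]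
    exact div_le_div_of_nonneg_right (by linarith) hp.le
  rw [key u, expandCell, ← max_neg_neg, ← min_neg_neg, ← neg_div, ← neg_div, ← neg_div]
  congr 2
  · ring
  · congr 1; ring

theorem expand_cell {s : ℝ} (hs : 0 ≤ s) (hs' : s < 1 / 2) (n : ℤ) {u : ℝ} (h0 : -1 ≤ u)
    (h1 : u ≤ 1) : expand s (2 * n + 1 / 2 + u) = 2 * n + 1 / 2 + expandCell s u := by
  rcases le_total 0 u with h | h
  · obtain ⟨-, e, e'⟩ := expandCell_nonneg_aux hs hs' h h1
    rw [expand, cellDepth_cell n h0 h1, inward_cell n h h1, min_eq_right (a := 1 / 2 + u) (by linarith),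
      show s * (1 + 2 * (1 / 2 - u)) = 2 * s * (1 - u) by ring, max_eq_right, ← e]
    · ring
    · exact (neg_nonpos.2 (le_min_iff.1 e').1).trans e'
  · obtain ⟨v, rfl⟩ : ∃ v, u = -v := ⟨-u, by ring⟩
    obtain ⟨-, e, e'⟩ := expandCell_nonneg_aux hs hs' (u := v) (by linarith) (by linarith)
    rw [expandCell_neg hs hs', expand, cellDepth_cell n h0 h1, inward_cell_nonpos n (by linarith)
      (by linarith), min_eq_left (a := 1 / 2 + -v) (by linarith),
      show s * (1 + 2 * (1 / 2 + -v)) = 2 * s * (1 - v) by ring, ← e]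
    have e4 : -(s * -max (-(2 * v)) (2 * v - 2) / (1 - 2 * s)) =
      -(-(s * max (-(2 * v)) (2 * v - 2) / (1 - 2 * s))) := by ring
    have e5 := le_min_iff.1 e'
    rw [e4, min_eq_right, max_neg_neg]
    · ring
    · linarith [e5.1, e5.2]

theorem expandCell_mem {s u : ℝ} (hs : 0 ≤ s) (h0 : -1 ≤ u) (h1 : u ≤ 1) :
    -1 ≤ expandCell s u ∧ expandCell s u ≤ 1 := by
  have hp : 0 < 1 + 2 * s := by linarith
  constructor
  · refine le_trans ?_ (le_max_left _ _)
    rw [le_div_iff₀ hp]; linarith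
  · refine max_le ?_ ((min_le_right _ _).trans ?_) <;> rw [div_le_one hp] <;> linarith

/-- The relation between a depth and its value after the expansion by `s`. -/
def DepthRel (s q q' : ℝ) : Prop :=
  (s ≤ q ↔ 0 ≤ q') ∧ (q ≤ s ↔ q' ≤ 0) ∧ (1 / 2 ≤ q ↔ 1 / 2 ≤ q')

/-- Comparisons with constants pass through minima and maxima. The depth of the handlebody is built
by these from functions of one coordinate, so the collar needs to be studied only on the line. -/
theorem DepthRel.min {s a a' b b' : ℝ} (ha : DepthRel s a a') (hb : DepthRel s b b') :
    DepthRel s (min a b) (min a' b') := by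
  obtain ⟨h1, h2, h3⟩ := ha
  obtain ⟨h4, h5, h6⟩ := hb
  simp only [DepthRel, le_min_iff, min_le_iff, h1, h2, h3, h4, h5, h6, and_self]

theorem DepthRel.max {s a a' b b' : ℝ} (ha : DepthRel s a a') (hb : DepthRel s b b') :
    DepthRel s (max a b) (max a' b') := by
  obtain ⟨h1, h2, h3⟩ := ha
  obtain ⟨h4, h5, h6⟩ := hb
  simp only [DepthRel, le_max_iff, max_le_iff, h1, h2, h3, h4, h5, h6, and_self]

/-- The cell map is increasing, takes `s - 1/2` to `-1/2` and fixes `0`. -/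
theorem depthRel_expandCell {s : ℝ} (hs : 0 ≤ s) (hs' : s < 1 / 2) (u : ℝ) :
    DepthRel s (1 / 2 + u) (1 / 2 + expandCell s u) := by
  have hp : 0 < 1 + 2 * s := by linarith
  have hm : 0 < 1 - 2 * s := by linarith
  have e1 : 0 ≤ 1 / 2 + expandCell s u ↔ -1 / 2 ≤ expandCell s u := by
    constructor <;> intro h <;> linarith
  have e2 : 1 / 2 + expandCell s u ≤ 0 ↔ expandCell s u ≤ -1 / 2 := by
    constructor <;> intro h <;> linarith
  have e3 : 1 / 2 ≤ 1 / 2 + expandCell s u ↔ 0 ≤ expandCell s u := by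
    constructor <;> intro h <;> linarith
  refine ⟨Iff.trans ?_ e1.symm, Iff.trans ?_ e2.symm, Iff.trans ?_ e3.symm⟩
  · rw [expandCell, le_max_iff, le_min_iff, le_div_iff₀ hp, le_div_iff₀ hm, le_div_iff₀ hp]
    constructor
    · intro h; left; linarith
    · rintro (h | ⟨h, -⟩) <;> linarith
  · rw [expandCell, max_le_iff, min_le_iff, div_le_iff₀ hp, div_le_iff₀ hm, div_le_iff₀ hp]
    constructor
    · intro h; exact ⟨by linarith, Or.inl (by linarith)⟩
    · rintro ⟨h, -⟩; linarith
  · rw [expandCell, le_max_iff, le_min_iff, le_div_iff₀ hp, le_div_iff₀ hm, le_div_iff₀ hp]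
    constructor
    · intro h; right; constructor <;> linarith
    · rintro (h | ⟨h, -⟩) <;> linarith

/-- The expansion preserves every cell. In cells other than the `m`-th, the distance to the wall
`2m` is at most `-1/2` or at least `3/2` before and after, which decides all three clauses. -/
theorem depthRel_sub {s : ℝ} (hs : 0 ≤ s) (hs' : s < 1 / 2) (m : ℤ) (x : ℝ) :
    DepthRel s (x - 2 * m) (expand s x - 2 * m) := by
  obtain ⟨n, u, rfl, h0, h1⟩ := exists_cell x
  have hr := expandCell_mem hs h0 h1
  rw [expand_cell hs hs' n h0 h1]
  rcases lt_trichotomy n m with h | rfl | h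
  · have : (n : ℝ) + 1 ≤ m := by exact_mod_cast h
    have a := depthRel_expandCell hs hs' u
    refine ⟨⟨fun _ => ?_, fun _ => ?_⟩, ⟨fun _ => ?_, fun _ => ?_⟩, ⟨fun _ => ?_, fun _ => ?_⟩⟩ <;>
      linarith
  · convert depthRel_expandCell hs hs' u using 1 <;> ring
  · have : (m : ℝ) + 1 ≤ n := by exact_mod_cast h
    refine ⟨⟨fun _ => ?_, fun _ => ?_⟩, ⟨fun _ => ?_, fun _ => ?_⟩, ⟨fun _ => ?_, fun _ => ?_⟩⟩ <;>
      linarith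

theorem depthRel_sub' {s : ℝ} (hs : 0 ≤ s) (hs' : s < 1 / 2) (m : ℤ) (x : ℝ) :
    DepthRel s (2 * m + 1 - x) (2 * m + 1 - expand s x) := by
  obtain ⟨n, u, rfl, h0, h1⟩ := exists_cell x
  have hr := expandCell_mem hs h0 h1
  rw [expand_cell hs hs' n h0 h1]
  rcases lt_trichotomy n m with h | rfl | h
  · have : (n : ℝ) + 1 ≤ m := by exact_mod_cast h
    refine ⟨⟨fun _ => ?_, fun _ => ?_⟩, ⟨fun _ => ?_, fun _ => ?_⟩, ⟨fun _ => ?_, fun _ => ?_⟩⟩ <;>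
      linarith
  · convert depthRel_expandCell hs hs' (-u) using 1
    · ring
    · rw [expandCell_neg hs hs']; ring
  · have : (m : ℝ) + 1 ≤ n := by exact_mod_cast h
    refine ⟨⟨fun _ => ?_, fun _ => ?_⟩, ⟨fun _ => ?_, fun _ => ?_⟩, ⟨fun _ => ?_, fun _ => ?_⟩⟩ <;>
      linarith

theorem depthRel_cellDepth {s : ℝ} (hs : 0 ≤ s) (hs' : s < 1 / 2) (x : ℝ) :
    DepthRel s (cellDepth x) (cellDepth (expand s x)) := by
  obtain ⟨n, u, rfl, h0, h1⟩ := exists_cell x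
  have hr := expandCell_mem hs h0 h1
  rw [expand_cell hs hs' n h0 h1, cellDepth_cell n h0 h1, cellDepth_cell n hr.1 hr.2]
  refine (depthRel_expandCell hs hs' u).min ?_
  convert depthRel_expandCell hs hs' (-u) using 1
  · rw [sub_eq_add_neg]
  · rw [expandCell_neg hs hs', sub_eq_add_neg]

variable {g : ℕ}

/-! ### The depth function, the boundary and the core of the standard handlebody -/

/-- A function that is nonnegative exactly on the standard handlebody. -/
def depth (g : ℕ) (p : ℝ × ℝ × ℝ) : ℝ :=
  min (min (min p.1 (2 * g + 1 - p.1)) (min p.2.1 (3 - p.2.1)))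
    (min (min p.2.2 (1 - p.2.2)) (max (cellDepth p.1) (cellDepth p.2.1)))

@[fun_prop]
theorem continuous_depth : Continuous (depth g) := by unfold depth; fun_prop

/-- The expansion of three-space, one coordinate at a time. -/
def expand₃ (s : ℝ) (p : ℝ × ℝ × ℝ) : ℝ × ℝ × ℝ := (expand s p.1, expand s p.2.1, expand s p.2.2)

theorem depthRel_depth {s : ℝ} (hs : 0 ≤ s) (hs' : s < 1 / 2) (p : ℝ × ℝ × ℝ) :
    DepthRel s (depth g p) (depth g (expand₃ s p)) := by
  have h0 : ∀ x, DepthRel s x (expand s x) := fun x => by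
    simpa using depthRel_sub hs hs' 0 x
  refine ((DepthRel.min (h0 _) ?_).min ((h0 _).min ?_)).min (((h0 _).min ?_).min
    ((depthRel_cellDepth hs hs' _).max (depthRel_cellDepth hs hs' _)))
  · exact_mod_cast depthRel_sub' hs hs' g p.1
  · have := depthRel_sub' hs hs' 1 p.2.1
    norm_num at this
    exact this
  · have := depthRel_sub' hs hs' 0 p.2.2
    norm_num at this
    exact this

theorem cellDepth_lt_zero_iff {x : ℝ} :
    cellDepth x < 0 ↔ ∃ n : ℤ, 2 * (n : ℝ) + 1 < x ∧ x < 2 * n + 2 := by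
  constructor
  · intro h
    obtain ⟨n, u, rfl, h0, h1⟩ := exists_cell x
    rw [cellDepth_cell n h0 h1, min_lt_iff] at h
    rcases h with h | h
    · exact ⟨n - 1, by push_cast; linarith, by push_cast; linarith⟩
    · exact ⟨n, by linarith, by linarith⟩
  · rintro ⟨n, h0, h1⟩
    rcases le_total x (2 * n + 3 / 2) with h | h
    · have := cellDepth_cell n (u := x - (2 * n + 1 / 2)) (by linarith) (by linarith)
      rw [add_sub_cancel] at this
      rw [this, min_lt_iff]
      right; linarith
    · have := cellDepth_cell (n + 1) (u := x - (2 * n + 5 / 2)) (by linarith) (by linarith)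
      push_cast at this
      rw [show 2 * ((n : ℝ) + 1) + 1 / 2 + (x - (2 * n + 5 / 2)) = x by ring] at this
      rw [this, min_lt_iff]
      left; linarith

/-- Negative cell depth describes all gaps `(2n+1, 2n+2)` at once. Within the outer rectangle only
the gaps `0, …, g-1` survive in `x`, and only `(1, 2)` in `y`. -/
theorem mem_stdHandlebody_iff {p : ℝ × ℝ × ℝ} : p ∈ stdHandlebody g ↔ 0 ≤ depth g p := by
  have hd : 0 ≤ depth g p ↔ ((0 ≤ p.1 ∧ p.1 ≤ 2 * g + 1) ∧ (0 ≤ p.2.1 ∧ p.2.1 ≤ 3)) ∧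
      (0 ≤ p.2.2 ∧ p.2.2 ≤ 1) ∧ ¬ (cellDepth p.1 < 0 ∧ cellDepth p.2.1 < 0) := by
    simp only [depth, le_min_iff, le_max_iff, sub_nonneg, not_and_or, not_lt]
  rw [hd]
  constructor
  · rintro ⟨h1, h2, h3, h4⟩
    refine ⟨⟨h1, h2⟩, h3, ?_⟩
    rw [cellDepth_lt_zero_iff, cellDepth_lt_zero_iff]
    rintro ⟨⟨n, hn, hn'⟩, m, hm, hm'⟩
    have a1 : (-1 : ℝ) < n := by linarith [h1.1]
    have a1' : -1 < n := by exact_mod_cast a1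
    have a2 : (n : ℝ) < g := by linarith [h1.2]
    have a2' : n < g := by exact_mod_cast a2
    have b1 : (-1 : ℝ) < m := by linarith [h2.1]
    have b1' : -1 < m := by exact_mod_cast b1
    have b2 : (m : ℝ) < 1 := by linarith [h2.2]
    have b2' : m < 1 := by exact_mod_cast b2
    obtain rfl : m = 0 := by omega
    obtain ⟨k, rfl⟩ := Int.eq_ofNat_of_zero_le (by omega : 0 ≤ n)
    refine h4 ⟨k, by omega⟩ ⟨⟨by exact_mod_cast hn, by exact_mod_cast hn'⟩, ?_, ?_⟩ <;>
      norm_num at hm hm' <;> linarith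
  · rintro ⟨⟨h1, h2⟩, h3, h4⟩
    refine ⟨h1, h2, h3, fun i hi => h4 ⟨?_, ?_⟩⟩
    · exact cellDepth_lt_zero_iff.2 ⟨i, by exact_mod_cast hi.1.1, by exact_mod_cast hi.1.2⟩
    · refine cellDepth_lt_zero_iff.2 ⟨0, ?_, ?_⟩ <;> norm_num
      exacts [hi.2.1, hi.2.2]

theorem expand_zero (x : ℝ) : expand 0 x = x := by simp [expand]

theorem expand₃_zero (p : ℝ × ℝ × ℝ) : expand₃ 0 p = p := by simp [expand₃, expand_zero]

theorem continuousOn_expand₃ :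
    ContinuousOn (fun q : ℝ × (ℝ × ℝ × ℝ) => expand₃ q.1 q.2) {q | 0 ≤ q.1 ∧ q.1 < 1 / 2} := by
  have h : ∀ f : ℝ × ℝ × ℝ → ℝ, Continuous f →
      ContinuousOn (fun q : ℝ × (ℝ × ℝ × ℝ) => expand q.1 (f q.2)) {q | 0 ≤ q.1 ∧ q.1 < 1 / 2} :=
    fun f hf => continuousOn_expand.comp
      (f := fun q : ℝ × (ℝ × ℝ × ℝ) => (q.1, f q.2)) (by fun_prop) fun q hq => hq
  exact (h _ continuous_fst).prodMk ((h _ (by fun_prop : Continuous fun p : ℝ × ℝ × ℝ => p.2.1)).prodMk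
    (h _ (by fun_prop : Continuous fun p : ℝ × ℝ × ℝ => p.2.2)))

/-- Points of positive depth are interior. A point of depth zero leaves the handlebody under the
expansion by any small `s > 0`, since staying inside would require depth at least `s`; as `s` tends
to `0` this contradicts interiority. -/
theorem mem_frontier_iff {p : ℝ × ℝ × ℝ} : p ∈ frontier (stdHandlebody g) ↔ depth g p = 0 := by
  rw [(isClosed_stdHandlebody g).frontier_eq]
  constructor
  · rintro ⟨h1, h2⟩
    rw [mem_stdHandlebody_iff] at h1
    refine le_antisymm (not_lt.1 fun h => h2 ?_) h1
    exact mem_interior.2 ⟨{q | 0 < depth g q}, fun q hq => mem_stdHandlebody_iff.2 (le_of_lt hq),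
      isOpen_lt continuous_const continuous_depth, h⟩
  · intro h
    refine ⟨mem_stdHandlebody_iff.2 h.ge, fun hi => ?_⟩
    have hc : ContinuousWithinAt (fun s : ℝ => expand₃ s p) (Set.Ico 0 (1 / 2)) 0 :=
      (continuousOn_expand₃.comp (f := fun s : ℝ => (s, p)) (by fun_prop) fun s hs => hs) 0
        ⟨le_rfl, by norm_num⟩
    have hc' : ContinuousWithinAt (fun s : ℝ => expand₃ s p) (Set.Ioo 0 (1 / 2)) 0 :=
      hc.mono Set.Ioo_subset_Ico_self
    have hn : stdHandlebody g ∈ 𝓝 (expand₃ 0 p) := by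
      rw [expand₃_zero]; exact mem_interior_iff_mem_nhds.1 hi
    have hne : (𝓝[Set.Ioo 0 (1 / 2)] (0 : ℝ)).NeBot := by
      rw [← mem_closure_iff_nhdsWithin_neBot, closure_Ioo (by norm_num)]
      exact ⟨le_rfl, by norm_num⟩
    obtain ⟨s, hs, hs'⟩ := ((hc'.eventually hn).and self_mem_nhdsWithin).exists
    have := (depthRel_depth (g := g) hs'.1.le hs'.2 p).1.2 (mem_stdHandlebody_iff.1 hs)
    linarith [hs'.1]

theorem cellDepth_eq_half_iff {x : ℝ} : 1 / 2 ≤ cellDepth x ↔ ∃ n : ℤ, x = 2 * n + 1 / 2 := by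
  constructor
  · intro h
    obtain ⟨n, u, rfl, h0, h1⟩ := exists_cell x
    rw [cellDepth_cell n h0 h1, le_min_iff] at h
    exact ⟨n, by linarith [h.1, h.2]⟩
  · rintro ⟨n, rfl⟩
    have := cellDepth_cell n (u := 0) (by norm_num) (by norm_num)
    rw [add_zero] at this
    rw [this]; norm_num

/-- The core of the standard handlebody: a graph onto which it contracts. -/
def stdCore (g : ℕ) : Set (ℝ × ℝ × ℝ) := {p | 1 / 2 ≤ depth g p}

/-- The third coordinate keeps the depth at most `1/2`, so the core is the set of maximal depth. It
is a ladder in the plane `z = 1/2`, with rails `y = 1/2` and `y = 5/2` and `g + 1` rungs `x = 2n +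
1/2`. -/
theorem mem_stdCore_iff {p : ℝ × ℝ × ℝ} : p ∈ stdCore g ↔
    (1 / 2 ≤ p.1 ∧ p.1 ≤ 2 * g + 1 / 2) ∧ (1 / 2 ≤ p.2.1 ∧ p.2.1 ≤ 5 / 2) ∧ p.2.2 = 1 / 2 ∧
      ((∃ n : ℤ, p.1 = 2 * n + 1 / 2) ∨ p.2.1 = 1 / 2 ∨ p.2.1 = 5 / 2) := by
  simp only [stdCore, Set.mem_ofPred_eq, depth, le_min_iff, le_max_iff, cellDepth_eq_half_iff]
  constructor
  · rintro ⟨⟨⟨h1, h2⟩, h3, h4⟩, ⟨h5, h6⟩, h7⟩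
    refine ⟨⟨h1, by linarith⟩, ⟨h3, by linarith⟩, by linarith, h7.imp_right ?_⟩
    rintro ⟨n, hn⟩
    have b1 : (-1 : ℝ) < n := by linarith
    have b1' : -1 < n := by exact_mod_cast b1
    have b2 : (n : ℝ) < 2 := by linarith
    have b2' : n < 2 := by exact_mod_cast b2
    obtain rfl | rfl : n = 0 ∨ n = 1 := by omega
    · left; rw [hn]; norm_num
    · right; rw [hn]; norm_num
  · rintro ⟨⟨h1, h2⟩, ⟨h3, h4⟩, h5, h6⟩
    refine ⟨⟨⟨h1, by linarith⟩, h3, by linarith⟩, ⟨h5.ge, by linarith⟩, h6.imp_right ?_⟩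
    rintro (h | h)
    · exact ⟨0, by rw [h]; norm_num⟩
    · exact ⟨1, by rw [h]; norm_num⟩

end

end HeegaardGauss
end

open scoped Manifold ContDiff Topology
noncomputable section
namespace HeegaardGauss

/-! ### Handlebodies in a space -/

section

theorem isCompact_stdHandlebody (g : ℕ) : IsCompact (stdHandlebody g) := by
  refine (((isCompact_Icc (a := (0 : ℝ)) (b := 2 * g + 1)).prod
    ((isCompact_Icc (a := (0 : ℝ)) (b := 3)).prod (isCompact_Icc (a := (0 : ℝ)) (b := 1)))).of_isClosed_subset
    (isClosed_stdHandlebody g) ?_)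
  exact fun p hp => ⟨hp.1, hp.2.1, hp.2.2.1⟩

instance (g : ℕ) : CompactSpace (stdHandlebody g) :=
  isCompact_iff_compactSpace.1 (isCompact_stdHandlebody g)

theorem stdCore_subset {g : ℕ} : stdCore g ⊆ stdHandlebody g := fun p hp =>
  mem_stdHandlebody_iff.2 (le_trans (by norm_num) (show (1 / 2 : ℝ) ≤ depth g p from hp))

theorem isClosed_stdCore {g : ℕ} : IsClosed (stdCore g) :=
  isClosed_le continuous_const continuous_depth

variable {g : ℕ} {M : Type} [TopologicalSpace M]

namespace MarkedHandlebody

variable (H : MarkedHandlebody g M)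

/-- The parametrisation of a handlebody. -/
def emb : C(stdHandlebody g, M) :=
  ⟨fun p => H.map p, continuousOn_iff_continuous_domRestrict.1 H.continuousOn⟩

theorem emb_injective : Function.Injective H.emb := fun _ _ h =>
  Subtype.ext (H.injOn (Subtype.coe_prop _) (Subtype.coe_prop _) h)

theorem emb_isClosedEmbedding [T2Space M] : Topology.IsClosedEmbedding H.emb :=
  Continuous.isClosedEmbedding H.emb.continuous H.emb_injective

theorem isClosed_image [T2Space M] {κ : Set (ℝ × ℝ × ℝ)} (hκ : κ ⊆ stdHandlebody g)
    (h : IsClosed κ) : IsClosed (H.map '' κ) :=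
  (((isCompact_stdHandlebody g).of_isClosed_subset h hκ).image_of_continuousOn
    (H.continuousOn.mono hκ)).isClosed

/-- The complement of the image of a subset of the standard handlebody. -/
def outside (κ : Set (ℝ × ℝ × ℝ)) : Set M := (H.map '' κ)ᶜ

theorem outside_anti {κ κ' : Set (ℝ × ℝ × ℝ)} (h : κ ⊆ κ') : H.outside κ' ⊆ H.outside κ :=
  Set.compl_subset_compl.2 (Set.image_mono h)

/-- A handlebody parametrises each part of it homeomorphically. -/
def homeoImage [T2Space M] {s : Set (ℝ × ℝ × ℝ)} (hs : s ⊆ stdHandlebody g) : s ≃ₜ H.map '' s :=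
  ((Equiv.Set.imageOfInjOn H.map s (H.injOn.mono hs)).toHomeomorphOfIsInducing (by
    have h := (H.emb_isClosedEmbedding.isEmbedding.comp (Topology.IsEmbedding.inclusion hs)).isInducing
    rw [← Topology.IsInducing.of_comp_iff Topology.IsInducing.subtypeVal]
    exact h))

@[simp]
theorem coe_homeoImage [T2Space M] {s : Set (ℝ × ℝ × ℝ)} (hs : s ⊆ stdHandlebody g) (p : s) :
    (H.homeoImage hs p : M) = H.map p := rfl

/-- The closed set `A` is the complement of the interior of the handlebody. -/
structure IsComplement (A : Set M) : Prop where
  isClosed : IsClosed A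
  union : A ∪ H.carrier = Set.univ
  inter : A ∩ H.carrier = H.boundary

variable {H} {A : Set M} (hA : H.IsComplement A)
include hA

theorem IsComplement.map_mem_iff {p : ℝ × ℝ × ℝ} (hp : p ∈ stdHandlebody g) :
    H.map p ∈ A ↔ depth g p = 0 := by
  rw [← mem_frontier_iff]
  constructor
  · intro h
    obtain ⟨q, hq, hqp⟩ : H.map p ∈ H.boundary := hA.inter ▸ ⟨h, p, hp, rfl⟩
    rwa [← H.injOn ((isClosed_stdHandlebody g).frontier_subset hq) hp hqp]
  · intro h
    have : H.map p ∈ A ∩ H.carrier := hA.inter.symm ▸ ⟨p, h, rfl⟩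
    exact this.1

/-- The image of the interior of the model is the complement of the closed set `A`, hence open in
`M`; openness of its subsets can then be tested inside the handlebody. -/
theorem IsComplement.isOpen_image [T2Space M] {V : Set (ℝ × ℝ × ℝ)} (hV : IsOpen V)
    (hVN : V ⊆ stdHandlebody g) : IsOpen (H.map '' V) := by
  obtain ⟨W, hW, hWV⟩ := (H.emb_isClosedEmbedding.isInducing.isOpen_iff
    (s := ((↑) : stdHandlebody g → ℝ × ℝ × ℝ) ⁻¹' V)).1 (hV.preimage continuous_subtype_val)
  convert hW.inter hA.isClosed.isOpen_compl using 1
  ext m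
  constructor
  · rintro ⟨p, hp, rfl⟩
    have hpW : (⟨p, hVN hp⟩ : stdHandlebody g) ∈ H.emb ⁻¹' W := hWV.symm ▸ hp
    refine ⟨hpW, fun h => ?_⟩
    have hf := mem_frontier_iff.2 ((hA.map_mem_iff (hVN hp)).1 h)
    rw [(isClosed_stdHandlebody g).frontier_eq] at hf
    exact hf.2 (interior_maximal hVN hV hp)
  · rintro ⟨hm, hmA⟩
    obtain ⟨p, hp, rfl⟩ : m ∈ H.carrier :=
      (hA.union.symm.subset (Set.mem_univ m)).resolve_left hmA
    have : (⟨p, hp⟩ : stdHandlebody g) ∈ H.emb ⁻¹' W := hm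
    rw [hWV] at this
    exact ⟨p, this, rfl⟩

/-- Erasing from `κ` its part in `V` glues `V` to the complement of `κ` along `V \ κ`. Every
attachment of a handle takes this form. -/
theorem IsComplement.isOpenUnion [T2Space M] {V κ : Set (ℝ × ℝ × ℝ)} (hV : IsOpen V)
    (hVN : V ⊆ stdHandlebody g) (hκ : κ ⊆ stdHandlebody g) (hκ' : IsClosed κ) :
    IsOpenUnion (H.outside κ) (H.map '' V) (H.outside (κ \ V)) (H.map '' (V \ κ)) := by
  have h1 : H.outside κ ⊆ H.outside (κ \ V) := H.outside_anti Set.sdiff_subset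
  have h2 : H.map '' V ⊆ H.outside (κ \ V) := by
    rintro _ ⟨p, hp, rfl⟩ ⟨q, hq, hqp⟩
    rw [H.injOn (hκ hq.1) (hVN hp) hqp] at hq
    exact hq.2 hp
  refine ⟨(Set.union_subset h1 h2).antisymm fun m hm => ?_, ?_,
    ⟨_, (H.isClosed_image hκ hκ').isOpen_compl, (Set.inter_eq_right.2 h1).symm⟩,
    ⟨_, hA.isOpen_image hV hVN, (Set.inter_eq_right.2 h2).symm⟩⟩
  · by_cases h : m ∈ H.map '' κ
    · obtain ⟨p, hp, rfl⟩ := h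
      refine Or.inr ⟨p, ?_, rfl⟩
      by_contra hc
      exact hm ⟨p, ⟨hp, hc⟩, rfl⟩
    · exact Or.inl h
  · ext m
    constructor
    · rintro ⟨h, p, hp, rfl⟩
      exact ⟨p, ⟨hp, fun hpκ => h ⟨p, hpκ, rfl⟩⟩, rfl⟩
    · rintro ⟨p, ⟨hp, hpκ⟩, rfl⟩
      refine ⟨?_, p, hp, rfl⟩
      rintro ⟨q, hq, hqp⟩
      rw [H.injOn (hκ hq) (hVN hp) hqp] at hq
      exact hpκ hq

theorem IsComplement.subset_outside {κ : Set (ℝ × ℝ × ℝ)} (hκ : κ ⊆ stdCore g) :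
    A ⊆ H.outside κ := by
  rintro m hm ⟨p, hp, rfl⟩
  have h1 := (hA.map_mem_iff (stdCore_subset (hκ hp))).1 hm
  have h2 : (1 / 2 : ℝ) ≤ depth g p := hκ hp
  rw [h1] at h2
  norm_num at h2

omit hA

/-! ### Retraction of the complement of the core -/

/-- The outward motion of the standard handlebody along its collar, at time `t`. -/
def outward (g : ℕ) (t : ℝ) (p : ℝ × ℝ × ℝ) : ℝ × ℝ × ℝ := expand₃ (t * depth g p) p

/-- Each point is expanded by a parameter `t * depth` adapted to its own depth. It is at most the
depth, so the point stays inside and reaches the boundary exactly at `t = 1`; the third clause of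
`DepthRel` keeps it off the core. -/
theorem outward_mem {t : ℝ} (ht : t ∈ Set.Icc (0 : ℝ) 1) {p : ℝ × ℝ × ℝ} (hp : p ∈ stdHandlebody g)
    (hp' : p ∉ stdCore g) : outward g t p ∈ stdHandlebody g ∧ outward g t p ∉ stdCore g := by
  rw [mem_stdHandlebody_iff] at hp
  have h1 : depth g p < 1 / 2 := not_le.1 hp'
  have h2 : 0 ≤ t * depth g p := mul_nonneg ht.1 hp
  have h3 : t * depth g p ≤ depth g p := mul_le_of_le_one_left hp ht.2
  obtain ⟨r1, -, r3⟩ := depthRel_depth (g := g) h2 (h3.trans_lt h1) p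
  exact ⟨mem_stdHandlebody_iff.2 (r1.1 h3), fun h => hp' (r3.2 h)⟩

theorem outward_one {p : ℝ × ℝ × ℝ} (hp : p ∈ stdHandlebody g)
    (hp' : p ∉ stdCore g) : depth g (outward g 1 p) = 0 := by
  rw [mem_stdHandlebody_iff] at hp
  have h1 : depth g p < 1 / 2 := not_le.1 hp'
  obtain ⟨r1, r2, -⟩ := depthRel_depth (g := g) hp h1 p
  rw [outward, one_mul]
  exact le_antisymm (r2.1 le_rfl) (r1.1 le_rfl)

theorem outward_zero (p : ℝ × ℝ × ℝ) : outward g 0 p = p := by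
  rw [outward, zero_mul, expand₃_zero]

theorem outward_of_depth {p : ℝ × ℝ × ℝ} (t : ℝ) (hp : depth g p = 0) : outward g t p = p := by
  rw [outward, hp, mul_zero, expand₃_zero]

theorem continuousOn_outward : ContinuousOn (fun q : ℝ × (ℝ × ℝ × ℝ) => outward g q.1 q.2)
    {q | q.1 ∈ Set.Icc (0 : ℝ) 1 ∧ q.2 ∈ stdHandlebody g ∧ q.2 ∉ stdCore g} := by
  refine continuousOn_expand₃.comp (f := fun q : ℝ × (ℝ × ℝ × ℝ) => (q.1 * depth g q.2, q.2))
    (by fun_prop) ?_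
  rintro ⟨t, p⟩ ⟨ht, hp, hp'⟩
  rw [mem_stdHandlebody_iff] at hp
  have h1 : depth g p < 1 / 2 := not_le.1 hp'
  have h3 : t * depth g p ≤ depth g p := mul_le_of_le_one_left hp ht.2
  exact ⟨mul_nonneg ht.1 hp, h3.trans_lt h1⟩

variable (H) in
open Classical in
/-- The outward motion of the complement of the core of a handlebody. -/
def retract [T2Space M] (t : ℝ) (m : M) : M :=
  if h : m ∈ H.carrier then H.map (outward g t ((H.homeoImage subset_rfl).symm ⟨m, h⟩)) else m

theorem retract_map [T2Space M] (t : ℝ) {p : ℝ × ℝ × ℝ} (hp : p ∈ stdHandlebody g) :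
    H.retract t (H.map p) = H.map (outward g t p) := by
  have h : H.map p ∈ H.carrier := ⟨p, hp, rfl⟩
  have e : (H.homeoImage subset_rfl).symm ⟨H.map p, h⟩ = ⟨p, hp⟩ := by
    rw [Homeomorph.symm_apply_eq]; rfl
  rw [retract, dif_pos h, e]

include hA

theorem IsComplement.retract_eq_self [T2Space M] (t : ℝ) {m : M} (hm : m ∈ A) :
    H.retract t m = m := by
  by_cases h : m ∈ H.carrier
  · obtain ⟨p, hp, rfl⟩ := h
    rw [retract_map t hp, outward_of_depth t ((hA.map_mem_iff hp).1 hm)]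
  · rw [retract, dif_neg h]

theorem IsComplement.continuousOn_retract [T2Space M] :
    ContinuousOn (fun q : ℝ × M => H.retract q.1 q.2)
      (Set.Icc (0 : ℝ) 1 ×ˢ H.outside (stdCore g)) := by
  have hcl : IsClosed H.carrier := H.isClosed_image subset_rfl (isClosed_stdHandlebody g)
  have h1 : ContinuousOn (fun q : ℝ × M => H.retract q.1 q.2)
      ((Set.Icc (0 : ℝ) 1 ×ˢ H.outside (stdCore g)) ∩ Prod.snd ⁻¹' A) :=
    continuousOn_snd.congr fun q hq => hA.retract_eq_self _ hq.2
  have h2 : ContinuousOn (fun q : ℝ × M => H.retract q.1 q.2)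
      ((Set.Icc (0 : ℝ) 1 ×ˢ H.outside (stdCore g)) ∩ Prod.snd ⁻¹' H.carrier) := by
    rw [continuousOn_iff_continuous_domRestrict]
    let ρ : ↥((Set.Icc (0 : ℝ) 1 ×ˢ H.outside (stdCore g)) ∩ Prod.snd ⁻¹' H.carrier) →
        stdHandlebody g := fun q => (H.homeoImage subset_rfl).symm ⟨q.1.2, q.2.2⟩
    have hρ : Continuous ρ := (H.homeoImage subset_rfl).symm.continuous.comp
      (Continuous.subtype_mk (continuous_snd.comp continuous_subtype_val) _)
    have hρm : ∀ q, H.map (ρ q) = q.1.2 := fun q => by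
      rw [← coe_homeoImage H subset_rfl, Homeomorph.apply_symm_apply]
    have hρ' : ∀ q, (ρ q : ℝ × ℝ × ℝ) ∉ stdCore g := fun q h => q.2.1.2 ⟨_, h, hρm q⟩
    have ho : Continuous fun q => outward g q.1.1 (ρ q) :=
      continuousOn_outward.comp_continuous (f := fun q : ↥((Set.Icc (0 : ℝ) 1 ×ˢ
        H.outside (stdCore g)) ∩ Prod.snd ⁻¹' H.carrier) => (q.1.1, (ρ q).1))
        (by fun_prop) fun q => ⟨q.2.1.1, (ρ q).2, hρ' q⟩
    have hc := H.emb.continuous.comp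
      (ho.subtype_mk fun q => (outward_mem q.2.1.1 (ρ q).2 (hρ' q)).1)
    refine hc.congr fun q => ?_
    change H.map (outward g q.1.1 (ρ q)) = H.retract q.1.1 q.1.2
    rw [← retract_map _ (ρ q).2, hρm]
  have hu : (Set.Icc (0 : ℝ) 1 ×ˢ H.outside (stdCore g)) =
      ((Set.Icc (0 : ℝ) 1 ×ˢ H.outside (stdCore g)) ∩ Prod.snd ⁻¹' A) ∪
      ((Set.Icc (0 : ℝ) 1 ×ˢ H.outside (stdCore g)) ∩ Prod.snd ⁻¹' H.carrier) := by
    rw [← Set.inter_union_distrib_left, ← Set.preimage_union, hA.union, Set.preimage_univ,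
      Set.inter_univ]
  rw [hu]
  intro q hq
  rw [continuousWithinAt_union]
  -- Pasting along closed sets: a point outside `B` is not in the closure of the corresponding
  -- piece, so continuity within that piece holds vacuously there.
  have hcont : ∀ (B : Set M), IsClosed B → ContinuousOn (fun q : ℝ × M => H.retract q.1 q.2)
      ((Set.Icc (0 : ℝ) 1 ×ˢ H.outside (stdCore g)) ∩ Prod.snd ⁻¹' B) →
      ContinuousWithinAt (fun q : ℝ × M => H.retract q.1 q.2)
      ((Set.Icc (0 : ℝ) 1 ×ˢ H.outside (stdCore g)) ∩ Prod.snd ⁻¹' B) q := fun B hB hc => by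
    by_cases h : q.2 ∈ B
    · exact hc q ⟨by rw [← hu] at hq; exact hq, h⟩
    · refine continuousWithinAt_of_notMem_closure fun hcl => h ?_
      exact (closure_minimal Set.inter_subset_right (hB.preimage continuous_snd)) hcl
  exact ⟨hcont A hA.isClosed h1, hcont _ hcl h2⟩

theorem IsComplement.retract_mem [T2Space M] {t : ℝ} (ht : t ∈ Set.Icc (0 : ℝ) 1) {m : M}
    (hm : m ∈ H.outside (stdCore g)) : H.retract t m ∈ H.outside (stdCore g) := by
  rcases hA.union.symm.subset (Set.mem_univ m) with h | ⟨p, hp, rfl⟩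
  · rwa [hA.retract_eq_self t h]
  · have hp' : p ∉ stdCore g := fun h => hm ⟨p, h, rfl⟩
    obtain ⟨h1, h2⟩ := outward_mem ht hp hp'
    rw [retract_map t hp]
    rintro ⟨q, hq, hqp⟩
    rw [H.injOn (stdCore_subset hq) h1 hqp] at hq
    exact h2 hq

theorem IsComplement.retract_one_mem [T2Space M] {m : M}
    (hm : m ∈ H.outside (stdCore g)) : H.retract 1 m ∈ A := by
  rcases hA.union.symm.subset (Set.mem_univ m) with h | ⟨p, hp, rfl⟩
  · rwa [hA.retract_eq_self 1 h]
  · have hp' : p ∉ stdCore g := fun h => hm ⟨p, h, rfl⟩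
    rw [retract_map 1 hp, hA.map_mem_iff (outward_mem (by simp) hp hp').1]
    exact outward_one hp hp'

/-- The outward motion is a deformation retraction onto `A`: the identity at time `0`, a map into
`A` at time `1`, and constant on `A`. -/
theorem IsComplement.bijective_core [T2Space M] (n : ℕ) :
    Function.Bijective (Hmap n (incl (hA.subset_outside (κ := stdCore g) subset_rfl))) := by
  have hc := continuousOn_iff_continuous_domRestrict.1 hA.continuousOn_retract
  let r : C(H.outside (stdCore g), A) := ⟨fun m => ⟨H.retract 1 m, hA.retract_one_mem m.2⟩,
    Continuous.subtype_mk (hc.comp (f := fun m : H.outside (stdCore g) =>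
      (⟨(1, m.1), by simp, m.2⟩ : ↥(Set.Icc (0 : ℝ) 1 ×ˢ H.outside (stdCore g)))) (by fun_prop)) _⟩
  refine Hmap_bijective_of_inverse (g := r) ?_ ?_ n
  · convert ContinuousMap.Homotopic.refl _
    refine ContinuousMap.ext fun m => Subtype.ext ?_
    exact (hA.retract_eq_self 1 m.2).symm
  · refine ContinuousMap.Homotopic.symm ⟨⟨⟨fun q => ⟨H.retract q.1 q.2, hA.retract_mem q.1.2 q.2.2⟩,
      Continuous.subtype_mk (hc.comp (f := fun q : unitInterval × H.outside (stdCore g) =>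
      (⟨(q.1.1, q.2.1), q.1.2, q.2.2⟩ : ↥(Set.Icc (0 : ℝ) 1 ×ˢ H.outside (stdCore g))))
        (by fun_prop)) _⟩, fun m => ?_, fun m => ?_⟩⟩
    · refine Subtype.ext ?_
      change H.retract 0 m = m
      rcases hA.union.symm.subset (Set.mem_univ m.1) with h | ⟨p, hp, hpm⟩
      · exact hA.retract_eq_self _ h
      · rw [← hpm, retract_map _ hp, outward_zero]
    · rfl

end MarkedHandlebody

end

end HeegaardGauss
end

open scoped Manifold ContDiff Topology
noncomputable section
namespace HeegaardGauss

/-! ### Attaching handles -/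

section

variable {X Y : Type} [TopologicalSpace X] [TopologicalSpace Y]

theorem aug_injective_of_surjective (f : C(X, Y)) (hf : Function.Surjective (Hmap 0 f))
    (h : Function.Injective (aug X)) : Function.Injective (aug Y) :=
  (injective_iff_map_eq_zero _).2 fun y hy => by
    obtain ⟨x, rfl⟩ := hf y
    rw [aug_Hmap] at hy
    rw [h (hy.trans (map_zero _).symm), map_zero]

theorem aug_injective_of_injective (f : C(X, Y)) (hf : Function.Injective (Hmap 0 f))
    (h : Function.Injective (aug Y)) : Function.Injective (aug X) := fun x y hxy =>
  hf (h (by rw [aug_Hmap, aug_Hmap, hxy]))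

instance : PathConnectedSpace UnitAddCircle :=
  Function.Surjective.pathConnectedSpace QuotientAddGroup.mk_surjective
    (AddCircle.continuous_mk' (1 : ℝ))

instance subsingleton_homology_circle (n : ℕ) : Subsingleton (Homology (n + 2) UnitAddCircle) :=
  (circle_equiv_punctured_plane (n + 2)).some.toEquiv.subsingleton

theorem exists_smul_loopClass {f : C(UnitAddCircle, X)}
    (hf : Function.Bijective (Hmap 1 f)) (x : Homology 1 X) : ∃ k : ℤ, x = k • loopClass f := by
  obtain ⟨y, rfl⟩ := hf.2 x
  obtain ⟨k, rfl⟩ := eq_smul_loopClass_id y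
  exact ⟨k, by rw [map_zsmul, ← loopClass_eq]⟩

namespace IsOpenUnion

variable {Y : Type} [TopologicalSpace Y] {A B X P : Set Y} (h : IsOpenUnion A B X P)
  {f : C(UnitAddCircle, P)} (hf : ∀ n, Function.Bijective (Hmap n f)) [ContractibleSpace B]
include h hf

theorem handle_surjective : Function.Surjective (Hmap 1 (incl h.left)) :=
  have : Subsingleton (Homology 1 B) := subsingleton_homology_of_contractible 0
  h.surjective_one (aug_injective_of_surjective f (hf 0).2 aug_bijective.1)

/-- The classes that die come from the overlap, whose first homology is generated by the attaching
circle; the circle itself dies in the contractible piece. -/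
theorem handle_map_eq_zero_iff (a : Homology 1 A) : Hmap 1 (incl h.left) a = 0 ↔
    ∃ k : ℤ, a = k • Hmap 1 (incl h.interLeft) (loopClass f) := by
  have : Subsingleton (Homology 1 B) := subsingleton_homology_of_contractible 0
  constructor
  · intro ha
    obtain ⟨p, rfl⟩ := h.exists_of_map_eq_zero ha
    obtain ⟨k, rfl⟩ := exists_smul_loopClass (hf 1) p
    exact ⟨k, map_zsmul _ _ _⟩
  · rintro ⟨k, rfl⟩
    rw [map_zsmul, Hmap_incl_incl, ← Hmap_incl_incl h.interRight h.right,
      Subsingleton.elim (Hmap 1 (incl h.interRight) (loopClass f)) 0, map_zero, zsmul_zero]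

theorem handle_subsingleton (n : ℕ) [Subsingleton (Homology (n + 3) A)] :
    Subsingleton (Homology (n + 3) X) :=
  have : Subsingleton (Homology (n + 2) P) := subsingleton_homology_of_bijective (hf (n + 2))
  h.subsingleton (n := n + 2)

/-- The second homology embeds in that of the attaching circle in degree one, with image in the
kernel of the map to `A`. That kernel is zero when the attaching class has infinite order. -/
theorem handle_subsingleton_two [Subsingleton (Homology 2 A)]
    (hk : ∀ k : ℤ, k • Hmap 1 (incl h.interLeft) (loopClass f) = 0 → k = 0) :
    Subsingleton (Homology 2 X) := by
  have : Subsingleton (Homology 2 B) := subsingleton_homology_of_contractible 1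
  refine subsingleton_of_forall_eq 0 fun x => h.delta_injective (n := 1) ?_
  obtain ⟨k, hkx⟩ := exists_smul_loopClass (hf 1) (h.delta 1 x)
  have h1 := h.delta_inter_left (n := 1) x
  rw [hkx, map_zsmul] at h1
  rw [hkx, hk k h1, zero_smul, map_zero]

end IsOpenUnion

/-- `T` is an interval times an open square without its centre. In the sup norm `c` parametrises the
boundary of the square, a sphere of radius `1/2`; halving it gives a sphere of radius `1/4` in the
open square, onto which the punctured square retracts. -/
theorem tube_bijective {a b m : ℝ} (hm : m ∈ Set.Ioo a b) {c : C(UnitAddCircle, ℝ × ℝ)}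
    (hc : Function.Injective c) (hr : Set.range c = Metric.sphere ((1 / 2, 1 / 2) : ℝ × ℝ) (1 / 2))
    {T : Set (ℝ × ℝ × ℝ)} (hT : ∀ p, p ∈ T ↔ p.1 ∈ Set.Ioo a b ∧
      p.2 ∈ Set.Ioo (0 : ℝ) 1 ×ˢ Set.Ioo (0 : ℝ) 1 ∧ p.2 ≠ (1 / 2, 1 / 2))
    {f : C(UnitAddCircle, T)}
    (hf : ∀ θ, (f θ : ℝ × ℝ × ℝ) = (m, (1 / 2, 1 / 2) + (1 / 2 : ℝ) • (c θ - (1 / 2, 1 / 2)))) (n : ℕ) :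
    Function.Bijective (Hmap n f) := by
  have hcθ : ∀ θ, ‖c θ - (1 / 2, 1 / 2)‖ = 1 / 2 := fun θ => by
    rw [← dist_eq_norm]; exact Metric.mem_sphere.1 (hr.subset ⟨θ, rfl⟩)
  let s : UnitAddCircle → Metric.sphere (0 : ℝ × ℝ) (1 / 4) := fun θ =>
    ⟨(1 / 2 : ℝ) • (c θ - (1 / 2, 1 / 2)), by
      rw [mem_sphere_zero_iff_norm, norm_smul, hcθ]; norm_num⟩
  have hs : Continuous s := by fun_prop
  have hsb : Function.Bijective s := by
    constructor
    · intro θ θ' h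
      have h' := congrArg Subtype.val h
      exact hc (sub_left_injective (smul_right_injective _ (by norm_num : (1 / 2 : ℝ) ≠ 0) h'))
    · rintro ⟨v, hv⟩
      rw [mem_sphere_zero_iff_norm] at hv
      obtain ⟨θ, hθ⟩ : (1 / 2, 1 / 2) + (2 : ℝ) • v ∈ Set.range c := by
        rw [hr, Metric.mem_sphere, dist_eq_norm, add_sub_cancel_left, norm_smul, hv]
        norm_num
      refine ⟨θ, Subtype.ext ?_⟩
      change (1 / 2 : ℝ) • (c θ - (1 / 2, 1 / 2)) = v
      rw [hθ, add_sub_cancel_left, smul_smul]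
      norm_num
  let S : UnitAddCircle ≃ₜ Metric.sphere (0 : ℝ × ℝ) (1 / 4) :=
    Continuous.homeoOfEquivCompactToT2 (f := Equiv.ofBijective s hsb) hs
  let O : Set (ℝ × ℝ) := Set.Ioo (-(1 / 2) : ℝ) (1 / 2) ×ˢ Set.Ioo (-(1 / 2) : ℝ) (1 / 2)
  have hO : Convex ℝ O := (convex_Ioo _ _).prod (convex_Ioo _ _)
  have hsub : Metric.sphere (0 : ℝ × ℝ) (1 / 4) ⊆ O \ {0} := fun v hv => by
    rw [mem_sphere_zero_iff_norm] at hv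
    have h1 := abs_le.1 ((norm_fst_le v).trans hv.le)
    have h2 := abs_le.1 ((norm_snd_le v).trans hv.le)
    refine ⟨⟨⟨by linarith, by linarith⟩, by linarith, by linarith⟩, fun h0 => ?_⟩
    rw [Set.mem_singleton_iff.1 h0, norm_zero] at hv
    norm_num at hv
  let G : C((O \ {0} : Set (ℝ × ℝ)), T) := ⟨fun v => ⟨(m, (1 / 2, 1 / 2) + v.1), by
    obtain ⟨⟨v1, v2⟩, ⟨⟨h1, h2⟩, h3, h4⟩, h0⟩ := v
    refine (hT _).2 ⟨hm, ⟨⟨?_, ?_⟩, ?_, ?_⟩, fun h => h0 (add_eq_left.1 h)⟩ <;>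
      dsimp only [Prod.mk_add_mk] at * <;> linarith⟩, by fun_prop⟩
  let G' : C(T, (O \ {0} : Set (ℝ × ℝ))) := ⟨fun p => ⟨p.1.2 - (1 / 2, 1 / 2), by
    obtain ⟨⟨x, y, z⟩, hp⟩ := p
    obtain ⟨-, ⟨⟨h1, h2⟩, h3, h4⟩, h0⟩ := (hT _).1 hp
    refine ⟨⟨⟨?_, ?_⟩, ?_, ?_⟩, fun h => h0 (sub_eq_zero.1 h)⟩ <;>
      dsimp only [Prod.mk_sub_mk] at * <;> linarith⟩, by fun_prop⟩
  have hG : ∀ n, Function.Bijective (Hmap n G) := fun n => by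
    refine Hmap_bijective_of_inverse (g := G') ?_ ?_ n
    · convert ContinuousMap.Homotopic.refl _
      refine ContinuousMap.ext fun v => Subtype.ext ?_
      exact (add_sub_cancel_left _ _).symm
    · refine homotopic_of_segment ?_
      rintro ⟨p, hp⟩ t ht
      obtain ⟨h1, h2⟩ := (hT _).1 hp
      have e : (1 - t) • (((G.comp G') ⟨p, hp⟩ : T) : ℝ × ℝ × ℝ) +
          t • ((ContinuousMap.id T ⟨p, hp⟩ : T) : ℝ × ℝ × ℝ) =
          ((1 - t) * m + t * p.1, p.2) := by
        change (1 - t) • ((m, (1 / 2, 1 / 2) + (p.2 - (1 / 2, 1 / 2))) : ℝ × ℝ × ℝ) + t • p = _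
        rw [add_sub_cancel]
        refine Prod.ext rfl ?_
        change (1 - t) • p.2 + t • p.2 = p.2
        rw [← add_smul, sub_add_cancel, one_smul]
      rw [e]
      exact (hT _).2 ⟨convex_Ioo a b hm h1 (sub_nonneg.2 ht.2) ht.1 (sub_add_cancel _ _), h2⟩
  have hfe : f = (G.comp (incl hsub)).comp (S : C(_, _)) :=
    ContinuousMap.ext fun θ => Subtype.ext (hf θ)
  have he : ⇑(Hmap n f) = Hmap n G ∘ Hmap n (incl hsub) ∘ Hmap n (S : C(_, _)) :=
    funext fun x => by rw [hfe, Hmap_comp, Hmap_comp]; rfl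
  rw [he]
  exact (hG n).comp ((sphere_homotopy (by norm_num) hO hsub n).comp (Hmap_bijective_homeomorph S n))

/-- A space has the homology of the two-dimensional sphere. -/
structure IsHomologyTwoSphere (P : Type) [TopologicalSpace P] : Prop where
  aug_injective : Function.Injective (aug P)
  one : Subsingleton (Homology 1 P)
  two : Nonempty (Homology 2 P ≃+ ℤ)
  ge_three : ∀ n, Subsingleton (Homology (n + 3) P)

theorem IsHomologyTwoSphere.of_bijective {f : C(X, Y)} (h : IsHomologyTwoSphere X)
    (hf : ∀ n, Function.Bijective (Hmap n f)) : IsHomologyTwoSphere Y :=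
  have := h.one
  have := h.ge_three
  ⟨aug_injective_of_surjective f (hf 0).2 h.aug_injective, subsingleton_homology_of_bijective (hf 1),
    ⟨(AddEquiv.ofBijective _ (hf 2)).symm.trans h.two.some⟩,
    fun n => subsingleton_homology_of_bijective (hf (n + 3))⟩

theorem IsHomologyTwoSphere.of_bijective' {f : C(X, Y)} (h : IsHomologyTwoSphere Y)
    (hf : ∀ n, Function.Bijective (Hmap n f)) : IsHomologyTwoSphere X :=
  have := h.one
  have := h.ge_three
  ⟨aug_injective_of_injective f (hf 0).1 h.aug_injective, (hf 1).1.subsingleton,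
    ⟨(AddEquiv.ofBijective _ (hf 2)).trans h.two.some⟩,
    fun n => (hf (n + 3)).1.subsingleton⟩

theorem isHomologyTwoSphere_punctured : IsHomologyTwoSphere (punctured R3) :=
  ⟨aug_bijective.1, inferInstance, homology_punctured_R3_two, fun _ => inferInstance⟩

/-- The sphere of radius `r` has the homology of both the whole punctured space and the punctured
convex set, and so transfers the computation. -/
theorem isHomologyTwoSphere_ball {B : Set (ℝ × ℝ × ℝ)} (hB : Convex ℝ B) {q : ℝ × ℝ × ℝ} {r : ℝ}
    (hr : 0 < r) (hq : Metric.sphere q r ⊆ B) :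
    IsHomologyTwoSphere (B \ {q} : Set (ℝ × ℝ × ℝ)) := by
  let e : (ℝ × ℝ × ℝ) ≃L[ℝ] R3 := (ContinuousLinearEquiv.prodAssoc ℝ ℝ ℝ ℝ).symm
  obtain ⟨f, hf⟩ := sphere_punctured (ℝ × ℝ × ℝ) hr
  have h1 : IsHomologyTwoSphere (punctured (ℝ × ℝ × ℝ)) :=
    isHomologyTwoSphere_punctured.of_bijective' (Hmap_bijective_homeomorph (puncturedHomeomorph e))
  have h2 := h1.of_bijective' hf
  let O : Set (ℝ × ℝ × ℝ) := (fun v => q + v) ⁻¹' B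
  have hO : Convex ℝ O := hB.translate_preimage_right q
  have hsub : Metric.sphere (0 : ℝ × ℝ × ℝ) r ⊆ O \ {0} := fun v hv => by
    rw [mem_sphere_zero_iff_norm] at hv
    refine ⟨hq (by rw [Metric.mem_sphere, dist_eq_norm, add_sub_cancel_left, hv]), fun h0 => ?_⟩
    rw [Set.mem_singleton_iff.1 h0, norm_zero] at hv
    exact hr.ne hv
  have h3 := h2.of_bijective (sphere_homotopy hr hO hsub)
  let T : (O \ {0} : Set (ℝ × ℝ × ℝ)) ≃ₜ (B \ {q} : Set (ℝ × ℝ × ℝ)) :=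
    (Homeomorph.addLeft q).subtype fun v => by
      change q + v ∈ B ∧ v ∉ ({0} : Set _) ↔ q + v ∈ B ∧ q + v ∉ ({q} : Set _)
      simp
  exact h3.of_bijective (Hmap_bijective_homeomorph T)

end

end HeegaardGauss
end

open scoped Manifold ContDiff Topology
noncomputable section
namespace HeegaardGauss

/-! ### The handle decomposition of a handlebody -/

section

variable {g : ℕ}

/-- An open box. -/
def openBox (a b c d e f : ℝ) : Set (ℝ × ℝ × ℝ) :=
  Set.Ioo a b ×ˢ (Set.Ioo c d ×ˢ Set.Ioo e f)

theorem mem_openBox {a b c d e f : ℝ} {p : ℝ × ℝ × ℝ} : p ∈ openBox a b c d e f ↔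
    (a < p.1 ∧ p.1 < b) ∧ (c < p.2.1 ∧ p.2.1 < d) ∧ (e < p.2.2 ∧ p.2.2 < f) := Iff.rfl

theorem convex_openBox (a b c d e f : ℝ) : Convex ℝ (openBox a b c d e f) :=
  (convex_Ioo a b).prod ((convex_Ioo c d).prod (convex_Ioo e f))

theorem isOpen_openBox (a b c d e f : ℝ) : IsOpen (openBox a b c d e f) :=
  isOpen_Ioo.prod (isOpen_Ioo.prod isOpen_Ioo)

/-- A neighbourhood of the part of the core that is dual to the `k`-th disc. -/
def handleBox (k : ℕ) : Set (ℝ × ℝ × ℝ) := openBox (2 * k + 1 / 2) (2 * k + 5 / 2) 0 1 0 1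

/-- A neighbourhood of a tooth of the comb. -/
def toothBox (k : ℕ) : Set (ℝ × ℝ × ℝ) := openBox (2 * k) (2 * k + 1) 0 (5 / 2) 0 1

/-- A neighbourhood of the back of the comb. -/
def backBox (g : ℕ) : Set (ℝ × ℝ × ℝ) := openBox (1 / 2) (2 * g + 1) 2 3 0 1

/-- A ball in the standard handlebody. -/
def cornerBox : Set (ℝ × ℝ × ℝ) := openBox 0 1 2 3 0 1

theorem handleBox_subset {k : ℕ} (hk : k < g) : handleBox k ⊆ stdHandlebody g := by
  rintro ⟨x, y, z⟩ ⟨⟨h1, h2⟩, ⟨h3, h4⟩, h5, h6⟩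
  have hg : (k : ℝ) + 1 ≤ g := by exact_mod_cast hk
  have hk0 : (0 : ℝ) ≤ k := k.cast_nonneg
  dsimp only at *
  refine ⟨⟨by dsimp only; linarith, by dsimp only; linarith⟩, ⟨h3.le, by dsimp only; linarith⟩,
    ⟨h5.le, h6.le⟩, fun i hi => ?_⟩
  have := hi.2.1
  dsimp only at this
  linarith

theorem toothBox_subset {k : ℕ} (hk : k ≤ g) : toothBox k ⊆ stdHandlebody g := by
  rintro ⟨x, y, z⟩ ⟨⟨h1, h2⟩, ⟨h3, h4⟩, h5, h6⟩
  have hg : (k : ℝ) ≤ g := by exact_mod_cast hk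
  have hk0 : (0 : ℝ) ≤ k := k.cast_nonneg
  dsimp only at *
  refine ⟨⟨by dsimp only; linarith, by dsimp only; linarith⟩, ⟨h3.le, by dsimp only; linarith⟩,
    ⟨h5.le, h6.le⟩, fun i hi => ?_⟩
  obtain ⟨h7, h8⟩ := hi.1
  dsimp only at h7 h8
  have e1 : (2 * i + 1 : ℝ) < 2 * k + 1 := by linarith
  have e1' : 2 * (i : ℕ) + 1 < 2 * k + 1 := by exact_mod_cast e1
  have e2 : (2 * k : ℝ) < 2 * i + 2 := by linarith
  have e2' : 2 * k < 2 * (i : ℕ) + 2 := by exact_mod_cast e2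
  omega

theorem subset_of_two_lt {V : Set (ℝ × ℝ × ℝ)} (h : ∀ p ∈ V, (0 ≤ p.1 ∧ p.1 ≤ 2 * g + 1) ∧
    (2 ≤ p.2.1 ∧ p.2.1 ≤ 3) ∧ 0 ≤ p.2.2 ∧ p.2.2 ≤ 1) : V ⊆ stdHandlebody g := by
  intro p hp
  obtain ⟨h1, h2, h3⟩ := h p hp
  exact ⟨h1, ⟨by linarith, h2.2⟩, h3, fun i hi => by linarith [hi.2.2]⟩

theorem backBox_subset : backBox g ⊆ stdHandlebody g := subset_of_two_lt fun p hp => by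
  obtain ⟨⟨h1, h2⟩, ⟨h3, h4⟩, h5, h6⟩ := mem_openBox.1 hp
  exact ⟨⟨by linarith, h2.le⟩, ⟨h3.le, h4.le⟩, h5.le, h6.le⟩

theorem cornerBox_subset : cornerBox ⊆ stdHandlebody g := subset_of_two_lt fun p hp => by
  obtain ⟨⟨h1, h2⟩, ⟨h3, h4⟩, h5, h6⟩ := mem_openBox.1 hp
  have : (0 : ℝ) ≤ g := g.cast_nonneg
  exact ⟨⟨h1.le, by linarith⟩, ⟨h3.le, h4.le⟩, h5.le, h6.le⟩

/-- The core with the first `k` handles removed. -/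
def coreMinus (g k : ℕ) : Set (ℝ × ℝ × ℝ) := {p | p ∈ stdCore g ∧ ∀ i < k, p ∉ handleBox i}

theorem coreMinus_zero : coreMinus g 0 = stdCore g := by ext; simp [coreMinus]

theorem coreMinus_succ (k : ℕ) : coreMinus g (k + 1) = coreMinus g k \ handleBox k := by
  ext p
  simp only [coreMinus, Set.mem_ofPred_eq, Set.mem_sdiff, Nat.lt_succ_iff_lt_or_eq, or_imp,
    forall_and, forall_eq, and_assoc]

theorem coreMinus_subset (k : ℕ) : coreMinus g k ⊆ stdCore g := fun _ h => h.1

theorem isClosed_coreMinus (k : ℕ) : IsClosed (coreMinus g k) := by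
  induction k with
  | zero => rw [coreMinus_zero]; exact isClosed_stdCore
  | succ k ih => rw [coreMinus_succ]; exact ih.sdiff (isOpen_openBox _ _ _ _ _ _)

/-- The open box holds just the piece of the lower rail between two neighbouring rungs: the rungs
lie in its end faces, and the earlier boxes are disjoint from it. -/
theorem mem_coreMinus_handleBox {k : ℕ} (hk : k < g) {p : ℝ × ℝ × ℝ} (hp : p ∈ handleBox k) :
    p ∈ coreMinus g k ↔ p.2 = (1 / 2, 1 / 2) := by
  obtain ⟨x, y, z⟩ := p
  obtain ⟨⟨h1, h2⟩, ⟨h3, h4⟩, h5, h6⟩ := mem_openBox.1 hp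
  have hg : (k : ℝ) + 1 ≤ g := by exact_mod_cast hk
  have hk0 : (0 : ℝ) ≤ k := k.cast_nonneg
  dsimp only at *
  constructor
  · rintro ⟨h, -⟩
    obtain ⟨-, -, h7, ⟨n, hn⟩ | h8 | h8⟩ := mem_stdCore_iff.1 h <;> dsimp only at *
    · have e1 : (2 * k : ℝ) < 2 * n := by linarith
      have e1' : 2 * (k : ℤ) < 2 * n := by exact_mod_cast e1
      have e2 : (2 * n : ℝ) < 2 * k + 2 := by linarith
      have e2' : 2 * n < 2 * (k : ℤ) + 2 := by exact_mod_cast e2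
      omega
    · rw [h7, h8]
    · linarith
  · intro h
    obtain ⟨rfl, rfl⟩ := Prod.mk.inj h
    refine ⟨mem_stdCore_iff.2 ⟨⟨?_, ?_⟩, ⟨?_, ?_⟩, rfl, Or.inr (Or.inl rfl)⟩, fun i hi hc => ?_⟩ <;>
      try (dsimp only; linarith)
    have hi' : (i : ℝ) + 1 ≤ k := by exact_mod_cast hi
    have := (mem_openBox.1 hc).1.2
    dsimp only at this
    linarith

/-- Erasing the `g` pieces of the lower rail leaves a tree: the upper rail with the `g + 1` rungs
hanging from it as teeth. -/
theorem mem_comb_iff {p : ℝ × ℝ × ℝ} : p ∈ coreMinus g g ↔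
    (1 / 2 ≤ p.1 ∧ p.1 ≤ 2 * g + 1 / 2) ∧ (1 / 2 ≤ p.2.1 ∧ p.2.1 ≤ 5 / 2) ∧ p.2.2 = 1 / 2 ∧
      ((∃ n : ℕ, n ≤ g ∧ p.1 = 2 * n + 1 / 2) ∨ p.2.1 = 5 / 2) := by
  obtain ⟨x, y, z⟩ := p
  rw [coreMinus, Set.mem_ofPred_eq, mem_stdCore_iff]
  dsimp only
  constructor
  · rintro ⟨⟨⟨h1, h2⟩, h3, h4, h5⟩, h6⟩
    refine ⟨⟨h1, h2⟩, h3, h4, ?_⟩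
    have key : ∀ n : ℤ, x = 2 * n + 1 / 2 → ∃ n : ℕ, n ≤ g ∧ x = 2 * n + 1 / 2 := fun n hn => by
      have e1 : (0 : ℝ) ≤ n := by linarith
      have e1' : 0 ≤ n := by exact_mod_cast e1
      obtain ⟨m, rfl⟩ := Int.eq_ofNat_of_zero_le e1'
      have e2 : (m : ℝ) ≤ g := by push_cast at hn; linarith
      exact ⟨m, by exact_mod_cast e2, by exact_mod_cast hn⟩
    rcases h5 with ⟨n, hn⟩ | h5 | h5
    · exact Or.inl (key n hn)
    · left
      -- The index of the last rung not to the right of `x`. A point of the lower rail strictly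
      -- beyond that rung lies in the `m`-th erased box.
      let m := ⌊(x - 1 / 2) / 2⌋
      have m1 : (m : ℝ) ≤ (x - 1 / 2) / 2 := Int.floor_le _
      have m2 : (x - 1 / 2) / 2 < m + 1 := Int.lt_floor_add_one _
      by_cases hm : x = 2 * m + 1 / 2
      · exact key m hm
      exfalso
      have m3 : (2 * m + 1 / 2 : ℝ) < x := lt_of_le_of_ne (by linarith) (Ne.symm hm)
      have m4 : 0 ≤ m := Int.floor_nonneg.2 (by linarith)
      have m5 : (m : ℝ) < g := by linarith
      have m5' : m < g := by exact_mod_cast m5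
      obtain ⟨i, hi⟩ := Int.eq_ofNat_of_zero_le m4
      rw [hi] at m2 m3
      push_cast at m2 m3
      refine h6 i (by omega) (mem_openBox.2 ⟨⟨?_, ?_⟩, ⟨?_, ?_⟩, ?_, ?_⟩) <;> dsimp only <;> linarith
    · exact Or.inr h5
  · rintro ⟨h1, h2, h3, h4⟩
    refine ⟨⟨h1, h2, h3, ?_⟩, fun i hi hc => ?_⟩
    · rcases h4 with ⟨n, -, hn⟩ | h4
      · exact Or.inl ⟨n, by exact_mod_cast hn⟩
      · exact Or.inr (Or.inr h4)
    · obtain ⟨⟨c1, c2⟩, ⟨c3, c4⟩, -⟩ := mem_openBox.1 hc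
      dsimp only at c1 c2 c3 c4
      rcases h4 with ⟨n, -, hn⟩ | h4
      · have e1 : (2 * i : ℝ) < 2 * n := by linarith
        have e1' : 2 * i < 2 * n := by exact_mod_cast e1
        have e2 : (2 * n : ℝ) < 2 * i + 2 := by linarith
        have e2' : 2 * n < 2 * i + 2 := by exact_mod_cast e2
        omega
      · linarith

/-- The comb with the first `k` teeth removed. -/
def combMinus (g k : ℕ) : Set (ℝ × ℝ × ℝ) := {p | p ∈ coreMinus g g ∧ ∀ i < k, p ∉ toothBox i}

theorem combMinus_zero : combMinus g 0 = coreMinus g g := by ext; simp [combMinus]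

theorem combMinus_succ (k : ℕ) : combMinus g (k + 1) = combMinus g k \ toothBox k := by
  ext p
  simp only [combMinus, Set.mem_ofPred_eq, Set.mem_sdiff, Nat.lt_succ_iff_lt_or_eq, or_imp,
    forall_and, forall_eq, and_assoc]

theorem combMinus_subset (k : ℕ) : combMinus g k ⊆ stdCore g := fun _ h => h.1.1

theorem isClosed_combMinus (k : ℕ) : IsClosed (combMinus g k) := by
  induction k with
  | zero => rw [combMinus_zero]; exact isClosed_coreMinus g
  | succ k ih => rw [combMinus_succ]; exact ih.sdiff (isOpen_openBox _ _ _ _ _ _)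

/-- The box stops just short of the upper rail, so it sees a single tooth, which starts at the free
end `y = 1/2` and leaves through the top face. -/
theorem mem_combMinus_toothBox {k : ℕ} (hk : k ≤ g) {p : ℝ × ℝ × ℝ} (hp : p ∈ toothBox k) :
    p ∈ combMinus g k ↔ p.1 = 2 * k + 1 / 2 ∧ p.2.2 = 1 / 2 ∧ 1 / 2 ≤ p.2.1 := by
  obtain ⟨x, y, z⟩ := p
  obtain ⟨⟨h1, h2⟩, ⟨h3, h4⟩, h5, h6⟩ := mem_openBox.1 hp
  have hg : (k : ℝ) ≤ g := by exact_mod_cast hk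
  have hk0 : (0 : ℝ) ≤ k := k.cast_nonneg
  dsimp only at *
  constructor
  · rintro ⟨h, -⟩
    obtain ⟨-, ⟨h7, -⟩, h8, ⟨n, -, hn⟩ | h9⟩ := mem_comb_iff.1 h <;> dsimp only at *
    · have e1 : (2 * k : ℝ) < 2 * n + 1 := by linarith
      have e1' : 2 * k < 2 * n + 1 := by exact_mod_cast e1
      have e2 : (2 * n : ℝ) < 2 * k + 1 := by linarith
      have e2' : 2 * n < 2 * k + 1 := by exact_mod_cast e2
      obtain rfl : n = k := by omega
      exact ⟨hn, h8, h7⟩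
    · linarith
  · rintro ⟨rfl, h8, h9⟩
    refine ⟨mem_comb_iff.2 ⟨⟨?_, ?_⟩, ⟨?_, ?_⟩, h8, Or.inl ⟨k, hk, rfl⟩⟩, fun i hi hc => ?_⟩ <;>
      try (dsimp only; linarith)
    have hi' : (i : ℝ) + 1 ≤ k := by exact_mod_cast hi
    have := (mem_openBox.1 hc).1.2
    dsimp only at this
    linarith

theorem mem_back_iff {p : ℝ × ℝ × ℝ} : p ∈ combMinus g (g + 1) ↔
    (1 / 2 ≤ p.1 ∧ p.1 ≤ 2 * g + 1 / 2) ∧ p.2.1 = 5 / 2 ∧ p.2.2 = 1 / 2 := by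
  obtain ⟨x, y, z⟩ := p
  rw [combMinus, Set.mem_ofPred_eq, mem_comb_iff]
  dsimp only
  constructor
  · rintro ⟨⟨h1, ⟨h2, h3⟩, h4, h5⟩, h6⟩
    refine ⟨h1, ?_, h4⟩
    rcases h5 with ⟨n, hn, hx⟩ | h5
    · by_contra hc
      have : y < 5 / 2 := lt_of_le_of_ne h3 hc
      refine h6 n (by omega) (mem_openBox.2 ⟨⟨?_, ?_⟩, ⟨?_, ?_⟩, ?_, ?_⟩) <;> dsimp only <;> linarith
    · exact h5
  · rintro ⟨h1, rfl, h3⟩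
    refine ⟨⟨h1, ⟨by norm_num, le_rfl⟩, h3, Or.inr rfl⟩, fun i _ hc => ?_⟩
    exact lt_irrefl _ (mem_openBox.1 hc).2.1.2

/-- The end point of the back of the comb. -/
def cornerPoint : ℝ × ℝ × ℝ := (1 / 2, 5 / 2, 1 / 2)

theorem back_diff_backBox : combMinus g (g + 1) \ backBox g = {cornerPoint} := by
  have hg : (0 : ℝ) ≤ g := g.cast_nonneg
  ext ⟨x, y, z⟩
  rw [Set.mem_sdiff, mem_back_iff, Set.mem_singleton_iff, cornerPoint, Prod.mk.injEq, Prod.mk.injEq]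
  dsimp only
  constructor
  · rintro ⟨⟨⟨h1, h2⟩, rfl, rfl⟩, h⟩
    refine ⟨?_, rfl, rfl⟩
    by_contra hc
    have : 1 / 2 < x := lt_of_le_of_ne h1 (Ne.symm hc)
    refine h (mem_openBox.2 ⟨⟨?_, ?_⟩, ⟨?_, ?_⟩, ?_, ?_⟩) <;> dsimp only <;> linarith
  · rintro ⟨rfl, rfl, rfl⟩
    exact ⟨⟨⟨le_rfl, by linarith⟩, rfl, rfl⟩, fun h => lt_irrefl _ (mem_openBox.1 h).1.1⟩

/-- The complement of a ray is star-shaped about a point on the backward extension of the ray. The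
centre at height `1/4` lies just below the free end of the tooth. -/
theorem contractible_toothBox_diff {k : ℕ} (hk : k ≤ g) :
    ContractibleSpace (toothBox k \ combMinus g k : Set (ℝ × ℝ × ℝ)) := by
  have ho : (2 * (k : ℝ) + 1 / 2, (1 / 4 : ℝ), (1 / 2 : ℝ)) ∈ toothBox k := by
    refine mem_openBox.2 ⟨⟨?_, ?_⟩, ⟨?_, ?_⟩, ?_, ?_⟩ <;> dsimp only <;> linarith
  have hoc : (2 * (k : ℝ) + 1 / 2, (1 / 4 : ℝ), (1 / 2 : ℝ)) ∉ combMinus g k := fun h => by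
    have := ((mem_combMinus_toothBox hk ho).1 h).2.2
    norm_num at this
  refine StarConvex.contractibleSpace (x := (2 * (k : ℝ) + 1 / 2, 1 / 4, 1 / 2)) ?_ ⟨_, ho, hoc⟩
  rintro ⟨x, y, z⟩ ⟨hp, hp'⟩ a b ha hb hab
  have hm := convex_openBox _ _ _ _ _ _ ho hp ha hb hab
  refine ⟨hm, fun h => hp' ?_⟩
  obtain ⟨h1, h2, h3⟩ := (mem_combMinus_toothBox hk hm).1 h
  simp only [Prod.smul_mk, Prod.mk_add_mk, smul_eq_mul] at h1 h2 h3
  obtain rfl : a = 1 - b := by linarith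
  have hb0 : b ≠ 0 := by rintro rfl; norm_num at h3
  have hb' : 0 < b := lt_of_le_of_ne hb hb0.symm
  refine (mem_combMinus_toothBox hk hp).2 ⟨mul_left_cancel₀ hb0 (by linarith),
    mul_left_cancel₀ hb0 (by dsimp only; linarith), ?_⟩
  dsimp only
  by_contra hc
  nlinarith

theorem mem_back_backBox {p : ℝ × ℝ × ℝ} (hp : p ∈ backBox g) : p ∈ combMinus g (g + 1) ↔
    p.1 ≤ 2 * g + 1 / 2 ∧ p.2.1 = 5 / 2 ∧ p.2.2 = 1 / 2 := by
  rw [mem_back_iff]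
  exact ⟨fun h => ⟨h.1.2, h.2⟩, fun h => ⟨⟨(mem_openBox.1 hp).1.1.le, h.1⟩, h.2⟩⟩

/-- As for a tooth; the free end of the rail is at `x = 2g + 1/2`, and the centre `2g + 3/4` lies
beyond it. -/
theorem contractible_backBox_diff :
    ContractibleSpace (backBox g \ combMinus g (g + 1) : Set (ℝ × ℝ × ℝ)) := by
  have hg : (0 : ℝ) ≤ g := g.cast_nonneg
  have ho : (2 * (g : ℝ) + 3 / 4, (5 / 2 : ℝ), (1 / 2 : ℝ)) ∈ backBox g := by
    refine mem_openBox.2 ⟨⟨?_, ?_⟩, ⟨?_, ?_⟩, ?_, ?_⟩ <;> dsimp only <;> linarith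
  have hoc : (2 * (g : ℝ) + 3 / 4, (5 / 2 : ℝ), (1 / 2 : ℝ)) ∉ combMinus g (g + 1) := fun h => by
    have := ((mem_back_backBox ho).1 h).1
    norm_num at this
  refine StarConvex.contractibleSpace (x := (2 * (g : ℝ) + 3 / 4, 5 / 2, 1 / 2)) ?_ ⟨_, ho, hoc⟩
  rintro ⟨x, y, z⟩ ⟨hp, hp'⟩ a b ha hb hab
  have hm := convex_openBox _ _ _ _ _ _ ho hp ha hb hab
  refine ⟨hm, fun h => hp' ?_⟩
  obtain ⟨h1, h2, h3⟩ := (mem_back_backBox hm).1 h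
  simp only [Prod.smul_mk, Prod.mk_add_mk, smul_eq_mul] at h1 h2 h3
  obtain rfl : a = 1 - b := by linarith
  have hb0 : b ≠ 0 := by rintro rfl; norm_num at h1
  have hb' : 0 < b := lt_of_le_of_ne hb hb0.symm
  refine (mem_back_backBox hp).2 ⟨?_, mul_left_cancel₀ hb0 (by dsimp only; linarith),
    mul_left_cancel₀ hb0 (by dsimp only; linarith)⟩
  dsimp only
  by_contra hc
  nlinarith

theorem contractible_openBox {a b c d e f : ℝ} (h1 : a < b) (h2 : c < d) (h3 : e < f) :
    ContractibleSpace (openBox a b c d e f) :=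
  (convex_openBox a b c d e f).contractibleSpace
    ((Set.nonempty_Ioo.2 h1).prod ((Set.nonempty_Ioo.2 h2).prod (Set.nonempty_Ioo.2 h3)))

theorem sphere_subset_cornerBox : Metric.sphere cornerPoint (1 / 4) ⊆ cornerBox := by
  rintro ⟨x, y, z⟩ h
  rw [Metric.mem_sphere, dist_eq_norm] at h
  have h1 := abs_le.1 ((norm_fst_le _).trans h.le)
  have h2 := abs_le.1 ((norm_fst_le _).trans ((norm_snd_le _).trans h.le))
  have h3 := abs_le.1 ((norm_snd_le _).trans ((norm_snd_le _).trans h.le))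
  simp only [cornerPoint, Prod.fst_sub, Prod.snd_sub] at h1 h2 h3
  refine mem_openBox.2 ⟨⟨?_, ?_⟩, ⟨?_, ?_⟩, ?_, ?_⟩ <;> dsimp only <;> linarith

theorem cornerPoint_mem : cornerPoint ∈ cornerBox := by
  refine mem_openBox.2 ⟨⟨?_, ?_⟩, ⟨?_, ?_⟩, ?_, ?_⟩ <;> norm_num [cornerPoint]

/-- Over the middle of a hole the first coordinate imposes no constraint, so in the disc the depth
is the sup-norm distance to the boundary of the unit square. -/
theorem mem_disc_frontier_iff {i : Fin g} {p : ℝ × ℝ × ℝ} :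
    p ∈ stdMeridianDisc i ∩ frontier (stdHandlebody g) ↔
      p.1 = 2 * i + 3 / 2 ∧ p.2 ∈ Metric.sphere ((1 / 2, 1 / 2) : ℝ × ℝ) (1 / 2) := by
  obtain ⟨x, y, z⟩ := p
  have hi : (i : ℝ) + 1 ≤ g := by exact_mod_cast i.2
  have hi0 : (0 : ℝ) ≤ i := Nat.cast_nonneg _
  have hs : (y, z) ∈ Metric.sphere ((1 / 2, 1 / 2) : ℝ × ℝ) (1 / 2) ↔
      max |y - 1 / 2| |z - 1 / 2| = 1 / 2 := Iff.rfl
  rw [hs]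
  have key : x = 2 * i + 3 / 2 → 0 ≤ y → y ≤ 1 →
      depth g (x, y, z) = min (1 / 2 - |y - 1 / 2|) (1 / 2 - |z - 1 / 2|) := by
    rintro rfl h0 h1
    have e1 : cellDepth (2 * i + 3 / 2) = -1 / 2 := by
      have := cellDepth_cell i (u := 1) (by norm_num) le_rfl
      rw [show (2 * (i : ℕ) + 3 / 2 : ℝ) = 2 * ((i : ℕ) : ℤ) + 1 / 2 + 1 by push_cast; ring, this]
      norm_num
    have e2 : cellDepth y = min y (1 - y) := by
      have := cellDepth_cell 0 (u := y - 1 / 2) (by linarith) (by linarith)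
      rw [show (2 * (0 : ℤ) + 1 / 2 + (y - 1 / 2) : ℝ) = y by push_cast; ring] at this
      rw [this]
      congr 1 <;> ring
    have e3 : ∀ w : ℝ, 1 / 2 - |w - 1 / 2| = min w (1 - w) := fun w => by
      rcases le_total w (1 / 2) with h | h
      · rw [abs_of_nonpos (by linarith), min_eq_left (by linarith)]; ring
      · rw [abs_of_nonneg (by linarith), min_eq_right (by linarith)]; ring
    have e4 : 0 ≤ min y (1 - y) := le_min h0 (by linarith)
    have e5 : min z (1 - z) ≤ 1 / 2 := by rw [← e3]; linarith [abs_nonneg (z - 1 / 2)]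
    have e6 : min y (1 - y) ≤ 1 / 2 := by rw [← e3]; linarith [abs_nonneg (y - 1 / 2)]
    simp only [depth]
    rw [e1, e2, e3, e3, max_eq_right (by linarith)]
    refine le_antisymm ?_ ?_
    · exact le_min ((min_le_right _ _).trans (min_le_right _ _))
        ((min_le_right _ _).trans (min_le_left _ _))
    · have a1 := min_le_left (min y (1 - y)) (min z (1 - z))
      have a2 := min_le_right (min y (1 - y)) (min z (1 - z))
      refine le_min (le_min (le_min ?_ ?_) (le_min ?_ ?_)) (le_min a2 a1)
      · linarith
      · linarith
      · exact a1.trans (min_le_left _ _)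
      · linarith
  constructor
  · rintro ⟨⟨h1, ⟨h2, h3⟩, -⟩, h⟩
    refine ⟨h1, ?_⟩
    rw [mem_frontier_iff, key h1 h2 h3, min_sub_sub_left] at h
    linarith
  · rintro ⟨h1, h2⟩
    have h3 := abs_le.1 ((le_max_left _ _).trans h2.le)
    have h4 := abs_le.1 ((le_max_right _ _).trans h2.le)
    refine ⟨⟨h1, ⟨?_, ?_⟩, ?_, ?_⟩, ?_⟩
    iterate 4 dsimp only; linarith
    rw [mem_frontier_iff, key h1 (by linarith) (by linarith), min_sub_sub_left, h2, sub_self]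

end

end HeegaardGauss
end

open scoped Manifold ContDiff Topology
noncomputable section
namespace HeegaardGauss

/-! ### Gluing a handlebody -/

section

variable {g : ℕ} {M : Type} [TopologicalSpace M]

theorem loopClass_eq_of_homotopic {X : Type} [TopologicalSpace X] {γ γ' : C(UnitAddCircle, X)}
    (h : γ.Homotopic γ') : loopClass γ = loopClass γ' := by
  rw [loopClass_eq γ, loopClass_eq γ', Hmap_homotopic 1 h]

theorem sum_add_single_zsmul {G : Type*} [AddCommGroup G] (e : Fin g → G) (k : Fin g) (c : Fin g → ℤ)
    (m : ℤ) : ∑ i, (c + Pi.single k m : Fin g → ℤ) i • e i = ∑ i, c i • e i + m • e k := by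
  simp only [Pi.add_apply, add_smul, Finset.sum_add_distrib]
  congr 1
  rw [Finset.sum_eq_single k]
  · rw [Pi.single_eq_same]
  · intro i _ hi
    rw [Pi.single_eq_of_ne hi, zero_smul]
  · simp

/-- The effect on homology of attaching to `A` the first `k` handles of a handlebody; `e i` is the
class in `A` of the attaching curve of the `i`-th handle. -/
structure HandleStage {A : Set M} (e : Fin g → Homology 1 A) {Q : Set M} (hQ : A ⊆ Q) (k : ℕ) :
    Prop where
  surjective : Function.Surjective (Hmap 1 (incl hQ))
  ker_iff : ∀ a, Hmap 1 (incl hQ) a = 0 ↔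
    ∃ c : Fin g → ℤ, (∀ i : Fin g, k ≤ i → c i = 0) ∧ a = ∑ i, c i • e i
  two : (∀ c : Fin g → ℤ, ∑ i, c i • e i = 0 → c = 0) → Subsingleton (Homology 2 Q)
  ge_three : ∀ n, Subsingleton (Homology (n + 3) Q)

namespace HandleStage

variable {A : Set M} {e : Fin g → Homology 1 A} {Q : Set M} {hQ : A ⊆ Q} {k : ℕ}

theorem start (h : ∀ n, Function.Bijective (Hmap n (incl hQ)))
    (hA : ∀ n, Subsingleton (Homology (n + 2) A)) : HandleStage e hQ 0 where
  surjective := (h 1).2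
  ker_iff a := by
    constructor
    · intro ha
      refine ⟨0, fun _ _ => rfl, (h 1).1 ?_⟩
      simp [ha]
    · rintro ⟨c, hc, rfl⟩
      simp [hc]
  two _ :=
    have : Subsingleton (Homology 2 A) := hA 0
    subsingleton_homology_of_bijective (h 2)
  ge_three n :=
    have : Subsingleton (Homology (n + 3) A) := hA (n + 1)
    subsingleton_homology_of_bijective (h (n + 3))

theorem of_bijective (hs : HandleStage e hQ k) {Q' : Set M} (hQ' : Q ⊆ Q')
    (h : ∀ n, Function.Bijective (Hmap n (incl hQ'))) : HandleStage e (hQ.trans hQ') k where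
  surjective y := by
    obtain ⟨x, rfl⟩ := (h 1).2 y
    obtain ⟨a, rfl⟩ := hs.surjective x
    exact ⟨a, (Hmap_incl_incl _ _ _).symm⟩
  ker_iff a := by
    rw [← hs.ker_iff, ← Hmap_incl_incl hQ hQ', map_eq_zero_iff _ (h 1).1]
  two hli :=
    have := hs.two hli
    subsingleton_homology_of_bijective (h 2)
  ge_three n :=
    have := hs.ge_three n
    subsingleton_homology_of_bijective (h (n + 3))

theorem succ {k : Fin g} (hs : HandleStage e hQ k) {B X P : Set M} (h : IsOpenUnion Q B X P)
    [ContractibleSpace B] {f : C(UnitAddCircle, P)} (hf : ∀ n, Function.Bijective (Hmap n f))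
    (hfe : Hmap 1 (incl h.interLeft) (loopClass f) = Hmap 1 (incl hQ) (e k)) :
    HandleStage e (hQ.trans h.left) (k + 1) where
  surjective y := by
    obtain ⟨x, rfl⟩ := h.handle_surjective hf y
    obtain ⟨a, rfl⟩ := hs.surjective x
    exact ⟨a, (Hmap_incl_incl _ _ _).symm⟩
  ker_iff a := by
    rw [← Hmap_incl_incl hQ h.left, h.handle_map_eq_zero_iff hf]
    simp only [hfe]
    constructor
    · rintro ⟨m, hm⟩
      -- At the previous stage `a` equals `m` times the attaching class, so the difference is a
      -- combination of the earlier classes; `m` is recorded in the coordinate `k`.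
      have : Hmap 1 (incl hQ) (a - m • e k) = 0 := by rw [map_sub, map_zsmul, hm, sub_self]
      obtain ⟨c, hc, hca⟩ := (hs.ker_iff _).1 this
      refine ⟨c + Pi.single k m, fun i hi => ?_, ?_⟩
      · have hne : i ≠ k := by rintro rfl; omega
        rw [Pi.add_apply, hc i (by omega), Pi.single_eq_of_ne hne, add_zero]
      · rw [sum_add_single_zsmul, ← hca, sub_add_cancel]
    · rintro ⟨c, hc, rfl⟩
      refine ⟨c k, ?_⟩
      have : Hmap 1 (incl hQ) (∑ i, (c + Pi.single k (-c k) : Fin g → ℤ) i • e i) = 0 :=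
        (hs.ker_iff _).2 ⟨_, fun i hi => by
          by_cases hik : i = k
          · subst hik; simp
          · rw [Pi.add_apply, Pi.single_eq_of_ne hik, add_zero,
              hc i (by have := Fin.val_ne_of_ne hik; omega)], rfl⟩
      rw [sum_add_single_zsmul, map_add, map_zsmul, neg_zsmul, ← sub_eq_add_neg, sub_eq_zero] at this
      exact this
  two hli :=
    have := hs.two hli
    -- A multiple of the new class that dies is a combination of the earlier classes. Independence
    -- then forces the multiple to be zero.
    h.handle_subsingleton_two hf fun m hm => by
      rw [hfe, ← map_zsmul, hs.ker_iff] at hm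
      obtain ⟨c, hc, hca⟩ := hm
      have h0 := hli (c + Pi.single k (-m)) (by
        rw [sum_add_single_zsmul, ← hca, neg_zsmul, add_neg_cancel])
      have := congrFun h0 k
      simpa [hc k le_rfl] using this
  ge_three n :=
    have := hs.ge_three n
    h.handle_subsingleton hf n

end HandleStage

theorem MarkedHandlebody.exists_parametrization_image [T2Space M] (H : MarkedHandlebody g M)
    {s : Set (ℝ × ℝ × ℝ)} (hs : s ⊆ stdHandlebody g) : ∃ e : C(s, H.map '' s),
      (∀ p, (e p : M) = H.map p) ∧ ∀ n, Function.Bijective (Hmap n e) :=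
  ⟨H.homeoImage hs, fun _ => rfl, Hmap_bijective_homeomorph (H.homeoImage hs)⟩

namespace MarkedHandlebody.IsComplement

variable [T2Space M] {H : MarkedHandlebody g M} {A : Set M} (hA : H.IsComplement A)
include hA

/-- Erasing a part of the graph at a free end glues a contractible set along a contractible set. -/
theorem bijective_attach {V κ : Set (ℝ × ℝ × ℝ)} (hV : IsOpen V)
    (hVN : V ⊆ stdHandlebody g) (hκ : κ ⊆ stdHandlebody g) (hκ' : IsClosed κ)
    [ContractibleSpace V] [ContractibleSpace (V \ κ : Set (ℝ × ℝ × ℝ))] (n : ℕ) :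
    Function.Bijective (Hmap n (incl (hA.isOpenUnion hV hVN hκ hκ').left)) := by
  have : ContractibleSpace (H.map '' V) := (H.homeoImage hVN).symm.contractibleSpace
  have : ContractibleSpace (H.map '' (V \ κ)) :=
    (H.homeoImage (Set.sdiff_subset.trans hVN)).symm.contractibleSpace
  exact (hA.isOpenUnion hV hVN hκ hκ').bijective_left_of_contractible n

omit hA in
theorem exists_parametrization (k : Fin g) {μ : C(UnitAddCircle, A)} (hμ : Function.Injective μ)
    (hr : Set.range (fun θ => (μ θ : M)) = H.meridian k) : ∃ c : C(UnitAddCircle, ℝ × ℝ),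
      Function.Injective c ∧ Set.range c = Metric.sphere ((1 / 2, 1 / 2) : ℝ × ℝ) (1 / 2) ∧
      ∀ θ, (2 * (k : ℝ) + 3 / 2, c θ) ∈ stdHandlebody g ∧
        H.map (2 * (k : ℝ) + 3 / 2, c θ) = μ θ := by
  have hfr : frontier (stdHandlebody g) ⊆ stdHandlebody g :=
    (isClosed_stdHandlebody g).frontier_subset
  have hm : ∀ θ, ∃ p ∈ stdMeridianDisc k ∩ frontier (stdHandlebody g), H.map p = μ θ :=
    fun θ => hr.subset ⟨θ, rfl⟩
  have hmem : ∀ θ, (μ θ : M) ∈ H.map '' stdHandlebody g := fun θ => by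
    obtain ⟨p, hp, hpθ⟩ := hm θ
    exact ⟨p, hfr hp.2, hpθ⟩
  let ρ : C(UnitAddCircle, stdHandlebody g) :=
    ⟨fun θ => (H.homeoImage subset_rfl).symm ⟨μ θ, hmem θ⟩, by fun_prop⟩
  have hρ : ∀ θ, H.map (ρ θ) = μ θ := fun θ => by
    rw [← coe_homeoImage H subset_rfl, ContinuousMap.coe_mk, Homeomorph.apply_symm_apply]
  have hρm : ∀ θ, (ρ θ).1 ∈ stdMeridianDisc k ∩ frontier (stdHandlebody g) := fun θ => by
    obtain ⟨p, hp, hpθ⟩ := hm θ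
    rwa [H.injOn (ρ θ).2 (hfr hp.2) ((hρ θ).trans hpθ.symm)]
  have hρe : ∀ θ, (2 * (k : ℝ) + 3 / 2, (ρ θ).1.2) = (ρ θ).1 := fun θ =>
    Prod.ext (mem_disc_frontier_iff.1 (hρm θ)).1.symm rfl
  refine ⟨⟨fun θ => (ρ θ).1.2, by fun_prop⟩, fun θ θ' h => ?_, ?_, fun θ => ?_⟩
  · have h' : (ρ θ).1 = (ρ θ').1 := by rw [← hρe θ, ← hρe θ']; exact congrArg _ h
    exact hμ (Subtype.ext (by rw [← hρ θ, ← hρ θ', h']))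
  · refine Set.Subset.antisymm ?_ fun v hv => ?_
    · rintro _ ⟨θ, rfl⟩
      exact (mem_disc_frontier_iff.1 (hρm θ)).2
    · have hv' := mem_disc_frontier_iff.2
        (⟨rfl, hv⟩ : ((2 * (k : ℝ) + 3 / 2, v) : ℝ × ℝ × ℝ).1 = 2 * (k : ℝ) + 3 / 2 ∧ _)
      obtain ⟨θ, hθ⟩ := hr.symm.subset ⟨_, hv', rfl⟩
      refine ⟨θ, ?_⟩
      have := H.injOn (ρ θ).2 (hfr hv'.2) ((hρ θ).trans hθ)
      exact congrArg Prod.snd this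
  · change (2 * (k : ℝ) + 3 / 2, (ρ θ).1.2) ∈ stdHandlebody g ∧
      H.map (2 * (k : ℝ) + 3 / 2, (ρ θ).1.2) = μ θ
    rw [hρe]
    exact ⟨(ρ θ).2, hρ θ⟩

-- The core meets the disc only in its centre, so shrinking the boundary circle towards the centre
-- by a positive factor keeps it off the core.
omit hA in
theorem pushed_mem (k : Fin g) {v : ℝ × ℝ}
    (hv : v ∈ Metric.sphere ((1 / 2, 1 / 2) : ℝ × ℝ) (1 / 2)) {t : ℝ} (ht : 0 < t) (ht' : t ≤ 1) :
    (2 * (k : ℝ) + 3 / 2, (1 / 2, 1 / 2) + t • (v - (1 / 2, 1 / 2))) ∈ stdHandlebody g ∧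
    (2 * (k : ℝ) + 3 / 2, (1 / 2, 1 / 2) + t • (v - (1 / 2, 1 / 2))) ∉ stdCore g := by
  obtain ⟨y, z⟩ := v
  have hk : (k : ℝ) + 1 ≤ g := by exact_mod_cast k.2
  have hk0 : (0 : ℝ) ≤ k := Nat.cast_nonneg _
  have hv' : max |y - 1 / 2| |z - 1 / 2| = 1 / 2 := hv
  have hy := abs_le.1 ((le_max_left _ _).trans hv'.le)
  have hz := abs_le.1 ((le_max_right _ _).trans hv'.le)
  simp only [Prod.mk_sub_mk, Prod.smul_mk, Prod.mk_add_mk, smul_eq_mul]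
  have hy1 : 0 ≤ 1 / 2 + t * (y - 1 / 2) := by nlinarith
  have hy2 : 1 / 2 + t * (y - 1 / 2) ≤ 1 := by nlinarith
  have hz1 : 0 ≤ 1 / 2 + t * (z - 1 / 2) := by nlinarith
  have hz2 : 1 / 2 + t * (z - 1 / 2) ≤ 1 := by nlinarith
  constructor
  · refine ⟨⟨?_, ?_⟩, ⟨hy1, ?_⟩, ⟨hz1, hz2⟩, fun i hi => ?_⟩
    iterate 3 dsimp only; linarith
    have := hi.2.1
    dsimp only at this
    linarith
  · intro h
    obtain ⟨-, -, h3, h4⟩ := mem_stdCore_iff.1 h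
    dsimp only at h3 h4
    have hz0 : z - 1 / 2 = 0 := by
      have : t * (z - 1 / 2) = 0 := by linarith
      exact (mul_eq_zero.1 this).resolve_left ht.ne'
    rcases h4 with ⟨n, hn⟩ | h4 | h4
    · have : ((2 * k + 1 : ℤ) : ℝ) = ((2 * n : ℤ) : ℝ) := by push_cast; linarith
      have := Int.cast_injective this
      omega
    · have hy0 : y - 1 / 2 = 0 := by
        have : t * (y - 1 / 2) = 0 := by linarith
        exact (mul_eq_zero.1 this).resolve_left ht.ne'
      rw [hy0, hz0, abs_zero, max_self] at hv'
      norm_num at hv'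
    · linarith

/-- The radial homotopy in the disc, with factor growing from `1/2` to `1`, carries the small circle
around the erased arc to the meridian. It takes place in the complement of the core. -/
theorem loopClass_pushed (k : Fin g) {μ : C(UnitAddCircle, A)} {P : Set M}
    (hP : P ⊆ H.outside (coreMinus g k)) {c : C(UnitAddCircle, ℝ × ℝ)}
    (hcs : ∀ θ, c θ ∈ Metric.sphere ((1 / 2, 1 / 2) : ℝ × ℝ) (1 / 2))
    (hcμ : ∀ θ, (2 * (k : ℝ) + 3 / 2, c θ) ∈ stdHandlebody g ∧
      H.map (2 * (k : ℝ) + 3 / 2, c θ) = μ θ) {f : C(UnitAddCircle, P)}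
    (hf : ∀ θ, (f θ : M) =
      H.map (2 * (k : ℝ) + 3 / 2, (1 / 2, 1 / 2) + (1 / 2 : ℝ) • (c θ - (1 / 2, 1 / 2)))) :
    Hmap 1 (incl hP) (loopClass f) =
      Hmap 1 (incl (hA.subset_outside (coreMinus_subset k))) (loopClass μ) := by
  rw [Hmap_loopClass, Hmap_loopClass]
  have ht : ∀ t : unitInterval, 0 < 1 / 2 + (t : ℝ) / 2 ∧ 1 / 2 + (t : ℝ) / 2 ≤ 1 := fun t =>
    ⟨by linarith [t.2.1], by linarith [t.2.2]⟩
  obtain ⟨G, hG⟩ : ∃ G : C(unitInterval × UnitAddCircle, stdHandlebody g), ∀ q,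
      (G q : ℝ × ℝ × ℝ) = (2 * (k : ℝ) + 3 / 2, (1 / 2, 1 / 2) +
        (1 / 2 + (q.1 : ℝ) / 2) • (c q.2 - (1 / 2, 1 / 2))) :=
    ⟨⟨fun q => ⟨(2 * (k : ℝ) + 3 / 2, (1 / 2, 1 / 2) +
      (1 / 2 + (q.1 : ℝ) / 2) • (c q.2 - (1 / 2, 1 / 2))),
      (pushed_mem k (hcs q.2) (ht q.1).1 (ht q.1).2).1⟩, by fun_prop⟩, fun _ => rfl⟩
  have hGm : ∀ q, H.emb (G q) ∈ H.outside (coreMinus g k) := by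
    rintro q ⟨p, hp, hpq⟩
    have hm := (pushed_mem k (hcs q.2) (ht q.1).1 (ht q.1).2).2
    rw [← hG, ← H.injOn (stdCore_subset hp.1) (G q).2 hpq] at hm
    exact hm hp.1
  refine loopClass_eq_of_homotopic ⟨⟨⟨fun q => ⟨H.emb (G q), hGm q⟩, by fun_prop⟩,
    fun θ => Subtype.ext ?_, fun θ => Subtype.ext ?_⟩⟩
  · change H.map (G (0, θ)) = f θ
    rw [hf, hG]
    simp
  · change H.map (G (1, θ)) = μ θ
    rw [hG, ← (hcμ θ).2]
    change H.map (_, _ + (1 / 2 + (1 : ℝ) / 2) • _) = _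
    rw [add_halves, one_smul, add_sub_cancel]

omit hA in
theorem exists_pushed_circle (k : Fin g) {c : C(UnitAddCircle, ℝ × ℝ)} (hc : Function.Injective c)
    (hcr : Set.range c = Metric.sphere ((1 / 2, 1 / 2) : ℝ × ℝ) (1 / 2)) :
    ∃ f : C(UnitAddCircle, (handleBox k \ coreMinus g k : Set (ℝ × ℝ × ℝ))),
      (∀ θ, (f θ : ℝ × ℝ × ℝ) =
        (2 * (k : ℝ) + 3 / 2, (1 / 2, 1 / 2) + (1 / 2 : ℝ) • (c θ - (1 / 2, 1 / 2)))) ∧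
      ∀ n, Function.Bijective (Hmap n f) := by
  have hcs : ∀ θ, c θ ∈ Metric.sphere ((1 / 2, 1 / 2) : ℝ × ℝ) (1 / 2) := fun θ =>
    hcr.subset ⟨θ, rfl⟩
  have hT : ∀ p, p ∈ handleBox k \ coreMinus g k ↔
      p.1 ∈ Set.Ioo (2 * (k : ℝ) + 1 / 2) (2 * k + 5 / 2) ∧
      p.2 ∈ Set.Ioo (0 : ℝ) 1 ×ˢ Set.Ioo (0 : ℝ) 1 ∧ p.2 ≠ (1 / 2, 1 / 2) := fun p => by
    constructor
    · rintro ⟨hp, hp'⟩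
      rw [mem_coreMinus_handleBox k.2 hp] at hp'
      exact ⟨hp.1, hp.2, hp'⟩
    · rintro ⟨h1, h2, h3⟩
      have hp : p ∈ handleBox k := ⟨h1, h2⟩
      exact ⟨hp, by rwa [mem_coreMinus_handleBox k.2 hp]⟩
  have hcpos : ∀ θ, c θ - (1 / 2, 1 / 2) ≠ 0 := fun θ h => by
    have := hcs θ
    rw [Metric.mem_sphere, dist_eq_norm, h, norm_zero] at this
    norm_num at this
  have hmem : ∀ θ, (2 * (k : ℝ) + 3 / 2, (1 / 2, 1 / 2) + (1 / 2 : ℝ) • (c θ - (1 / 2, 1 / 2))) ∈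
      handleBox k \ coreMinus g k := fun θ => by
    have h : max |(c θ).1 - 1 / 2| |(c θ).2 - 1 / 2| = 1 / 2 := hcs θ
    have hy := abs_le.1 ((le_max_left _ _).trans h.le)
    have hz := abs_le.1 ((le_max_right _ _).trans h.le)
    refine (hT _).2 ⟨⟨by dsimp only; linarith, by dsimp only; linarith⟩,
      ⟨⟨?_, ?_⟩, ?_, ?_⟩, fun h => ?_⟩
    iterate 4
      simp only [Prod.fst_add, Prod.snd_add, Prod.smul_fst, Prod.smul_snd, Prod.fst_sub,
        Prod.snd_sub, smul_eq_mul]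
      linarith
    exact smul_ne_zero (by norm_num) (hcpos θ) (add_eq_left.1 h)
  refine ⟨⟨fun θ => ⟨_, hmem θ⟩, by fun_prop⟩, fun θ => rfl, fun n => ?_⟩
  exact tube_bijective (a := 2 * (k : ℝ) + 1 / 2) (b := 2 * k + 5 / 2) (m := 2 * k + 3 / 2)
    ⟨by linarith, by linarith⟩ hc hcr hT (fun θ => rfl) n

theorem exists_pushed (k : Fin g) {μ : C(UnitAddCircle, A)} (hμ : Function.Injective μ)
    (hr : Set.range (fun θ => (μ θ : M)) = H.meridian k)
    (hP : H.map '' (handleBox k \ coreMinus g k) ⊆ H.outside (coreMinus g k)) :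
    ∃ f : C(UnitAddCircle, H.map '' (handleBox k \ coreMinus g k)),
      (∀ n, Function.Bijective (Hmap n f)) ∧ Hmap 1 (incl hP) (loopClass f) =
        Hmap 1 (incl (hA.subset_outside (coreMinus_subset k))) (loopClass μ) := by
  obtain ⟨c, hc, hcr, hcμ⟩ := exists_parametrization k hμ hr
  obtain ⟨f₀, hf₀e, hf₀⟩ := exists_pushed_circle k hc hcr
  have hsub : (handleBox k \ coreMinus g k : Set (ℝ × ℝ × ℝ)) ⊆ stdHandlebody g :=
    Set.sdiff_subset.trans (handleBox_subset k.2)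
  obtain ⟨e, he, hb⟩ := H.exists_parametrization_image hsub
  refine ⟨e.comp f₀, fun n => Hmap_comp_bijective (hb n) (hf₀ n), ?_⟩
  refine hA.loopClass_pushed k hP (fun θ => hcr.subset ⟨θ, rfl⟩) hcμ fun θ => ?_
  rw [ContinuousMap.comp_apply, he, hf₀e]

variable {μ : Fin g → C(UnitAddCircle, A)} (hμ : ∀ i, Function.Injective (μ i))
  (hr : ∀ i, Set.range (fun θ => (μ i θ : M)) = H.meridian i)
  (hA2 : ∀ n, Subsingleton (Homology (n + 2) A))
include hμ hr hA2

theorem handleStage_core {k : ℕ} (hk : k ≤ g) : HandleStage (fun i => loopClass (μ i))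
    (hA.subset_outside (coreMinus_subset (g := g) k)) k := by
  induction k with
  | zero =>
    refine HandleStage.start (fun n => ?_) hA2
    have := hA.bijective_core n
    -- The proofs of inclusion depend on the set to be rewritten, so they are generalised before
    -- `coreMinus g 0` is replaced by the core. The same device recurs below.
    revert this
    generalize_proofs h1 h2
    revert h1 h2
    rw [coreMinus_zero]
    exact fun _ _ h => h
  | succ k ih =>
    have hs := ih (by omega)
    have h := hA.isOpenUnion (V := handleBox k) (isOpen_openBox _ _ _ _ _ _) (handleBox_subset hk)
      ((coreMinus_subset k).trans stdCore_subset) (isClosed_coreMinus k)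
    rw [← coreMinus_succ] at h
    have hc : ContractibleSpace (handleBox k) :=
      contractible_openBox (by linarith) one_pos one_pos
    have : ContractibleSpace (H.map '' handleBox k) :=
      (H.homeoImage (handleBox_subset hk)).symm.contractibleSpace
    obtain ⟨f, hf, hfe⟩ := hA.exists_pushed ⟨k, hk⟩ (hμ ⟨k, hk⟩) (hr ⟨k, hk⟩) h.interLeft
    exact HandleStage.succ (k := ⟨k, hk⟩) hs h hf hfe

theorem handleStage_comb {k : ℕ} (hk : k ≤ g + 1) : HandleStage (fun i => loopClass (μ i))
    (hA.subset_outside (combMinus_subset (g := g) k)) g := by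
  induction k with
  | zero =>
    have := hA.handleStage_core hμ hr hA2 le_rfl
    revert this
    generalize_proofs h1 h2
    revert h1 h2
    rw [combMinus_zero]
    exact fun _ _ h => h
  | succ k ih =>
    have hk' : k ≤ g := by omega
    have hc : ContractibleSpace (toothBox k) :=
      contractible_openBox (by linarith) (by norm_num) one_pos
    have := contractible_toothBox_diff hk'
    have h := (ih (by omega)).of_bijective _ (hA.bijective_attach (V := toothBox k) (isOpen_openBox _ _ _ _ _ _)
      (toothBox_subset hk') ((combMinus_subset k).trans stdCore_subset) (isClosed_combMinus k))
    revert h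
    generalize_proofs h1 h2
    revert h1 h2
    rw [combMinus_succ]
    exact fun _ _ h => h

theorem handleStage_corner (hq : A ⊆ H.outside {cornerPoint}) :
    HandleStage (fun i => loopClass (μ i)) hq g := by
  have hc : ContractibleSpace (backBox g) :=
    contractible_openBox (by linarith [g.cast_nonneg (α := ℝ)]) (by norm_num) one_pos
  have := contractible_backBox_diff (g := g)
  have h := (hA.handleStage_comb hμ hr hA2 le_rfl).of_bijective _
    (hA.bijective_attach (V := backBox g) (isOpen_openBox _ _ _ _ _ _) backBox_subset
      ((combMinus_subset _).trans stdCore_subset) (isClosed_combMinus _))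
  revert h
  generalize_proofs h1
  revert h1
  rw [back_diff_backBox]
  exact fun _ h => h

/-- The homology of the space obtained by gluing a handlebody to `A`. -/
theorem homology_glued :
    Function.Surjective (Hmap 1 (⟨Subtype.val, continuous_subtype_val⟩ : C(A, M))) ∧
    (∀ a, Hmap 1 (⟨Subtype.val, continuous_subtype_val⟩ : C(A, M)) a = 0 ↔
      ∃ c : Fin g → ℤ, a = ∑ i, c i • loopClass (μ i)) ∧
    ((∀ c : Fin g → ℤ, ∑ i, c i • loopClass (μ i) = 0 → c = 0) →
      Subsingleton (Homology 2 M) ∧ Nonempty (Homology 3 M ≃+ ℤ) ∧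
      ∀ n, Subsingleton (Homology (n + 4) M)) := by
  have hqN : ({cornerPoint} : Set (ℝ × ℝ × ℝ)) ⊆ stdHandlebody g :=
    Set.singleton_subset_iff.2 (cornerBox_subset cornerPoint_mem)
  have hq : A ⊆ H.outside {cornerPoint} := hA.subset_outside fun p hp =>
    combMinus_subset (g + 1) ((back_diff_backBox (g := g)).symm.subset hp).1
  have hs := hA.handleStage_corner hμ hr hA2 hq
  have h := hA.isOpenUnion (V := cornerBox) (isOpen_openBox _ _ _ _ _ _) cornerBox_subset hqN isClosed_singleton
  -- Once the last point of the graph is erased nothing is missing from `M`.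
  have hX : H.outside ({cornerPoint} \ cornerBox) = Set.univ := by
    rw [Set.sdiff_eq_empty.2 (Set.singleton_subset_iff.2 cornerPoint_mem)]
    simp [outside]
  rw [hX] at h
  have hc : ContractibleSpace cornerBox := contractible_openBox one_pos (by norm_num) one_pos
  have : ContractibleSpace (H.map '' cornerBox) :=
    (H.homeoImage cornerBox_subset).symm.contractibleSpace
  have hP : IsHomologyTwoSphere (H.map '' (cornerBox \ {cornerPoint})) :=
    (isHomologyTwoSphere_ball (convex_openBox _ _ _ _ _ _) (by norm_num)
      sphere_subset_cornerBox).of_bijective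
      (Hmap_bijective_homeomorph (H.homeoImage (Set.sdiff_subset.trans cornerBox_subset)))
  let U : (Set.univ : Set M) ≃ₜ M := Homeomorph.Set.univ M
  have hU := Hmap_bijective_homeomorph U
  have hcomp : ∀ a, Hmap 1 (⟨Subtype.val, continuous_subtype_val⟩ : C(A, M)) a =
      Hmap 1 (U : C(_, _)) (Hmap 1 (incl h.left) (Hmap 1 (incl hq) a)) := fun a => by
    rw [Hmap_incl_incl, ← Hmap_comp]; rfl
  have := hP.one
  have hB1 : Subsingleton (Homology 1 (H.map '' cornerBox)) := subsingleton_homology_of_contractible 0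
  have hsurj := h.surjective_one hP.aug_injective
  -- Filling in a point kills no class in degree one, because the overlap has no first homology.
  have hinj : Function.Injective (Hmap 1 (incl h.left)) :=
    (injective_iff_map_eq_zero _).2 fun a ha => by
      obtain ⟨p, rfl⟩ := h.exists_of_map_eq_zero ha
      rw [Subsingleton.elim p 0, map_zero]
  refine ⟨fun y => ?_, fun a => ?_, fun hli => ⟨?_, ?_, fun n => ?_⟩⟩
  · obtain ⟨y, rfl⟩ := (hU 1).2 y
    obtain ⟨x, rfl⟩ := hsurj y
    obtain ⟨a, rfl⟩ := hs.surjective x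
    exact ⟨a, hcomp a⟩
  · rw [hcomp, map_eq_zero_iff _ (hU 1).1, map_eq_zero_iff _ hinj, hs.ker_iff]
    exact ⟨fun ⟨c, _, hc⟩ => ⟨c, hc⟩, fun ⟨c, hc⟩ => ⟨c, fun i hi => absurd i.2 (by omega), hc⟩⟩
  · have : Subsingleton (Homology (1 + 1) (H.outside {cornerPoint})) := hs.two hli
    have : Subsingleton (Homology 2 (Set.univ : Set M)) := h.subsingleton (n := 1)
    exact subsingleton_homology_of_bijective (hU 2)
  -- The third homology arises only at this last gluing: with the neighbouring groups zero, the
  -- connecting map identifies it with the second homology of the sphere around the point.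
  · have h2 : Subsingleton (Homology 2 (H.outside {cornerPoint})) := hs.two hli
    have h3 : Subsingleton (Homology (2 + 1) (H.outside {cornerPoint})) := hs.ge_three 0
    have h4 : Subsingleton (Homology 2 (H.map '' cornerBox)) :=
      subsingleton_homology_of_contractible 1
    exact ⟨(AddEquiv.ofBijective _ (hU 3)).symm.trans
      ((AddEquiv.ofBijective _ (h.delta_bijective (n := 2))).trans hP.two.some)⟩
  · have := hs.ge_three (n + 1)
    have : Subsingleton (Homology (n + 3 + 1) (H.outside {cornerPoint})) := hs.ge_three (n + 1)
    have := hP.ge_three n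
    have : Subsingleton (Homology (n + 4) (Set.univ : Set M)) := h.subsingleton (n := n + 3)
    exact subsingleton_homology_of_bijective (hU (n + 4))

end MarkedHandlebody.IsComplement

end

end HeegaardGauss
end

open scoped Manifold ContDiff Topology
noncomputable section
namespace HeegaardGauss

/-! ### Counting crossings -/

section

theorem eventually_le_iff (T : Finset ℝ) (t : ℝ) :
    ∀ᶠ v in 𝓝 t, ∀ τ ∈ T, τ ≠ t → (τ ≤ v ↔ τ ≤ t) := by
  rw [Filter.eventually_all_finset]
  intro τ _
  rcases lt_trichotomy τ t with h | h | h
  · filter_upwards [lt_mem_nhds h] with v hv _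
    exact ⟨fun _ => h.le, fun _ => hv.le⟩
  · exact Filter.Eventually.of_forall fun v hv => absurd h hv
  · filter_upwards [gt_mem_nhds h] with v hv _
    exact ⟨fun h' => absurd h' hv.not_ge, fun h' => absurd h' h.not_ge⟩

/-- The level of a real function relative to the half-integers, corrected by the signs of the
crossings so far. -/
def level (g : ℝ → ℝ) (σ : ℝ → ℤ) (T : Finset ℝ) (t : ℝ) : ℤ :=
  ⌊g t - 1 / 2⌋ - (if t ∈ T ∧ σ t = -1 then 1 else 0) - ∑ τ ∈ T.filter (· ≤ t), σ τ

theorem fract_eq_half_iff {x : ℝ} : Int.fract x = 1 / 2 ↔ ((⌊x - 1 / 2⌋ : ℤ) : ℝ) = x - 1 / 2 := by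
  constructor
  · intro h
    have : x - 1 / 2 = (⌊x⌋ : ℝ) := by rw [← h, Int.self_sub_fract]
    rw [this, Int.floor_intCast]
  · intro h
    have : x = 1 / 2 + (⌊x - 1 / 2⌋ : ℤ) := by linarith
    rw [this, Int.fract_add_intCast]
    norm_num [Int.fract_eq_iff]

/-- The floor jumps exactly at the crossings, by the sign of the crossing. At an upward crossing it
already has its new value, as has the sum. At a downward crossing it still has its old value while
the sum has changed, which the correction term repairs. -/
theorem level_eventually_eq {g : ℝ → ℝ} (hg : Continuous g) {σ : ℝ → ℤ} {T : Finset ℝ}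
    (hT : ∀ t ∈ Set.Icc (0 : ℝ) 1, t ∈ T ↔ Int.fract (g t) = 1 / 2)
    (hσ : ∀ t ∈ T, σ t = 1 ∨ σ t = -1)
    (hs : ∀ t ∈ T, ∀ᶠ v in 𝓝 t, v ≠ t → 0 < σ t * (v - t) * (Int.fract (g v) - 1 / 2))
    {t : ℝ} (ht : t ∈ Set.Icc (0 : ℝ) 1) :
    ∀ᶠ v in 𝓝 t, v ∈ Set.Icc (0 : ℝ) 1 → level g σ T v = level g σ T t := by
  have hr : Continuous fun t => g t - 1 / 2 := hg.sub continuous_const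
  by_cases htT : t ∈ T
  · have hk := fract_eq_half_iff.1 ((hT t ht).1 htT)
    set k := ⌊g t - 1 / 2⌋ with hkdef
    have h1 : ∀ᶠ v in 𝓝 t, (k : ℝ) - 1 / 2 < g v - 1 / 2 :=
      hr.continuousAt.eventually_const_lt (by rw [hk]; linarith)
    have h2 : ∀ᶠ v in 𝓝 t, g v - 1 / 2 < (k : ℝ) + 1 / 2 :=
      hr.continuousAt.eventually_lt_const (by rw [hk]; linarith)
    filter_upwards [h1, h2, hs t htT, eventually_le_iff T t] with v h1 h2 h3 h4 hv
    by_cases hvt : v = t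
    · rw [hvt]
    have h3 := h3 hvt
    have hfr : Int.fract (g v) = g v - k := by
      rw [Int.fract_eq_iff]
      exact ⟨by linarith, by linarith, k, by ring⟩
    have hvT : v ∉ T := fun h => by
      rw [hT v hv] at h
      rw [h, sub_self, mul_zero] at h3
      exact lt_irrefl _ h3
    have hup : 0 < g v - 1 / 2 - k → ⌊g v - 1 / 2⌋ = k := fun h => by
      rw [Int.floor_eq_iff]; constructor <;> linarith
    have hdown : g v - 1 / 2 - k < 0 → ⌊g v - 1 / 2⌋ = k - 1 := fun h => by
      rw [Int.floor_eq_iff]; push_cast; constructor <;> linarith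
    rw [hfr, show g v - k - 1 / 2 = g v - 1 / 2 - k by ring] at h3
    rw [level, level, if_neg (fun h => hvT h.1), ← hkdef]
    rcases lt_or_gt_of_ne hvt with hlt | hgt
    · have hf : T.filter (· ≤ v) = (T.filter (· ≤ t)).erase t := by
        ext τ
        simp only [Finset.mem_filter, Finset.mem_erase]
        constructor
        · rintro ⟨a, b⟩
          have : τ ≠ t := by rintro rfl; linarith
          exact ⟨this, a, (h4 τ a this).1 b⟩
        · rintro ⟨a, b, c⟩
          exact ⟨b, (h4 τ b a).2 c⟩
      have hsum := Finset.sum_erase_eq_sub (f := σ)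
        (Finset.mem_filter.2 ⟨htT, le_refl t⟩ : t ∈ T.filter (· ≤ t))
      rw [hf, hsum]
      rcases hσ t htT with h | h
      · rw [h] at h3 ⊢
        rw [hdown (by push_cast at h3; nlinarith), if_neg (by norm_num)]
        ring
      · rw [h] at h3 ⊢
        rw [hup (by push_cast at h3; nlinarith), if_pos ⟨htT, rfl⟩]
        ring
    · have hf : T.filter (· ≤ v) = T.filter (· ≤ t) := by
        ext τ
        simp only [Finset.mem_filter]
        refine and_congr_right fun a => ?_
        by_cases hτ : τ = t
        · rw [hτ]; exact ⟨fun _ => le_rfl, fun _ => hgt.le⟩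
        · exact h4 τ a hτ
      rw [hf]
      rcases hσ t htT with h | h
      · rw [h] at h3 ⊢
        rw [hup (by push_cast at h3; nlinarith), if_neg (by norm_num)]
      · rw [h] at h3 ⊢
        rw [hdown (by push_cast at h3; nlinarith), if_pos ⟨htT, rfl⟩]
        ring
  · have hne : ((⌊g t - 1 / 2⌋ : ℤ) : ℝ) ≠ g t - 1 / 2 := fun h =>
      htT ((hT t ht).2 (fract_eq_half_iff.2 h))
    have h1 : ∀ᶠ v in 𝓝 t, ((⌊g t - 1 / 2⌋ : ℤ) : ℝ) < g v - 1 / 2 :=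
      hr.continuousAt.eventually_const_lt (lt_of_le_of_ne (Int.floor_le _) hne)
    have h2 : ∀ᶠ v in 𝓝 t, g v - 1 / 2 < (⌊g t - 1 / 2⌋ : ℤ) + 1 :=
      hr.continuousAt.eventually_lt_const (Int.lt_floor_add_one _)
    filter_upwards [h1, h2, eventually_le_iff T t] with v h1 h2 h4 hv
    have hfl : ⌊g v - 1 / 2⌋ = ⌊g t - 1 / 2⌋ := Int.floor_eq_iff.2 ⟨h1.le, h2⟩
    have hvT : v ∉ T := fun h => by
      have := fract_eq_half_iff.1 ((hT v hv).1 h)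
      rw [hfl] at this
      linarith
    have hf : T.filter (· ≤ v) = T.filter (· ≤ t) := by
      ext τ
      simp only [Finset.mem_filter]
      exact and_congr_right fun a => h4 τ a (by rintro rfl; exact htT a)
    rw [level, level, hfl, hf, if_neg (fun h => hvT h.1), if_neg (fun h => htT h.1)]

/-- The increment of a real function over a period is the number of its crossings of the
half-integers, counted with signs. -/
theorem sub_eq_sum_crossings {g : ℝ → ℝ} (hg : Continuous g) {σ : ℝ → ℤ} {T : Finset ℝ}
    (hT : ∀ t ∈ Set.Icc (0 : ℝ) 1, t ∈ T ↔ Int.fract (g t) = 1 / 2)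
    (hσ : ∀ t ∈ T, σ t = 1 ∨ σ t = -1)
    (hs : ∀ t ∈ T, ∀ᶠ v in 𝓝 t, v ≠ t → 0 < σ t * (v - t) * (Int.fract (g v) - 1 / 2))
    (hT1 : ∀ t ∈ T, t ∈ Set.Icc (0 : ℝ) 1) {n : ℤ} (hn : g 1 = g 0 + n) (hσ1 : σ 1 = σ 0) :
    n = ∑ τ ∈ T.filter (0 < ·), σ τ := by
  have hloc : IsLocallyConstant fun t : Set.Icc (0 : ℝ) 1 => level g σ T t := by
    rw [IsLocallyConstant.iff_eventually_eq]
    intro t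
    have := (level_eventually_eq hg hT hσ hs t.2)
    filter_upwards [continuous_subtype_val.continuousAt.eventually this] with v hv
    exact hv v.2
  have h := hloc.apply_eq_of_preconnectedSpace ⟨1, by simp⟩ ⟨0, by simp⟩
  -- The two ends are the same point of the circle, so their correction terms cancel; dropping `0`
  -- from the sum counts a crossing there once.
  have h01 : (1 : ℝ) ∈ T ↔ (0 : ℝ) ∈ T := by
    rw [hT 1 (by simp), hT 0 (by simp), hn, Int.fract_add_intCast]
  have hfl : ⌊g 1 - 1 / 2⌋ = ⌊g 0 - 1 / 2⌋ + n := by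
    rw [hn, add_sub_right_comm, Int.floor_add_intCast]
  have hf1 : T.filter (· ≤ 1) = T := Finset.filter_true_of_mem fun t ht => (hT1 t ht).2
  have hsplit : ∑ τ ∈ T, σ τ = ∑ τ ∈ T.filter (0 < ·), σ τ + ∑ τ ∈ T.filter (· ≤ 0), σ τ := by
    rw [← Finset.sum_filter_add_sum_filter_not T (0 < ·)]
    simp only [not_lt]
  simp only [level, hfl, h01, hσ1, hf1, hsplit] at h
  linarith

end

end HeegaardGauss
end

open scoped Manifold ContDiff Topology
noncomputable section
namespace HeegaardGauss

/-! ### The sides of a simple closed curve -/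

section

/-- The vector `a` turned by a right angle. -/
def turn (a : Plane) : Plane := !₂[-a 1, a 0]

theorem frameDet_turn (a : Plane) : frameDet a (turn a) = a 0 * a 0 + a 1 * a 1 := by
  simp [frameDet, turn]

theorem frameDet_turn_pos {a : Plane} (ha : a ≠ 0) : 0 < frameDet a (turn a) := by
  rw [frameDet_turn]
  by_contra h
  have h0 : a 0 = 0 := by nlinarith [mul_self_nonneg (a 0), mul_self_nonneg (a 1)]
  have h1 : a 1 = 0 := by nlinarith [mul_self_nonneg (a 0), mul_self_nonneg (a 1)]
  refine ha ?_
  ext i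
  fin_cases i
  · exact h0
  · exact h1

theorem frameDet_add_smul (a n : Plane) (x y : ℝ) :
    frameDet a (x • a + y • n) = y * frameDet a n := by
  simp only [frameDet, PiLp.add_apply, PiLp.smul_apply, smul_eq_mul]
  ring

theorem exists_frame_equiv {a n : Plane} (h : frameDet a n ≠ 0) :
    ∃ e : (ℝ × ℝ) ≃L[ℝ] Plane, ∀ q, e q = q.1 • a + q.2 • n := by
  let l : (ℝ × ℝ) →ₗ[ℝ] Plane :=
    (LinearMap.toSpanSingleton ℝ Plane a).coprod (LinearMap.toSpanSingleton ℝ Plane n)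
  have hl : ∀ q, l q = q.1 • a + q.2 • n := fun q => by simp [l]
  have hinj : Function.Injective l := by
    rw [← LinearMap.ker_eq_bot, LinearMap.ker_eq_bot']
    intro q hq
    rw [hl] at hq
    have := frameDet_injective h (a := q.1) (b := -q.2) (by rw [neg_smul, sub_neg_eq_add, hq])
    exact Prod.ext this.1 (neg_eq_zero.1 this.2)
  exact ⟨(LinearEquiv.ofInjectiveOfFinrankEq l hinj (by simp)).toContinuousLinearEquiv, hl⟩

theorem eventually_sign_of_hasDerivAt {w : ℝ → ℝ} {c : ℝ} (hw : HasDerivAt w c 0) (h0 : w 0 = 0)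
    (hc : c ≠ 0) : ∀ᶠ v in 𝓝 (0 : ℝ), v ≠ 0 → 0 < c * v * w v := by
  have h1 := hasDerivAt_iff_tendsto_slope.1 hw
  have h2 : ∀ᶠ v in 𝓝[≠] (0 : ℝ), 0 < c * slope w 0 v :=
    (h1.const_mul c).eventually_const_lt (mul_self_pos.2 hc)
  rw [eventually_nhdsWithin_iff] at h2
  filter_upwards [h2] with v hv hv0
  have h3 := hv hv0
  rw [slope_def_field, h0, sub_zero, sub_zero] at h3
  have h4 : 0 < v * v := mul_self_pos.2 hv0
  have h5 : c * v * w v = c * (w v / v) * (v * v) := by field_simp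
  rw [h5]
  exact mul_pos h3 h4

theorem pos_or_neg_of_isPreconnected {X : Type*} [TopologicalSpace X] {K : Set X}
    (hK : IsPreconnected K) {f : X → ℝ} (hf : ContinuousOn f K) (h0 : ∀ x ∈ K, f x ≠ 0) :
    (∀ x ∈ K, 0 < f x) ∨ ∀ x ∈ K, f x < 0 := by
  by_contra! h
  obtain ⟨⟨x, hx, hx'⟩, y, hy, hy'⟩ := h
  obtain ⟨z, hz, hz'⟩ := hK.intermediate_value hx hy hf ⟨hx', hy'⟩
  exact h0 z hz hz'

variable {S : Type} [TopologicalSpace S] [ChartedSpace Plane S]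

/-- The function `f` vanishes exactly on the curve `α`, is continuous near it, and takes both signs
near each of its points. -/
structure IsDefining (f : S → ℝ) (α : SimpleClosedCurve S) : Prop where
  zero : ∀ s, f s = 0 ↔ s ∈ Set.range α.toFun
  continuousAt : ∀ s ∈ Set.range α.toFun, ∀ᶠ s' in 𝓝 s, ContinuousAt f s'
  pos : ∀ s ∈ Set.range α.toFun, ∃ᶠ s' in 𝓝 s, 0 < f s'
  neg : ∀ s ∈ Set.range α.toFun, ∃ᶠ s' in 𝓝 s, f s' < 0

/-- A closed curve near a parameter, read in the preferred chart. -/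
def ClosedCurve.read (α : ClosedCurve S) (θ : UnitAddCircle) (u : ℝ) : Plane :=
  chartAt Plane (α.toFun θ) (α.toFun (θ + (u : UnitAddCircle)))

/-- The Fermi coordinates along a curve. -/
def ClosedCurve.fermi (α : ClosedCurve S) (θ : UnitAddCircle) (q : ℝ × ℝ) : Plane :=
  α.read θ q.1 + q.2 • turn (α.velocity θ)

theorem ClosedCurve.continuous_shift (α : ClosedCurve S) (θ : UnitAddCircle) :
    Continuous fun u : ℝ => α.toFun (θ + (u : UnitAddCircle)) :=
  α.continuous.comp (continuous_const.add (AddCircle.continuous_mk' (1 : ℝ)))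

theorem ClosedCurve.eventually_mem_source (α : ClosedCurve S) (θ : UnitAddCircle) :
    ∀ᶠ u : ℝ in 𝓝 0, α.toFun (θ + (u : UnitAddCircle)) ∈ (chartAt Plane (α.toFun θ)).source := by
  refine ((chartAt Plane (α.toFun θ)).open_source.preimage (α.continuous_shift θ)).mem_nhds ?_
  rw [Set.mem_preimage, AddCircle.coe_zero, add_zero]
  exact mem_chart_source _ _

/-- An injective curve on a compact circle is an embedding, so no other strand of it comes near the
point `α θ`. -/
theorem SimpleClosedCurve.eventually_exists_shift [T2Space S] (α : SimpleClosedCurve S)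
    (θ : UnitAddCircle) {V : Set ℝ} (hV : V ∈ 𝓝 (0 : ℝ)) :
    ∀ᶠ s in 𝓝 (α.toFun θ), s ∈ Set.range α.toFun →
      ∃ u ∈ V, s = α.toFun (θ + (u : UnitAddCircle)) := by
  have hemb := (α.continuous.isClosedEmbedding α.injective).isEmbedding
  have ho : IsOpenMap (fun u : ℝ => θ + (u : UnitAddCircle)) :=
    (isOpenMap_add_left θ).comp QuotientAddGroup.isOpenMap_coe
  have h1 : (fun u : ℝ => θ + (u : UnitAddCircle)) '' V ∈ 𝓝 θ := by
    have := ho.image_mem_nhds hV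
    rwa [AddCircle.coe_zero, add_zero] at this
  rw [hemb.nhds_eq_comap, Filter.mem_comap] at h1
  obtain ⟨U, hU, hUV⟩ := h1
  filter_upwards [hU] with s hs
  rintro ⟨η, rfl⟩
  obtain ⟨u, hu, rfl⟩ := hUV hs
  exact ⟨u, hu, rfl⟩

section Manifold

variable [IsManifold (𝓡 2) ∞ S]

theorem ClosedCurve.contDiffAt_read (α : ClosedCurve S) (θ : UnitAddCircle) {u : ℝ}
    (hu : α.toFun (θ + (u : UnitAddCircle)) ∈ (chartAt Plane (α.toFun θ)).source) :
    ContDiffAt ℝ ∞ (α.read θ) u := by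
  obtain ⟨t, rfl⟩ := QuotientAddGroup.mk_surjective θ
  have h1 : ContMDiff 𝓘(ℝ) (𝓡 2) ∞
      (fun u : ℝ => α.toFun (((t : ℝ) : UnitAddCircle) + (u : UnitAddCircle))) := by
    have h2 : ContMDiff 𝓘(ℝ) 𝓘(ℝ) ∞ (fun u : ℝ => t + u) :=
      (contDiff_const.add contDiff_id).contMDiff
    exact α.smooth.comp h2
  rw [← contMDiffAt_iff_contDiffAt]
  have h2 := (contMDiffOn_chart (I := 𝓡 2) (n := ∞) (x := α.toFun ((t : ℝ) : UnitAddCircle))).contMDiffAt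
    ((chartAt Plane (α.toFun ((t : ℝ) : UnitAddCircle))).open_source.mem_nhds hu)
  exact h2.comp u (h1 u)

theorem ClosedCurve.hasStrictDerivAt_read (α : ClosedCurve S) (θ : UnitAddCircle) :
    HasStrictDerivAt (α.read θ) (α.velocity θ) 0 :=
  (α.contDiffAt_read θ (α.eventually_mem_source θ).self_of_nhds).hasStrictDerivAt' (α.hasDerivAt θ)
    (by simp)

theorem ClosedCurve.hasStrictFDerivAt_fermi (α : ClosedCurve S) (θ : UnitAddCircle)
    {e : (ℝ × ℝ) ≃L[ℝ] Plane}
    (he : ∀ q, e q = q.1 • α.velocity θ + q.2 • turn (α.velocity θ)) :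
    HasStrictFDerivAt (α.fermi θ) (e : (ℝ × ℝ) →L[ℝ] Plane) (0, 0) := by
  have h1 := ((α.hasStrictDerivAt_read θ).hasStrictFDerivAt.comp ((0, 0) : ℝ × ℝ) (f := Prod.fst)
    hasStrictFDerivAt_fst).add
    ((hasStrictFDerivAt_snd (𝕜 := ℝ) (p := ((0, 0) : ℝ × ℝ))).smul_const (turn (α.velocity θ)))
  refine HasStrictFDerivAt.congr_fderiv h1 (ContinuousLinearMap.ext fun q => ?_)
  simp [he]

/-- Fermi coordinates are local coordinates of the surface. -/
theorem ClosedCurve.exists_fermi_chart (α : ClosedCurve S) (θ : UnitAddCircle)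
    (hv : α.velocity θ ≠ 0) :
    ∃ E : OpenPartialHomeomorph (ℝ × ℝ) S, ((0, 0) : ℝ × ℝ) ∈ E.source ∧ E (0, 0) = α.toFun θ ∧
      (∀ q, E q = (chartAt Plane (α.toFun θ)).symm (α.fermi θ q)) ∧
      (∀ᶠ u in 𝓝 (0 : ℝ), E (u, 0) = α.toFun (θ + (u : UnitAddCircle))) ∧
      ∀ (ζ : ℝ → S) (b : Plane), ζ 0 = α.toFun θ →
        HasDerivAt (fun v => chartAt Plane (α.toFun θ) (ζ v)) b 0 →
        ∃ c, HasDerivAt (fun v => (E.symm (ζ v)).2) c 0 ∧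
          frameDet (α.velocity θ) b = c * frameDet (α.velocity θ) (turn (α.velocity θ)) := by
  obtain ⟨e, he⟩ := exists_frame_equiv (frameDet_turn_pos hv).ne'
  have hF := α.hasStrictFDerivAt_fermi θ he
  set φ := chartAt Plane (α.toFun θ) with hφ
  have h0 : α.fermi θ (0, 0) = φ (α.toFun θ) := by
    simp [ClosedCurve.fermi, ClosedCurve.read, hφ]
  have hline : ∀ u, α.fermi θ (u, 0) = φ (α.toFun (θ + (u : UnitAddCircle))) := fun u => by
    simp [ClosedCurve.fermi, ClosedCurve.read, hφ]
  have hev := α.eventually_mem_source θ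
  have hsrc := mem_chart_source Plane (α.toFun θ)
  have hinv := hF.to_localInverse
  set Φ := hF.toOpenPartialHomeomorph (α.fermi θ) with hΦ
  have hΦc : ∀ q, Φ q = α.fermi θ q := fun q => rfl
  refine ⟨Φ.trans φ.symm, ?_, ?_, fun q => rfl, ?_, ?_⟩
  · rw [OpenPartialHomeomorph.trans_source]
    refine ⟨hF.mem_toOpenPartialHomeomorph_source, ?_⟩
    rw [Set.mem_preimage, hΦc, h0]
    exact φ.map_source hsrc
  · rw [OpenPartialHomeomorph.trans_apply, hΦc, h0]
    exact φ.left_inv hsrc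
  · filter_upwards [hev] with u hu
    rw [OpenPartialHomeomorph.trans_apply, hΦc, hline]
    exact φ.left_inv hu
  · intro ζ b hζ hb
    -- In the frame of the velocity and its rotation, the second coordinate of `b` is the rate of
    -- departure from the curve, and the determinant with the velocity sees only this coordinate.
    refine ⟨(e.symm b).2, ?_, ?_⟩
    · have h1 : HasFDerivAt Φ.symm (e.symm : Plane →L[ℝ] (ℝ × ℝ)) (φ (ζ 0)) := by
        rw [hζ, ← h0]
        exact hinv.hasFDerivAt
      have h2 := h1.comp_hasDerivAt (0 : ℝ) hb
      exact (hasFDerivAt_snd (𝕜 := ℝ) (E := ℝ) (F := ℝ)).comp_hasDerivAt (0 : ℝ) h2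
    · conv_lhs => rw [← e.apply_symm_apply b, he, frameDet_add_smul]

/-- The function `f` has the sign of `ε` to the left of the curve `α` at the parameter `θ`, and the
opposite sign to the right of it. -/
def IsSide (f : S → ℝ) (α : SimpleClosedCurve S) (θ : UnitAddCircle) (ε : ℤˣ) : Prop :=
  ∀ᶠ q : ℝ × ℝ in 𝓝 (0, 0), q.2 ≠ 0 →
    0 < ((ε : ℤ) : ℝ) * q.2 * f ((chartAt Plane (α.toFun θ)).symm (α.fermi θ q))

/-- In Fermi coordinates the curve is an axis. On a small box `f` has no zeros off the axis, so its
sign is constant on each half; since both signs occur near the point, the halves have opposite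
signs. -/
theorem IsDefining.exists_isSide [T2Space S] {f : S → ℝ} {α : SimpleClosedCurve S}
    (hf : IsDefining f α) (θ : UnitAddCircle) : ∃ ε, IsSide f α θ ε := by
  obtain ⟨E, hE0, hEθ, hE, hline, -⟩ := α.exists_fermi_chart θ (α.immersed θ)
  have hθ : α.toFun θ ∈ Set.range α.toFun := ⟨θ, rfl⟩
  have hcont : Filter.Tendsto E (𝓝 (0, 0)) (𝓝 (α.toFun θ)) := hEθ ▸ E.continuousAt hE0
  have hline' : ∀ᶠ q : ℝ × ℝ in 𝓝 (0, 0), E (q.1, 0) = α.toFun (θ + (q.1 : UnitAddCircle)) :=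
    (continuous_fst.tendsto ((0, 0) : ℝ × ℝ)).eventually hline
  have hV : ∀ᶠ u in 𝓝 (0 : ℝ),
      E (u, 0) = α.toFun (θ + (u : UnitAddCircle)) ∧ ((u, 0) : ℝ × ℝ) ∈ E.source := by
    refine hline.and ?_
    exact ((Continuous.prodMk_left (0 : ℝ)).tendsto (0 : ℝ)).eventually (E.open_source.mem_nhds hE0)
  have hgood : ∀ᶠ q : ℝ × ℝ in 𝓝 (0, 0),
      ContinuousAt (fun q => f (E q)) q ∧ (f (E q) = 0 ↔ q.2 = 0) := by
    filter_upwards [E.open_source.mem_nhds hE0, hcont.eventually (hf.continuousAt _ hθ),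
      hcont.eventually (α.eventually_exists_shift θ hV), hline'] with q hq hqc hqs hql
    refine ⟨ContinuousAt.comp hqc (E.continuousAt hq), ?_⟩
    rw [hf.zero]
    constructor
    · intro h
      obtain ⟨u, ⟨hu1, hu2⟩, hu⟩ := hqs h
      rw [← hu1] at hu
      rw [E.injOn hq hu2 hu]
    · intro h
      rw [show q = (q.1, 0) from Prod.ext rfl h]
      exact ⟨_, hql.symm⟩
  rw [Metric.eventually_nhds_iff_ball] at hgood
  obtain ⟨δ, hδ, hball⟩ := hgood
  have hball' : ∀ q : ℝ × ℝ, q ∈ Metric.ball (0 : ℝ) δ ×ˢ Metric.ball (0 : ℝ) δ →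
      ContinuousAt (fun q => f (E q)) q ∧ (f (E q) = 0 ↔ q.2 = 0) := fun q hq => by
    rw [ball_prod_same] at hq
    exact hball q hq
  have hconv : ∀ I : Set ℝ, Convex ℝ I → 0 ∉ I → I ⊆ Metric.ball (0 : ℝ) δ →
      (∀ x ∈ Metric.ball (0 : ℝ) δ ×ˢ I, 0 < f (E x)) ∨
        ∀ x ∈ Metric.ball (0 : ℝ) δ ×ˢ I, f (E x) < 0 := by
    intro I hI h0 hIδ
    refine pos_or_neg_of_isPreconnected (((convex_ball (0 : ℝ) δ).prod hI).isPreconnected)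
      (fun x hx => (hball' x ⟨hx.1, hIδ hx.2⟩).1.continuousWithinAt) fun x hx hx0 => ?_
    rw [(hball' x ⟨hx.1, hIδ hx.2⟩).2] at hx0
    exact h0 (hx0 ▸ hx.2)
  have hfreq : ∀ P : S → Prop, (∃ᶠ s in 𝓝 (α.toFun θ), P s) →
      ∃ q ∈ Metric.ball (0 : ℝ) δ ×ˢ Metric.ball (0 : ℝ) δ, P (E q) := by
    intro P hP
    rw [← hEθ, ← E.map_nhds_eq hE0, Filter.frequently_map] at hP
    obtain ⟨q, hq, hq'⟩ := (hP.and_eventually (Metric.ball_mem_nhds _ hδ)).exists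
    change q ∈ Metric.ball _ _ at hq'
    rw [← ball_prod_same] at hq'
    exact ⟨q, hq', hq⟩
  obtain ⟨p, hp, hpp⟩ := hfreq _ (hf.pos _ hθ)
  obtain ⟨n, hn, hnn⟩ := hfreq _ (hf.neg _ hθ)
  have hp2 : p.2 ≠ 0 := fun h => hpp.ne' ((hball' p hp).2.2 h)
  have hn2 : n.2 ≠ 0 := fun h => hnn.ne ((hball' n hn).2.2 h)
  have hmem : ∀ q : ℝ × ℝ, q ∈ Metric.ball (0 : ℝ) δ ×ˢ Metric.ball (0 : ℝ) δ → q.2 ≠ 0 →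
      q ∈ Metric.ball (0 : ℝ) δ ×ˢ Set.Ioo 0 δ ∧ 0 < q.2 ∨
        q ∈ Metric.ball (0 : ℝ) δ ×ˢ Set.Ioo (-δ) 0 ∧ q.2 < 0 := by
    intro q hq hq2
    have h3 := hq.2
    rw [Metric.mem_ball, dist_zero_right, Real.norm_eq_abs, abs_lt] at h3
    rcases lt_or_gt_of_ne hq2 with h | h
    · exact .inr ⟨⟨hq.1, h3.1, h⟩, h⟩
    · exact .inl ⟨⟨hq.1, h, h3.2⟩, h⟩
  have hsub : ∀ a b, -δ ≤ a → b ≤ δ → Set.Ioo a b ⊆ Metric.ball (0 : ℝ) δ := fun a b ha hb x hx => by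
    rw [Metric.mem_ball, dist_zero_right, Real.norm_eq_abs, abs_lt]
    exact ⟨ha.trans_lt hx.1, hx.2.trans_le hb⟩
  have hup := hconv (Set.Ioo 0 δ) (convex_Ioo _ _) (fun h => h.1.false)
    (hsub _ _ (by linarith) le_rfl)
  have hlo := hconv (Set.Ioo (-δ) 0) (convex_Ioo _ _) (fun h => h.2.false)
    (hsub _ _ le_rfl hδ.le)
  have hsides : ∃ ε : ℤˣ, (∀ x ∈ Metric.ball (0 : ℝ) δ ×ˢ Set.Ioo 0 δ,
      0 < ((ε : ℤ) : ℝ) * f (E x)) ∧ ∀ x ∈ Metric.ball (0 : ℝ) δ ×ˢ Set.Ioo (-δ) 0,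
      ((ε : ℤ) : ℝ) * f (E x) < 0 := by
    rcases hup with hup | hup <;> rcases hlo with hlo | hlo
    · rcases hmem n hn hn2 with h | h
      · exact absurd (hup n h.1) hnn.not_gt
      · exact absurd (hlo n h.1) hnn.not_gt
    · exact ⟨1, by simpa using hup, by simpa using hlo⟩
    · exact ⟨-1, by simpa using hup, by simpa using hlo⟩
    · rcases hmem p hp hp2 with h | h
      · exact absurd (hup p h.1) hpp.not_gt
      · exact absurd (hlo p h.1) hpp.not_gt
  obtain ⟨ε, hε1, hε2⟩ := hsides
  refine ⟨ε, ?_⟩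
  rw [IsSide]
  filter_upwards [Metric.ball_mem_nhds ((0, 0) : ℝ × ℝ) hδ] with q hq hq2
  rw [← ball_prod_same] at hq
  rw [← hE, mul_right_comm]
  rcases hmem q hq hq2 with h | h
  · exact mul_pos (hε1 q h.1) h.2
  · exact mul_pos_of_neg_of_neg (hε2 q h.1) h.2

/-- The sign of a defining function along a path that crosses the curve. -/
theorem IsSide.eventually_path {f : S → ℝ} {α : SimpleClosedCurve S}
    {θ : UnitAddCircle} {ε : ℤˣ} (h : IsSide f α θ ε) {ζ : ℝ → S} {b : Plane}
    (hζ : ContinuousAt ζ 0) (hζ0 : ζ 0 = α.toFun θ)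
    (hb : HasDerivAt (fun v => chartAt Plane (α.toFun θ) (ζ v)) b 0)
    (hab : frameDet (α.velocity θ) b ≠ 0) :
    ∀ᶠ v in 𝓝 (0 : ℝ), v ≠ 0 →
      0 < ((ε : ℤ) : ℝ) * frameDet (α.velocity θ) b * v * f (ζ v) := by
  obtain ⟨E, hE0, hEθ, hE, -, hpath⟩ := α.exists_fermi_chart θ (α.immersed θ)
  obtain ⟨c, hc, hfr⟩ := hpath ζ b hζ0 hb
  have hK := frameDet_turn_pos (α.immersed θ)
  have hc0 : c ≠ 0 := fun h0 => hab (by rw [hfr, h0, zero_mul])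
  have htgt : α.toFun θ ∈ E.target := hEθ ▸ E.map_source hE0
  have hsymm : E.symm (α.toFun θ) = (0, 0) := by rw [← hEθ, E.left_inv hE0]
  have hq : Filter.Tendsto (fun v => E.symm (ζ v)) (𝓝 0) (𝓝 (0, 0)) := by
    have h1 : ContinuousAt E.symm (ζ 0) := by
      rw [hζ0]
      exact E.symm.continuousAt htgt
    have h2 : ContinuousAt (fun v => E.symm (ζ v)) 0 := ContinuousAt.comp h1 hζ
    rw [ContinuousAt, hζ0, hsymm] at h2
    exact h2
  have h1 := eventually_sign_of_hasDerivAt hc (by rw [hζ0, hsymm]) hc0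
  have h2 : ∀ᶠ v in 𝓝 (0 : ℝ), ζ v ∈ E.target :=
    hζ.eventually (E.open_target.mem_nhds (hζ0 ▸ htgt))
  filter_upwards [h1, h2, hq.eventually h] with v h1 h2 h3 hv
  have h4 := h1 hv
  have hne : (E.symm (ζ v)).2 ≠ 0 := fun h0 => by rw [h0, mul_zero] at h4; exact h4.false
  have h5 := h3 hne
  rw [← hE, E.right_inv h2] at h5
  have h6 := mul_pos (mul_pos h4 h5) hK
  have h7 : 0 < (E.symm (ζ v)).2 * (E.symm (ζ v)).2 := mul_self_pos.2 hne
  rw [hfr]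
  refine pos_of_mul_pos_left (b := (E.symm (ζ v)).2 * (E.symm (ζ v)).2) ?_ h7.le
  convert h6 using 1
  ring

end Manifold

end

end HeegaardGauss
end

open scoped Manifold ContDiff Topology
noncomputable section
namespace HeegaardGauss

/-! ### The sides of a curve on an oriented surface -/

section

theorem frameDet_map (L : Plane →L[ℝ] Plane) (v w : Plane) :
    frameDet (L v) (L w) = L.det * frameDet v w := by
  have h1 : ∀ u : Plane, u = u 0 • EuclideanSpace.single 0 1 + u 1 • EuclideanSpace.single 1 1 := by
    intro u
    ext i
    fin_cases i <;> simp
  have h2 : ∀ (u : Plane) (i : Fin 2), L u i =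
      u 0 * L (EuclideanSpace.single 0 1) i + u 1 * L (EuclideanSpace.single 1 1) i := by
    intro u i
    conv_lhs => rw [h1 u]
    simp
  have h3 : L.det = L (EuclideanSpace.single 0 1) 0 * L (EuclideanSpace.single 1 1) 1 -
      L (EuclideanSpace.single 1 1) 0 * L (EuclideanSpace.single 0 1) 1 := by
    rw [ContinuousLinearMap.det, ← LinearMap.det_toMatrix (EuclideanSpace.basisFun (Fin 2) ℝ).toBasis,
      Matrix.det_fin_two]
    simp [LinearMap.toMatrix_apply]
  rw [h3]
  unfold frameDet
  rw [h2 v 0, h2 v 1, h2 w 0, h2 w 1]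
  ring

/-- The default value of `fderiv` is zero, whose determinant in the plane is zero. So the
orientation condition on the atlas contains differentiability. -/
theorem differentiableAt_of_det_pos {T : Plane → Plane} {x : Plane} (h : 0 < (fderiv ℝ T x).det) :
    DifferentiableAt ℝ T x := by
  by_contra h0
  rw [fderiv_zero_of_not_differentiableAt h0] at h
  simp [ContinuousLinearMap.det] at h

theorem units_eq_of_mul_pos {ε δ : ℤˣ} {c x : ℝ} (hc : 0 < c) (h1 : 0 < ((ε : ℤ) : ℝ) * x)
    (h2 : 0 < ((δ : ℤ) : ℝ) * c * x) : ε = δ := by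
  have h3 : 0 < ((δ : ℤ) : ℝ) * x := by
    refine pos_of_mul_pos_left (b := c) ?_ hc.le
    linarith
  rcases Int.units_eq_one_or ε with rfl | rfl <;> rcases Int.units_eq_one_or δ with rfl | rfl
  · rfl
  · simp at h1 h3; linarith
  · simp at h1 h3; linarith
  · rfl

variable {S : Type} [TopologicalSpace S] [ChartedSpace Plane S]

theorem IsSide.eq {f : S → ℝ} {α : SimpleClosedCurve S} {θ : UnitAddCircle} {ε δ : ℤˣ}
    (h1 : IsSide f α θ ε) (h2 : IsSide f α θ δ) : ε = δ := by
  have h3 := (h1.and h2)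
  have h4 : Filter.Tendsto (fun s : ℝ => ((0, s) : ℝ × ℝ)) (𝓝[≠] 0) (𝓝 (0, 0)) :=
    ((Continuous.prodMk_right (0 : ℝ)).tendsto (0 : ℝ)).mono_left nhdsWithin_le_nhds
  obtain ⟨s, hs, hs0⟩ := ((h4.eventually h3).and self_mem_nhdsWithin).exists
  have h5 := hs.1 hs0
  have h6 := hs.2 hs0
  rw [mul_assoc] at h5 h6
  exact units_eq_of_mul_pos one_pos h5 (by rwa [mul_one])

variable [IsManifold (𝓡 2) ∞ S]

/-- Change of the chart in which a family of frames along a curve is read. -/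
theorem ClosedCurve.eventually_frame (hS : IsOrientedAtlas S) (α : ClosedCurve S)
    (θ : UnitAddCircle) (hv : α.velocity θ ≠ 0) :
    ∀ᶠ u : ℝ in 𝓝 0, ∃ b, ContinuousAt
        (fun s : ℝ => (chartAt Plane (α.toFun θ)).symm (α.fermi θ (u, s))) 0 ∧
      (chartAt Plane (α.toFun θ)).symm (α.fermi θ (u, 0)) = α.toFun (θ + (u : UnitAddCircle)) ∧
      HasDerivAt (fun s : ℝ => chartAt Plane (α.toFun (θ + (u : UnitAddCircle)))
        ((chartAt Plane (α.toFun θ)).symm (α.fermi θ (u, s)))) b 0 ∧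
      0 < frameDet (α.velocity (θ + (u : UnitAddCircle))) b := by
  set φ := chartAt Plane (α.toFun θ) with hφ
  set a := α.velocity θ with ha
  have hsrc := α.eventually_mem_source θ
  have hderiv : deriv (α.read θ) 0 = a := (α.hasStrictDerivAt_read θ).hasDerivAt.deriv
  have hder : ∀ᶠ u : ℝ in 𝓝 0, 0 < frameDet (deriv (α.read θ) u) (turn a) := by
    have h1 : ContinuousAt (deriv (α.read θ)) 0 :=
      (ContDiffAt.fderiv_right (m := 0) (α.contDiffAt_read θ hsrc.self_of_nhds)
        (by simp)).continuousAt.clm_apply continuousAt_const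
    have h2 : ContinuousAt (fun u => frameDet (deriv (α.read θ) u) (turn a)) 0 := by
      unfold frameDet
      fun_prop
    refine h2.eventually_const_lt ?_
    beta_reduce
    rw [hderiv]
    exact frameDet_turn_pos hv
  filter_upwards [hsrc, hder] with u hu hdu
  set p := α.toFun (θ + (u : UnitAddCircle)) with hp
  set φ' := chartAt Plane p with hφ'
  have hp' : p ∈ φ'.source := mem_chart_source _ _
  have hfermi : α.fermi θ (u, 0) = φ p := by
    simp [ClosedCurve.fermi, ClosedCurve.read, hφ, hp]
  have hread : α.read θ u = φ p := rfl
  have hT : φ p ∈ (φ.symm.trans φ').source := by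
    rw [OpenPartialHomeomorph.trans_source]
    refine ⟨φ.map_source hu, ?_⟩
    rw [Set.mem_preimage, φ.left_inv hu]
    exact hp'
  have hdet := hS φ (chart_mem_atlas _ _) φ' (chart_mem_atlas _ _) _ hT
  have hTd := (differentiableAt_of_det_pos hdet).hasFDerivAt
  set L := fderiv ℝ (φ.symm.trans φ') (φ p) with hL
  have hline : HasDerivAt (fun s : ℝ => α.fermi θ (u, s)) (turn a) 0 := by
    have := ((hasDerivAt_id (0 : ℝ)).smul_const (turn a)).const_add (α.read θ u)
    simpa [ClosedCurve.fermi] using this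
  refine ⟨L (turn a), ?_, ?_, ?_, ?_⟩
  · have h1 : ContinuousAt φ.symm (α.fermi θ (u, 0)) := by
      rw [hfermi]
      exact φ.continuousAt_symm (φ.map_source hu)
    exact ContinuousAt.comp (f := fun s : ℝ => α.fermi θ (u, s)) h1 hline.continuousAt
  · rw [hfermi, φ.left_inv hu]
  · have h1 : HasFDerivAt (φ.symm.trans φ') L (α.fermi θ (u, 0)) := by
      rw [hfermi]
      exact hTd
    exact h1.comp_hasDerivAt (0 : ℝ) hline
  -- The velocity at the shifted parameter is read in another chart; the change of charts multiplies
  -- the frame determinant by a positive number.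
  · have hvel : α.velocity (θ + (u : UnitAddCircle)) = L (deriv (α.read θ) u) := by
      have h1 : HasDerivAt (α.read θ) (deriv (α.read θ) u) (u + 0) := by
        rw [add_zero]
        exact ((α.contDiffAt_read θ hu).differentiableAt (by simp)).hasDerivAt
      have h2 : HasDerivAt (fun v => α.read θ (u + v)) (deriv (α.read θ) u) 0 :=
        h1.comp_const_add u 0
      have h3 : HasFDerivAt (φ.symm.trans φ') L (α.read θ (u + 0)) := by
        rw [add_zero, hread]
        exact hTd
      have h4 := h3.comp_hasDerivAt (0 : ℝ) h2
      refine (HasDerivAt.congr_of_eventuallyEq h4 ?_).unique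
        (α.hasDerivAt (θ + (u : UnitAddCircle))) |>.symm
      have h5 : ∀ᶠ v : ℝ in 𝓝 0, α.toFun (θ + ((u + v : ℝ) : UnitAddCircle)) ∈ φ.source := by
        refine (φ.open_source.preimage ((α.continuous_shift θ).comp
          (continuous_const.add continuous_id))).mem_nhds ?_
        simpa using hu
      filter_upwards [h5] with v hv
      simp only [Function.comp_apply, OpenPartialHomeomorph.trans_apply, ClosedCurve.read]
      rw [← hφ, φ.left_inv hv, AddCircle.coe_add, add_assoc]
    rw [hvel, frameDet_map]
    exact mul_pos hdet hdu

/-- The normal coordinate line of the chart at `θ` through a nearby point of the curve crosses the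
curve there. Its sign can be read off both from the side at `θ` and from the side at that point, and
orientation makes the two agree. -/
theorem IsSide.eventually [T2Space S] (hS : IsOrientedAtlas S) {f : S → ℝ} {α : SimpleClosedCurve S}
    (hf : IsDefining f α) {θ : UnitAddCircle} {ε : ℤˣ} (h : IsSide f α θ ε) :
    ∀ᶠ η in 𝓝 θ, IsSide f α η ε := by
  have hmap : Filter.map (fun u : ℝ => θ + (u : UnitAddCircle)) (𝓝 0) = 𝓝 θ := by
    have ho : IsOpenMap (fun u : ℝ => θ + (u : UnitAddCircle)) :=
      (isOpenMap_add_left θ).comp QuotientAddGroup.isOpenMap_coe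
    have := ho.map_nhds_eq (x := 0)
      (continuous_const.add (AddCircle.continuous_mk' (1 : ℝ))).continuousAt
    rwa [AddCircle.coe_zero, add_zero] at this
  rw [← hmap, Filter.eventually_map]
  have h1 : ∀ᶠ u : ℝ in 𝓝 0, ∀ᶠ q : ℝ × ℝ in 𝓝 (u, 0), q.2 ≠ 0 →
      0 < ((ε : ℤ) : ℝ) * q.2 * f ((chartAt Plane (α.toFun θ)).symm (α.fermi θ q)) :=
    ((Continuous.prodMk_left (0 : ℝ)).tendsto (0 : ℝ)).eventually (Filter.Eventually.eventually_nhds h)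
  filter_upwards [h1, α.eventually_frame hS θ (α.immersed θ)] with u hu hfr
  obtain ⟨b, hc, h0, hb, hpos⟩ := hfr
  obtain ⟨δ, hδ⟩ := hf.exists_isSide (θ + (u : UnitAddCircle))
  have h2 := hδ.eventually_path hc h0 hb hpos.ne'
  have h3 := ((Continuous.prodMk_right u).tendsto (0 : ℝ)).eventually hu
  have h4 : ∀ᶠ s : ℝ in 𝓝[≠] 0, ε = δ := by
    filter_upwards [nhdsWithin_le_nhds h2, nhdsWithin_le_nhds h3, self_mem_nhdsWithin] with s h5 h6 hs
    have h5 := h5 hs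
    have h6 := h6 hs
    rw [mul_assoc] at h5 h6
    exact units_eq_of_mul_pos hpos h6 h5
  obtain ⟨s, rfl⟩ := h4.exists
  exact hδ

/-- On an oriented surface the sides of a simple closed curve are globally defined. -/
theorem IsDefining.exists_forall_isSide [T2Space S] (hS : IsOrientedAtlas S) {f : S → ℝ}
    {α : SimpleClosedCurve S} (hf : IsDefining f α) : ∃ ε, ∀ θ, IsSide f α θ ε := by
  obtain ⟨ε, hε⟩ := hf.exists_isSide 0
  refine ⟨ε, ?_⟩
  have ho : ∀ δ, IsOpen {θ | IsSide f α θ δ} := fun δ =>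
    isOpen_iff_eventually.2 fun θ hθ => IsSide.eventually hS hf hθ
  -- The complement consists of the parameters with the opposite side, which is open as well; the
  -- circle is connected.
  have hc : IsClopen {θ | IsSide f α θ ε} := by
    refine ⟨⟨?_⟩, ho ε⟩
    convert ho (-ε) using 1
    ext θ
    constructor
    · intro h
      obtain ⟨δ, hδ⟩ := hf.exists_isSide θ
      rcases Int.units_eq_one_or ε with rfl | rfl <;> rcases Int.units_eq_one_or δ with rfl | rfl
      · exact absurd hδ h
      · exact hδ
      · simpa using hδ
      · exact absurd hδ h
    · intro h h'
      have h1 := IsSide.eq h h'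
      rcases Int.units_eq_one_or ε with rfl | rfl <;> exact absurd h1 (by decide)
  rcases isClopen_iff.1 hc with h | h
  · exact absurd (show (0 : UnitAddCircle) ∈ {θ | IsSide f α θ ε} from hε) (by simp [h])
  · exact fun θ => Set.eq_univ_iff_forall.1 h θ

end

end HeegaardGauss
end

open scoped Manifold ContDiff Topology
noncomputable section
namespace HeegaardGauss

/-! ### Degrees as algebraic intersection numbers -/

section

/-- The representative in `[-1/2, 1/2)` of a point of the circle relative to the point `1/2`. -/
def excess (w : UnitAddCircle) : ℝ := (AddCircle.equivIco 1 0 w : ℝ) - 1 / 2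

theorem excess_coe (x : ℝ) : excess (x : UnitAddCircle) = Int.fract x - 1 / 2 := by
  have h := AddCircle.coe_equivIco_mk_apply (p := (1 : ℝ)) x
  rw [div_one, mul_one] at h
  exact congrArg (· - (1 / 2 : ℝ)) h

theorem excess_eq_zero_iff (w : UnitAddCircle) : excess w = 0 ↔ w = ((1 / 2 : ℝ) : UnitAddCircle) := by
  obtain ⟨x, rfl⟩ := QuotientAddGroup.mk_surjective w
  have h1 : excess ((x : ℝ) : UnitAddCircle) = Int.fract x - 1 / 2 := excess_coe x
  have h2 : ((Int.fract x : ℝ) : UnitAddCircle) = (x : UnitAddCircle) := by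
    rw [Int.fract, AddCircle.coe_sub]
    have : (((⌊x⌋ : ℤ) : ℝ) : UnitAddCircle) = 0 := by
      rw [AddCircle.coe_eq_zero_iff]
      exact ⟨⌊x⌋, by simp⟩
    rw [this, sub_zero]
  constructor
  · intro h
    have h3 : excess ((x : ℝ) : UnitAddCircle) = 0 := h
    rw [h1, sub_eq_zero] at h3
    change (x : UnitAddCircle) = _
    rw [← h2, h3]
  · intro h
    rw [h, excess_coe, Int.fract_eq_self.2 (by norm_num)]
    norm_num

/-- The only jump is at the base point, opposite to the level `1/2`, so `excess` can serve to define
a curve near that level. -/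
theorem continuousAt_excess {w : UnitAddCircle} (hw : w ≠ 0) : ContinuousAt excess w :=
  (continuous_subtype_val.continuousAt.comp
    (AddCircle.continuousAt_equivIco (1 : ℝ) 0 (by rwa [AddCircle.coe_zero]))).sub continuousAt_const

variable {S : Type} [TopologicalSpace S] [ChartedSpace Plane S]

theorem crossingSign_mul_pos {α β : ClosedCurve S} {θ η : UnitAddCircle} {ε : ℤˣ} {v x : ℝ}
    (h0 : frameDet (α.velocity θ) (β.velocity η) ≠ 0)
    (h : 0 < ((ε : ℤ) : ℝ) * frameDet (α.velocity θ) (β.velocity η) * v * x) :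
    0 < (((ε * crossingSign α β θ η : ℤˣ) : ℤ) : ℝ) * v * x := by
  unfold crossingSign
  set c := frameDet (α.velocity θ) (β.velocity η)
  split_ifs with hc
  · rw [mul_one]
    refine pos_of_mul_pos_left (b := c) ?_ hc.le
    linarith
  · have hc' : 0 < -c := by
      rcases lt_or_gt_of_ne h0 with h1 | h1
      · linarith
      · exact absurd h1 hc
    refine pos_of_mul_pos_left (b := -c) ?_ hc'.le
    simp only [mul_neg, mul_one, Units.val_neg, Int.cast_neg]
    linarith

variable [IsManifold (𝓡 2) ∞ S]

theorem IsSide.eventually_curve {f : S → ℝ} {α : SimpleClosedCurve S} {ε : ℤˣ} {θ : UnitAddCircle}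
    (h : IsSide f α θ ε) {γ : ClosedCurve S} (ht : Transverse α.toClosedCurve γ) {t : ℝ}
    (hθ : α.toFun θ = γ.toFun (t : UnitAddCircle)) :
    ∀ᶠ v in 𝓝 t, v ≠ t →
      0 < (((ε * crossingSign α.toClosedCurve γ θ (t : UnitAddCircle) : ℤˣ) : ℤ) : ℝ) * (v - t) *
        f (γ.toFun (v : UnitAddCircle)) := by
  have hb := γ.hasDerivAt (t : UnitAddCircle)
  rw [← hθ] at hb
  have h0 := ht _ _ hθ
  have h1 := h.eventually_path (γ.continuous_shift (t : UnitAddCircle)).continuousAt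
    (by rw [AddCircle.coe_zero, add_zero, hθ]) hb h0
  have h2 : Filter.Tendsto (fun v : ℝ => v - t) (𝓝 t) (𝓝 0) := by
    have h3 : Continuous fun v : ℝ => v - t := by fun_prop
    simpa using h3.tendsto t
  filter_upwards [h2.eventually h1] with v hv hvt
  have h3 := hv (sub_ne_zero.2 hvt)
  rw [← AddCircle.coe_add, add_sub_cancel] at h3
  exact crossingSign_mul_pos h0 h3

open Classical in
/-- The winding number of the image of a transverse closed curve under a map to the circle, for
which a simple closed curve is the preimage of a point, is an intersection number. -/
theorem wind_eq_algebraicIntersection [T2Space S] {F : C(S, UnitAddCircle)}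
    {α : SimpleClosedCurve S} (hf : IsDefining (fun s => excess (F s)) α) {ε : ℤˣ}
    (hε : ∀ θ, IsSide (fun s => excess (F s)) α θ ε) {γ : ClosedCurve S}
    (htr : Transverse α.toClosedCurve γ) :
    wind (loopClass (F.comp ⟨γ.toFun, γ.continuous⟩)) =
      ε * algebraicIntersection α.toClosedCurve γ := by
  obtain ⟨g, hg⟩ := exists_lift_circle (A := ℝ)
    (F.comp ⟨fun t : ℝ => γ.toFun (t : UnitAddCircle),
      γ.continuous.comp (AddCircle.continuous_mk' (1 : ℝ))⟩)
  have hg' : ∀ t : ℝ, (g t : UnitAddCircle) = F (γ.toFun (t : UnitAddCircle)) := hg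
  have hex : ∀ t : ℝ, excess (F (γ.toFun (t : UnitAddCircle))) = Int.fract (g t) - 1 / 2 := fun t => by
    rw [← hg', excess_coe]
  have hw := wind_loopClass (γ := F.comp ⟨γ.toFun, γ.continuous⟩) g.continuous fun t _ => hg' t
  have hfin := finite_crossings α.toClosedCurve γ htr
  have hcross : ∀ t : ℝ, Int.fract (g t) = 1 / 2 ↔
      ∃ θ, α.toFun θ = γ.toFun (t : UnitAddCircle) := fun t => by
    rw [← sub_eq_zero, ← hex, hf.zero]
    exact Iff.rfl
  -- The chosen parameter on `α` is unique because `α` is simple; the value away from crossings is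
  -- irrelevant.
  let σ : ℝ → ℤ := fun t => if h : ∃ θ, α.toFun θ = γ.toFun (t : UnitAddCircle) then
    ((ε * crossingSign α.toClosedCurve γ h.choose (t : UnitAddCircle) : ℤˣ) : ℤ) else 1
  have hσ : ∀ (θ : UnitAddCircle) (t : ℝ), α.toFun θ = γ.toFun (t : UnitAddCircle) →
      σ t = ((ε * crossingSign α.toClosedCurve γ θ (t : UnitAddCircle) : ℤˣ) : ℤ) := by
    intro θ t h
    have h1 : ∃ θ, α.toFun θ = γ.toFun (t : UnitAddCircle) := ⟨θ, h⟩
    have h2 : h1.choose = θ := α.injective (h1.choose_spec.trans h.symm)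
    simp only [σ, dif_pos h1, h2]
  let X := hfin.toFinset
  -- Representatives in `(0, 1]`, so that a crossing at the base point is counted at `1` and not at
  -- `0`, in accordance with `sub_eq_sum_crossings`.
  let r : UnitAddCircle → ℝ := fun η => (AddCircle.equivIoc 1 0 η : ℝ)
  have hr : ∀ η, ((r η : ℝ) : UnitAddCircle) = η := fun η =>
    (AddCircle.equivIoc 1 0).symm_apply_apply η
  have hr1 : ∀ η, r η ∈ Set.Ioc (0 : ℝ) 1 := fun η => by
    simpa using (AddCircle.equivIoc (1 : ℝ) 0 η).2
  have hr2 : ∀ t ∈ Set.Ioc (0 : ℝ) 1, r (t : UnitAddCircle) = t := fun t ht => by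
    have := (AddCircle.equivIoc (1 : ℝ) 0).apply_symm_apply ⟨t, by simpa using ht⟩
    exact congrArg Subtype.val this
  let T₀ : Finset ℝ := X.image fun x => r x.2
  have hT₀ : ∀ t ∈ T₀, t ∈ Set.Ioc (0 : ℝ) 1 ∧ Int.fract (g t) = 1 / 2 := by
    intro t ht
    obtain ⟨x, hx, rfl⟩ := Finset.mem_image.1 ht
    refine ⟨hr1 _, (hcross _).2 ⟨x.1, ?_⟩⟩
    rw [hr]
    exact hfin.mem_toFinset.1 hx
  have hT₀' : ∀ t ∈ Set.Ioc (0 : ℝ) 1, Int.fract (g t) = 1 / 2 → t ∈ T₀ := by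
    intro t ht h
    obtain ⟨θ, hθ⟩ := (hcross t).1 h
    exact Finset.mem_image.2 ⟨(θ, (t : UnitAddCircle)), hfin.mem_toFinset.2 hθ, hr2 t ht⟩
  let T : Finset ℝ := (insert 0 T₀).filter fun t => Int.fract (g t) = 1 / 2
  have hT : ∀ t, t ∈ T ↔ (t = 0 ∨ t ∈ T₀) ∧ Int.fract (g t) = 1 / 2 := fun t => by
    rw [Finset.mem_filter, Finset.mem_insert]
  have hcoe1 : ((1 : ℝ) : UnitAddCircle) = ((0 : ℝ) : UnitAddCircle) := by
    rw [AddCircle.coe_zero]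
    exact AddCircle.coe_period 1
  have key := sub_eq_sum_crossings (T := T) (σ := σ) g.continuous (fun t ht => ?_) (fun t ht => ?_)
    (fun t ht => ?_) (fun t ht => ?_)
    (n := wind (loopClass (F.comp ⟨γ.toFun, γ.continuous⟩))) (by rw [hw]; ring)
    (by simp only [σ, hcoe1])
  · have hfilter : T.filter (0 < ·) = T₀ := by
      ext t
      rw [Finset.mem_filter, hT]
      constructor
      · rintro ⟨⟨rfl | h, -⟩, h0⟩
        · exact absurd h0 (lt_irrefl _)
        · exact h
      · exact fun h => ⟨⟨.inr h, (hT₀ t h).2⟩, (hT₀ t h).1.1⟩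
    have hinj : Set.InjOn (fun x : UnitAddCircle × UnitAddCircle => r x.2) X := by
      intro x hx y hy hxy
      have hx' : α.toFun x.1 = γ.toFun x.2 := hfin.mem_toFinset.1 hx
      have hy' : α.toFun y.1 = γ.toFun y.2 := hfin.mem_toFinset.1 hy
      have h2 : x.2 = y.2 := by rw [← hr x.2, ← hr y.2]; exact congrArg _ hxy
      exact Prod.ext (α.injective (by rw [hx', hy', h2])) h2
    have hsum : algebraicIntersection α.toClosedCurve γ =
        ∑ x ∈ X, (crossingSign α.toClosedCurve γ x.1 x.2 : ℤ) := by
      unfold algebraicIntersection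
      have h1 := finsum_set_coe_eq_finsum_mem
        (f := fun x : UnitAddCircle × UnitAddCircle => (crossingSign α.toClosedCurve γ x.1 x.2 : ℤ))
        {x | α.toFun x.1 = γ.toFun x.2}
      refine h1.trans ?_
      rw [finsum_mem_eq_finite_toFinset_sum _ hfin]
    rw [key, hfilter, Finset.sum_image hinj, hsum, Finset.mul_sum]
    refine Finset.sum_congr rfl fun x hx => ?_
    have hx' : α.toFun x.1 = γ.toFun x.2 := hfin.mem_toFinset.1 hx
    rw [hσ x.1 (r x.2) (by rw [hr, hx']), hr, Units.val_mul]
  · rw [hT]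
    refine ⟨fun h => h.2, fun h => ⟨?_, h⟩⟩
    rcases ht.1.eq_or_lt with h0 | h0
    · exact .inl h0.symm
    · exact .inr (hT₀' t ⟨h0, ht.2⟩ h)
  · obtain ⟨θ, hθ⟩ := (hcross t).1 ((hT t).1 ht).2
    rw [hσ θ t hθ]
    rcases Int.units_eq_one_or (ε * crossingSign α.toClosedCurve γ θ (t : UnitAddCircle)) with h | h
    · exact .inl (by rw [h]; rfl)
    · exact .inr (by rw [h]; rfl)
  · obtain ⟨θ, hθ⟩ := (hcross t).1 ((hT t).1 ht).2
    rw [hσ θ t hθ]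
    filter_upwards [(hε θ).eventually_curve htr hθ] with v hv hvt
    have h1 := hv hvt
    rwa [hex] at h1
  · rcases ((hT t).1 ht).1 with rfl | h
    · exact ⟨le_rfl, zero_le_one⟩
    · exact Set.Ioc_subset_Icc_self (hT₀ t h).1

end

end HeegaardGauss
end

open scoped Manifold ContDiff Topology
noncomputable section
namespace HeegaardGauss

/-! ### The curves of a Heegaard diagram as level sets -/

section

variable {g : ℕ}

/-- Over a hole the depth does not depend on `x`, so near a meridian the boundary surface is a
product with an interval in the direction of `x`. -/
theorem depth_near_disc (i : Fin g) {x y z : ℝ} (hx : x ∈ Set.Icc (2 * (i : ℝ) + 1) (2 * (i : ℝ) + 2))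
    (hy : y ∈ Set.Icc (0 : ℝ) 1) :
    depth g (x, y, z) = min (min z (1 - z)) (min y (1 - y)) := by
  have h1 : cellDepth y = min y (1 - y) := by
    have := cellDepth_cell 0 (u := y - 1 / 2) (by linarith [hy.1]) (by linarith [hy.2])
    simp only [Int.cast_zero, mul_zero, zero_add, add_sub_cancel] at this
    rw [this]
    congr 1
    ring
  have h2 : cellDepth x ≤ 0 := by
    rcases le_total x (2 * (i : ℝ) + 3 / 2) with h | h
    · have := cellDepth_cell i (u := x - (2 * (i : ℝ) + 1 / 2)) (by linarith [hx.1]) (by linarith)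
      simp only [Int.cast_natCast, add_sub_cancel] at this
      rw [this]
      exact min_le_of_right_le (by linarith [hx.1])
    · have := cellDepth_cell (i + 1) (u := x - (2 * ((i : ℝ) + 1) + 1 / 2)) (by linarith)
        (by linarith [hx.2])
      simp only [Int.cast_add, Int.cast_one, Int.cast_natCast, add_sub_cancel] at this
      rw [this]
      exact min_le_of_left_le (by linarith [hx.2])
  have h3 : 0 ≤ min y (1 - y) := le_min hy.1 (by linarith [hy.2])
  have hi : (i : ℝ) + 1 ≤ g := by exact_mod_cast i.2
  have hi0 : (0 : ℝ) ≤ i := Nat.cast_nonneg _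
  rw [depth, h1, max_eq_right (h2.trans h3)]
  have h4 : min y (1 - y) ≤ 1 / 2 := by
    rcases le_total y (1 / 2) with h | h
    · exact (min_le_left _ _).trans h
    · exact (min_le_right _ _).trans (by linarith)
  refine min_eq_right ((min_le_right _ _).trans ?_)
  have h5 := hx.1
  have h6 := hx.2
  refine le_min (le_min ?_ ?_) (le_min (min_le_left _ _) ?_)
  · exact h4.trans (by dsimp only; linarith)
  · exact h4.trans (by dsimp only; linarith)
  · exact h4.trans (by dsimp only; linarith [hy.2])

variable {S M : Type} [TopologicalSpace S] [ChartedSpace Plane S] [TopologicalSpace M]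

namespace HeegaardDiagram

variable (D : HeegaardDiagram g S M)

/-- The splitting surface read in the model of the first handlebody, where the circle maps dual to
the discs are defined. -/
theorem exists_retract [T2Space M] : ∃ ρ : C(S, stdHandlebody g), (∀ s, D.pos.map (ρ s) = D.surface s) ∧
    Topology.IsEmbedding (fun s => (ρ s : ℝ × ℝ × ℝ)) ∧
    Set.range (fun s => (ρ s : ℝ × ℝ × ℝ)) = frontier (stdHandlebody g) := by
  have hfr : frontier (stdHandlebody g) ⊆ stdHandlebody g :=
    (isClosed_stdHandlebody g).frontier_subset
  have hmem : ∀ s, D.surface s ∈ D.pos.map '' stdHandlebody g := fun s => by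
    have h : D.surface s ∈ D.pos.boundary := D.pos_boundary ▸ ⟨s, rfl⟩
    exact Set.image_mono hfr h
  let e := D.pos.homeoImage (subset_refl (stdHandlebody g))
  let ρ : C(S, stdHandlebody g) := ⟨fun s => e.symm ⟨D.surface s, hmem s⟩,
    e.symm.continuous.comp (D.surface_isEmbedding.continuous.subtype_mk _)⟩
  have hρ : ∀ s, D.pos.map (ρ s) = D.surface s := fun s => by
    rw [← D.pos.coe_homeoImage (subset_refl (stdHandlebody g))]
    exact congrArg Subtype.val (e.apply_symm_apply ⟨D.surface s, hmem s⟩)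
  refine ⟨ρ, hρ, ?_, ?_⟩
  · refine Topology.IsEmbedding.subtypeVal.comp ?_
    rw [← D.pos.emb_isClosedEmbedding.isEmbedding.of_comp_iff]
    convert D.surface_isEmbedding using 1
    exact funext hρ
  · ext p
    constructor
    · rintro ⟨s, rfl⟩
      obtain ⟨q, hq, hqs⟩ : D.surface s ∈ D.pos.boundary := D.pos_boundary ▸ ⟨s, rfl⟩
      rw [← hρ] at hqs
      change (ρ s : ℝ × ℝ × ℝ) ∈ _
      rwa [← D.pos.injOn (hfr hq) (ρ s).2 hqs]
    · intro hp
      obtain ⟨s, hs⟩ : D.pos.map p ∈ Set.range D.surface := D.pos_boundary ▸ ⟨p, hp, rfl⟩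
      rw [← hρ] at hs
      exact ⟨s, D.pos.injOn (ρ s).2 (hfr hp) hs⟩

theorem isDefining_posCurve {ρ : C(S, stdHandlebody g)} (hρ : ∀ s, D.pos.map (ρ s) = D.surface s)
    (hemb : Topology.IsEmbedding (fun s => (ρ s : ℝ × ℝ × ℝ)))
    (hrange : Set.range (fun s => (ρ s : ℝ × ℝ × ℝ)) = frontier (stdHandlebody g)) (i : Fin g) :
    IsDefining (fun s => excess (((discMap i).comp ρ) s)) (D.posCurve i) := by
  have hfr : frontier (stdHandlebody g) ⊆ stdHandlebody g :=
    (isClosed_stdHandlebody g).frontier_subset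
  have hmem : ∀ s, s ∈ Set.range (D.posCurve i).toFun ↔ (ρ s : ℝ × ℝ × ℝ) ∈ stdMeridianDisc i := by
    intro s
    have hs : (ρ s : ℝ × ℝ × ℝ) ∈ frontier (stdHandlebody g) := hrange ▸ ⟨s, rfl⟩
    rw [← D.surface_isEmbedding.injective.mem_set_image, D.posCurve_eq, ← hρ]
    constructor
    · rintro ⟨p, hp, hps⟩
      rw [← D.pos.injOn (hfr hp.2) (ρ s).2 hps]
      exact hp.1
    · exact fun h => ⟨_, ⟨h, hs⟩, rfl⟩
  have hzero : ∀ s, excess (((discMap i).comp ρ) s) = 0 ↔ s ∈ Set.range (D.posCurve i).toFun :=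
    fun s => by rw [excess_eq_zero_iff, ContinuousMap.comp_apply, discMap_eq_half_iff, hmem]
  have hfreq : ∀ s ∈ Set.range (D.posCurve i).toFun, ∀ P : ℝ → Prop, (∃ᶠ e in 𝓝 (0 : ℝ), P e) →
      ∃ᶠ s' in 𝓝 s, P (excess (((discMap i).comp ρ) s')) := by
    intro s hs P hP
    obtain ⟨⟨x, y, z⟩, hp⟩ : ∃ p, (ρ s : ℝ × ℝ × ℝ) = p := ⟨_, rfl⟩
    have hd := (hmem s).1 hs
    have hs' : (ρ s : ℝ × ℝ × ℝ) ∈ frontier (stdHandlebody g) := hrange ▸ ⟨s, rfl⟩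
    rw [hp] at hd hs'
    obtain ⟨hx, hy, hz⟩ := hd
    dsimp only at hx hy hz
    rw [mem_frontier_iff, depth_near_disc i ⟨by linarith, by linarith⟩ hy] at hs'
    -- Sliding a point of the meridian by `e` along the arm stays on the surface and gives the
    -- function the value `e`; hence both signs occur arbitrarily near.
    have hpoint : ∀ e ∈ Set.Ioo (-(1 / 2) : ℝ) (1 / 2),
        ∃ s', (ρ s' : ℝ × ℝ × ℝ) = (x + e, y, z) ∧ excess (((discMap i).comp ρ) s') = e := by
      intro e he
      have h1 : ((x + e, y, z) : ℝ × ℝ × ℝ) ∈ frontier (stdHandlebody g) := by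
        rw [mem_frontier_iff, depth_near_disc i ⟨by linarith [he.1], by linarith [he.2]⟩ hy, hs']
      rw [← hrange] at h1
      obtain ⟨s', hs'⟩ := h1
      refine ⟨s', hs', ?_⟩
      have h2 : (ρ s' : ℝ × ℝ × ℝ) = (x + e, y, z) := hs'
      rw [ContinuousMap.comp_apply, discMap_of_le (by rw [h2]; dsimp only; linarith [hy.2]), h2,
        excess_coe]
      have h3 : max 0 (min 1 (x + e - (2 * (i : ℝ) + 1))) = 1 / 2 + e := by
        rw [min_eq_right (by linarith [he.2]), max_eq_right (by linarith [he.1]), hx]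
        ring
      dsimp only
      rw [h3, Int.fract_eq_self.2 ⟨by linarith [he.1], by linarith [he.2]⟩]
      ring
    rw [hemb.nhds_eq_comap, Filter.frequently_comap, hp]
    have ht : Filter.Tendsto (fun e : ℝ => ((x + e, y, z) : ℝ × ℝ × ℝ)) (𝓝 0) (𝓝 (x, y, z)) := by
      have : Continuous (fun e : ℝ => ((x + e, y, z) : ℝ × ℝ × ℝ)) := by fun_prop
      simpa using this.tendsto 0
    refine ht.frequently ?_
    refine (hP.and_eventually (Ioo_mem_nhds (show -(1 / 2) < (0 : ℝ) by norm_num)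
      (by norm_num : (0 : ℝ) < 1 / 2))).mono fun e he => ?_
    obtain ⟨s', h1, h2⟩ := hpoint e he.2
    exact ⟨s', h1, h2.symm ▸ he.1⟩
  refine ⟨hzero, fun s hs => ?_, fun s hs => hfreq s hs _ ?_, fun s hs => hfreq s hs (· < 0) ?_⟩
  · have h1 : ((discMap i).comp ρ) s ≠ 0 := by
      intro h
      have h2 := (hzero s).2 hs
      rw [h, ← AddCircle.coe_zero, excess_coe] at h2
      norm_num at h2
    filter_upwards [((discMap i).comp ρ).continuous.continuousAt.eventually_ne h1] with s' hs'
    exact ContinuousAt.comp (g := excess) (continuousAt_excess hs')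
      ((discMap i).comp ρ).continuous.continuousAt
  · exact (Filter.Eventually.frequently (f := 𝓝[>] (0 : ℝ)) self_mem_nhdsWithin).filter_mono
      nhdsWithin_le_nhds
  · exact (Filter.Eventually.frequently (f := 𝓝[<] (0 : ℝ)) self_mem_nhdsWithin).filter_mono
      nhdsWithin_le_nhds

variable [IsManifold (𝓡 2) ∞ S] [T2Space M]

open Classical in
theorem intersectionMatrix_eq (i j : Fin g) : D.gauss.intersectionMatrix i j =
    algebraicIntersection (D.posCurve i).toClosedCurve (D.negCurve j).toClosedCurve := by
  have := D.gauss.finite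
  let _ := Fintype.ofFinite D.gauss.Chord
  have h1 : D.gauss.intersectionMatrix i j = ∑ h : D.gauss.Chord,
      if (D.gauss.topEnd h).1 = i ∧ (D.gauss.botEnd h).1 = j then (D.gauss.sign h : ℤ) else 0 := rfl
  rw [h1, ← Finset.sum_filter]
  let e : {x : UnitAddCircle × UnitAddCircle //
      (D.posCurve i).toFun x.1 = (D.negCurve j).toFun x.2} → D.gauss.Chord :=
    fun x => ⟨((i, x.1.1), (j, x.1.2)), x.2⟩
  rw [← finsum_mem_finset_eq_sum]
  unfold algebraicIntersection
  symm
  rw [← finsum_mem_univ]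
  refine finsum_mem_eq_of_bijOn e ⟨?_, ?_, ?_⟩ ?_
  · intro x _
    simp only [Finset.coe_filter, Finset.mem_univ, true_and, Set.mem_ofPred_eq]
    exact ⟨rfl, rfl⟩
  · intro x _ y _ hxy
    have h2 := congrArg Subtype.val hxy
    simp only [e, Prod.mk.injEq, true_and] at h2
    exact Subtype.ext (Prod.ext h2.1 h2.2)
  · rintro ⟨⟨⟨a, θ⟩, b, η⟩, hx⟩ h
    simp only [Finset.coe_filter, Finset.mem_univ, true_and] at h
    obtain ⟨ha, hb⟩ := h
    change a = i at ha
    change b = j at hb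
    subst ha hb
    exact ⟨⟨(θ, η), hx⟩, Set.mem_univ _, rfl⟩
  · intro x _
    rfl

end HeegaardDiagram

end

end HeegaardGauss
end

open scoped Manifold ContDiff Topology
noncomputable section
namespace HeegaardGauss

/-! ### The homology of a Heegaard diagram -/

section

theorem nonempty_linearEquiv {X Y : Type*} [AddCommGroup X] [AddCommGroup Y] [Module ℤ X] [Module ℤ Y]
    (e : X ≃+ Y) : Nonempty (X ≃ₗ[ℤ] Y) :=
  ⟨e.toLinearEquiv fun c x => by simpa using map_intCast_smul e ℤ ℤ c x⟩

/-- Multiplication of coordinates by signs. -/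
def signEquiv {ι : Type*} (ε : ι → ℤˣ) : (ι → ℤ) ≃+ (ι → ℤ) where
  toFun a i := ε i * a i
  invFun a i := ε i * a i
  left_inv a := funext fun i => by dsimp only; rw [← mul_assoc, Int.units_coe_mul_self, one_mul]
  right_inv a := funext fun i => by dsimp only; rw [← mul_assoc, Int.units_coe_mul_self, one_mul]
  map_add' a b := funext fun i => mul_add _ _ _

theorem exists_addEquiv_of_bijective {X Y Z : Type*} [AddCommGroup X] [AddCommGroup Y]
    [AddCommGroup Z] {f : X →+ Y} (hf : Function.Bijective f) {d : X →+ Z}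
    (hd : Function.Bijective d) : ∃ Θ : Y ≃+ Z, ∀ x, Θ (f x) = d x :=
  ⟨(AddEquiv.ofBijective f hf).symm.trans (AddEquiv.ofBijective d hd), fun x =>
    congrArg d ((AddEquiv.ofBijective f hf).symm_apply_apply x)⟩

variable {g : ℕ} {S M : Type} [TopologicalSpace S] [ChartedSpace Plane S] [TopologicalSpace M]
  [T2Space M]

theorem frontier_stdHandlebody_nonempty (g : ℕ) : (frontier (stdHandlebody g)).Nonempty := by
  obtain ⟨⟨p, hp⟩⟩ := (inferInstance : Nonempty (stdHandlebody g))
  refine nonempty_frontier_iff.2 ⟨⟨p, hp⟩, fun h => ?_⟩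
  have : ((-1, 0, 0) : ℝ × ℝ × ℝ) ∈ stdHandlebody g := h ▸ Set.mem_univ _
  have := this.1.1
  norm_num at this

namespace HeegaardDiagram

variable (D : HeegaardDiagram g S M)

theorem isComplement_pos : D.neg.IsComplement D.pos.carrier :=
  ⟨D.pos.isClosed_image subset_rfl (isClosed_stdHandlebody g), D.union_eq,
    D.inter_eq.trans D.neg_boundary.symm⟩

omit [T2Space M] in
include D in
theorem pathConnectedSpace : PathConnectedSpace M := by
  have h : ∀ H : MarkedHandlebody g M, IsPathConnected H.carrier := fun H => by
    have := isPathConnected_range H.emb.continuous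
    convert this using 1
    ext x
    simp only [MarkedHandlebody.carrier, Set.mem_image, Set.mem_range, Subtype.exists]
    exact ⟨fun ⟨p, hp, hx⟩ => ⟨p, hp, hx⟩, fun ⟨p, hp, hx⟩ => ⟨p, hp, hx⟩⟩
  rw [pathConnectedSpace_iff_univ, ← D.union_eq]
  refine (h _).union (h _) ?_
  rw [D.inter_eq, ← D.pos_boundary]
  exact (frontier_stdHandlebody_nonempty g).image _

variable [IsManifold (𝓡 2) ∞ S]

/-- The first homology of the first handlebody, in coordinates in which a curve on the splitting
surface is given by its intersection numbers with the meridians. -/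
theorem exists_coordinates (hS : IsOrientedAtlas S) :
    ∃ (Θ : Homology 1 D.pos.carrier ≃+ (Fin g → ℤ)) (κ : C(S, D.pos.carrier)),
      (∀ s, (κ s : M) = D.surface s) ∧
      ∀ γ : ClosedCurve S, (∀ i, Transverse (D.posCurve i).toClosedCurve γ) →
        Θ (loopClass (κ.comp ⟨γ.toFun, γ.continuous⟩)) =
          fun i => algebraicIntersection (D.posCurve i).toClosedCurve γ := by
  have : T2Space S := D.surface_isEmbedding.t2Space
  obtain ⟨ρ, hρ, hemb, hrange⟩ := D.exists_retract
  have hdef := D.isDefining_posCurve hρ hemb hrange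
  choose ε hε using fun i => IsDefining.exists_forall_isSide hS (hdef i)
  obtain ⟨e, he, hbij⟩ : ∃ e : C(stdHandlebody g, D.pos.carrier), (∀ p, (e p : M) = D.pos.map p) ∧
      ∀ n, Function.Bijective (Hmap n e) :=
    D.pos.exists_parametrization_image (subset_refl (stdHandlebody g))
  -- The curve `m_i⁺` is oriented independently of the circle map of its disc. The resulting sign `ε
  -- i` is built into the coordinates, where it cancels the sign in `wind_eq_algebraicIntersection`.
  obtain ⟨Θ, hΘ⟩ := exists_addEquiv_of_bijective (hbij 1) (d := (signEquiv ε).toAddMonoidHom.comp (degrees g))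
    ((signEquiv ε).bijective.comp (degrees_bijective g))
  refine ⟨Θ, e.comp ρ, fun s => (he _).trans (hρ s), fun γ hγ => ?_⟩
  have h1 : loopClass ((e.comp ρ).comp ⟨γ.toFun, γ.continuous⟩) =
      Hmap 1 e (loopClass (ρ.comp ⟨γ.toFun, γ.continuous⟩)) := by
    rw [Hmap_loopClass, ContinuousMap.comp_assoc]
  rw [h1, hΘ]
  funext i
  change (ε i : ℤ) * degrees g (loopClass (ρ.comp ⟨γ.toFun, γ.continuous⟩)) i = _
  rw [degrees_loopClass, ← ContinuousMap.comp_assoc, wind_eq_algebraicIntersection (hdef i) (hε i) (hγ i),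
    ← mul_assoc, Int.units_coe_mul_self, one_mul]

/-- The homology of a space with a Heegaard diagram in terms of its intersection matrix. -/
theorem exists_presentation (hS : IsOrientedAtlas S) :
    ∃ q : (Fin g → ℤ) →+ Homology 1 M, Function.Surjective q ∧
      (∀ v, q v = 0 ↔ ∃ c, v = D.gauss.intersectionMatrix.mulVec c) ∧
      (∀ γ : ClosedCurve S, (∀ i, Transverse (D.posCurve i).toClosedCurve γ) →
        q (fun i => algebraicIntersection (D.posCurve i).toClosedCurve γ) = loopClass (D.loop γ)) ∧
      ((∀ c, D.gauss.intersectionMatrix.mulVec c = 0 → c = 0) →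
        Subsingleton (Homology 2 M) ∧ Nonempty (Homology 3 M ≃+ ℤ) ∧
        ∀ n, Subsingleton (Homology (n + 4) M)) := by
  obtain ⟨Θ, κ, hκ, hΘ⟩ := D.exists_coordinates hS
  have hA2 : ∀ n, Subsingleton (Homology (n + 2) D.pos.carrier) := fun n => by
    obtain ⟨e, -, he⟩ : ∃ e : C(stdHandlebody g, D.pos.carrier), (∀ p, (e p : M) = D.pos.map p) ∧
        ∀ n, Function.Bijective (Hmap n e) := D.pos.exists_parametrization_image (subset_refl (stdHandlebody g))
    exact (AddEquiv.ofBijective (Hmap (n + 2) e) (he (n + 2))).symm.toEquiv.subsingleton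
  have hκ' : Function.Injective κ := fun s t hst =>
    D.surface_isEmbedding.injective (by rw [← hκ, ← hκ, hst])
  let μ : Fin g → C(UnitAddCircle, D.pos.carrier) := fun j =>
    κ.comp ⟨(D.negCurve j).toFun, (D.negCurve j).continuous⟩
  -- The second handlebody is glued to the first along the curves `m_j⁻`.
  obtain ⟨h1, h2, h3⟩ := D.isComplement_pos.homology_glued (μ := μ)
    (fun j => hκ'.comp (D.negCurve j).injective) (fun j => by
      rw [← D.negCurve_eq, ← Set.range_comp]
      exact congrArg Set.range (funext fun θ => hκ _)) hA2
  have hμ : ∀ c : Fin g → ℤ,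
      Θ (∑ j, c j • loopClass (μ j)) = D.gauss.intersectionMatrix.mulVec c := fun c => by
    rw [map_sum]
    funext i
    rw [Finset.sum_apply, Matrix.mulVec, dotProduct]
    refine Finset.sum_congr rfl fun j _ => ?_
    rw [map_zsmul, hΘ (D.negCurve j).toClosedCurve fun i => D.transverse i j, D.intersectionMatrix_eq,
      Pi.smul_apply, smul_eq_mul, mul_comm]
  refine ⟨(Hmap 1 ⟨Subtype.val, continuous_subtype_val⟩).comp Θ.symm.toAddMonoidHom,
    h1.comp Θ.symm.surjective, fun v => ?_, fun γ hγ => ?_, fun h => h3 fun c hc => h c ?_⟩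
  · refine (h2 _).trans (exists_congr fun c => ?_)
    rw [← hμ]
    exact Θ.symm_apply_eq
  · have h4 : Θ.symm (fun i => algebraicIntersection (D.posCurve i).toClosedCurve γ) =
        loopClass (κ.comp ⟨γ.toFun, γ.continuous⟩) := by
      rw [Θ.symm_apply_eq, hΘ γ hγ]
    refine (congrArg _ h4).trans ((Hmap_loopClass _ _).trans (congrArg loopClass ?_))
    ext θ
    exact hκ _
  · rw [← hμ, hc, map_zero]

/-- One direction uses degree one only: a matrix with trivial cokernel is invertible. In the other,
invertibility kills degree one and also gives the independence of the attaching classes that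
controls degrees two and above. -/
theorem isHomologySphere_iff (hS : IsOrientedAtlas S) :
    IsHomologySphere M ↔ IsUnit D.gauss.intersectionMatrix.det := by
  obtain ⟨q, hq, hker, -, hhigh⟩ := D.exists_presentation hS
  rw [← Matrix.isUnit_iff_isUnit_det]
  constructor
  · intro h
    rw [← Matrix.mulVec_surjective_iff_isUnit]
    intro v
    obtain ⟨e⟩ := h 1
    have : Subsingleton (Homology 1 S3) := subsingleton_homology_sphere_one
    have : Subsingleton (Homology 1 M) := e.toEquiv.subsingleton
    obtain ⟨c, hc⟩ := (hker v).1 (Subsingleton.elim _ _)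
    exact ⟨c, hc.symm⟩
  · intro h
    have hsurj := Matrix.mulVec_surjective_iff_isUnit.2 h
    have hone : Subsingleton (Homology 1 M) := by
      refine subsingleton_of_forall_eq 0 fun x => ?_
      obtain ⟨v, rfl⟩ := hq x
      obtain ⟨c, rfl⟩ := hsurj v
      exact (hker _).2 ⟨c, rfl⟩
    obtain ⟨h2, ⟨e3⟩, h4⟩ := hhigh fun c hc =>
      Matrix.eq_zero_of_mulVec_eq_zero ((Matrix.isUnit_iff_isUnit_det _).1 h).ne_zero hc
    have := D.pathConnectedSpace
    have htriv : ∀ k, Subsingleton (Homology k M) → Subsingleton (Homology k S3) →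
        Nonempty (Homology k M ≃ₗ[ℤ] Homology k S3) := fun k _ _ => ⟨0, 0, fun _ => Subsingleton.elim _ _,
          fun _ => Subsingleton.elim _ _⟩
    intro k
    match k with
    | 0 =>
      obtain ⟨e⟩ := homology_sphere_zero
      exact nonempty_linearEquiv ((AddEquiv.ofBijective (aug M) aug_bijective).trans e.symm)
    | 1 => exact htriv 1 hone subsingleton_homology_sphere_one
    | 2 => exact htriv 2 h2 subsingleton_homology_sphere_two
    | 3 =>
      obtain ⟨e⟩ := homology_sphere_three
      exact nonempty_linearEquiv (e3.trans e.symm)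
    | n + 4 => exact htriv (n + 4) (h4 n) (subsingleton_homology_sphere n)

/-- The relations are the columns of the matrix, whose span is the range of `mulVec` and so the
kernel of the presentation; the isomorphism is the inverse of the induced map on the quotient. -/
theorem exists_linearEquiv (hS : IsOrientedAtlas S) :
    ∃ φ : Homology 1 M ≃ₗ[ℤ]
        (Fin g → ℤ) ⧸ Submodule.span ℤ
          (Set.range fun j : Fin g => fun i : Fin g => D.gauss.intersectionMatrix i j),
      ∀ γ : ClosedCurve S, (∀ i, Transverse (D.posCurve i).toClosedCurve γ) →
        φ (loopClass (D.loop γ)) = Submodule.Quotient.mk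
          (fun i => algebraicIntersection (D.posCurve i).toClosedCurve γ) := by
  obtain ⟨q, hq, hker, hloop, -⟩ := D.exists_presentation hS
  let Q : (Fin g → ℤ) →ₗ[ℤ] Homology 1 M :=
    { toFun := q
      map_add' := map_add q
      map_smul' := fun c x => by simpa using map_intCast_smul q ℤ ℤ c x }
  have hQ : Submodule.span ℤ
      (Set.range fun j : Fin g => fun i : Fin g => D.gauss.intersectionMatrix i j) =
      LinearMap.ker Q := by
    ext v
    rw [LinearMap.mem_ker]
    refine Iff.trans ?_ (hker v).symm
    rw [show (fun j : Fin g => fun i : Fin g => D.gauss.intersectionMatrix i j) =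
      D.gauss.intersectionMatrix.col from rfl, ← Matrix.range_mulVecLin]
    exact exists_congr fun c => eq_comm
  let φ := (Submodule.quotEquivOfEq _ _ hQ).trans (Q.quotKerEquivOfSurjective hq)
  refine ⟨φ.symm, fun γ hγ => ?_⟩
  rw [LinearEquiv.symm_apply_eq, ← hloop γ hγ]
  rfl

end HeegaardDiagram

end

end HeegaardGauss
end

open HeegaardGauss in
theorem mainTheorem8 (g : ℕ)
    {M : Type} [TopologicalSpace M] [T2Space M] [CompactSpace M]
    [ChartedSpace (EuclideanSpace ℝ (Fin 3)) M]
    {S : Type} [TopologicalSpace S] [ChartedSpace Plane S] [IsManifold (𝓡 2) ∞ S]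
    (hS : IsOrientedAtlas S) (D : HeegaardDiagram g S M) :
    (∃ φ : Homology 1 M ≃ₗ[ℤ]
        (Fin g → ℤ) ⧸ Submodule.span ℤ
          (Set.range fun j : Fin g => fun i : Fin g => D.gauss.intersectionMatrix i j),
      ∀ γ : ClosedCurve S, (∀ i, Transverse (D.posCurve i).toClosedCurve γ) →
        ∃ c : Homology 1 M, IsLoopClass (D.loop γ) c ∧
          φ c = Submodule.Quotient.mk
            (fun i => algebraicIntersection (D.posCurve i).toClosedCurve γ)) ∧
    (IsHomologySphere M ↔ IsUnit D.gauss.intersectionMatrix.det) := by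
  obtain ⟨φ, hφ⟩ := D.exists_linearEquiv hS
  exact ⟨⟨φ, fun γ hγ => ⟨_, isLoopClass_loopClass _, hφ γ hγ⟩⟩, D.isHomologySphere_iff hS⟩
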